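/- **Theorem.** All groups are discrete and countable. For such a group $G$ let $C^*_rG$ be its reduced $C^*$-algebra, i.e. the norm closure in $\mathcal B(\ell^2 G)$ of the $*$-algebra generated by the left regular representation, and let $\operatorname{tr}_G\colon K_0(C^*_rG)\to\mathbb R$ be the homomorphism induced by the canonical trace $a\mapsto\langle\delta_1,a\,\delta_1\rangle$, which extends $\sum_g\lambda_g g\mapsto\lambda_1$ on $\mathbb C G$. Let $G$ and $H$ be countable groups and let $A\subset\mathbb R$ be a subset with $\operatorname{tr}_H(K_0(C^*_rH))\subset A$. Let $\Delta$ and $\Omega$ be sets with commuting actions of $G$ from the left and of $H$ from the right, such that $\Delta$ and $\Omega$ are free $H$-sets. Suppose that $\Delta$ is a free $G$-set and that $\Omega=\Omega'\sqcup X$ is a disjoint union, where $\Omega'$ is $G$-invariant and a free $G$-set, and $X$ is the union of exactly $r$ distinct $H$-orbits, $1\le r<\infty$. Suppose that there is a bijection $\phi\colon\Delta\to\Omega$ with $\phi(xh)=\phi(x)h$ for all $x\in\Delta$, $h\in H$, such that for every $g\in G$ the set $$R_g:=\{x\in\Delta\mid \phi(gx)\neq g\,\phi(x)\}$$ is contained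 in the union of finitely many $H$-orbits of $\Delta$. Then $$\operatorname{tr}_G(K_0(C^*_rG))\subset \tfrac1r A=\{\tfrac1r a\mid a\in A\}.$$ -/

import Mathlib

open scoped ComplexInnerProductSpace

/-! ### The `K₀`-group of a unital `*`-ring, by projections in matrices -/

section KTheory

/-- Murray–von Neumann equivalence of square matrices, possibly of different sizes:
`p = v v*` and `q = v* v` for some rectangular matrix `v`. -/
def MvN {A : Type*} [Ring A] [StarRing A] {ι κ : Type*} [Fintype ι] [Fintype κ]
    (p : Matrix ι ι A) (q : Matrix κ κ A) : Prop :=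
  ∃ v : Matrix ι κ A, v * v.conjTranspose = p ∧ v.conjTranspose * v = q

theorem MvN.refl {A : Type*} [Ring A] [StarRing A] {ι : Type*} [Fintype ι]
    {p : Matrix ι ι A} (hp : IsStarProjection p) : MvN p p := by
  have h1 : p.conjTranspose = p := hp.isSelfAdjoint
  have h2 : p * p = p := hp.isIdempotentElem
  exact ⟨p, by rw [h1, h2], by rw [h1, h2]⟩

theorem MvN.symm {A : Type*} [Ring A] [StarRing A] {ι κ : Type*} [Fintype ι] [Fintype κ]
    {p : Matrix ι ι A} {q : Matrix κ κ A} (h : MvN p q) : MvN q p := by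
  obtain ⟨v, h1, h2⟩ := h
  exact ⟨v.conjTranspose, by rwa [Matrix.conjTranspose_conjTranspose],
    by rwa [Matrix.conjTranspose_conjTranspose]⟩

theorem MvN.trans {A : Type*} [Ring A] [StarRing A] {ι κ μ : Type*} [Fintype ι] [Fintype κ]
    [Fintype μ] {p : Matrix ι ι A} {q : Matrix κ κ A} {s : Matrix μ μ A}
    (hp : IsStarProjection p) (hs : IsStarProjection s)
    (h : MvN p q) (h' : MvN q s) : MvN p s := by
  obtain ⟨v, h1, h2⟩ := h
  obtain ⟨w, h3, h4⟩ := h'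
  have e1 : p * p = p := hp.isIdempotentElem
  have e2 : s * s = s := hs.isIdempotentElem
  refine ⟨v * w, ?_, ?_⟩
  · calc v * w * (v * w).conjTranspose
        = v * (w * w.conjTranspose) * v.conjTranspose := by
          simp only [Matrix.conjTranspose_mul, Matrix.mul_assoc]
      _ = (v * v.conjTranspose) * (v * v.conjTranspose) := by
          rw [h3, ← h2]; simp only [Matrix.mul_assoc]
      _ = p := by rw [h1, e1]
  · calc (v * w).conjTranspose * (v * w)
        = w.conjTranspose * (v.conjTranspose * v) * w := by
          simp only [Matrix.conjTranspose_mul, Matrix.mul_assoc]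
      _ = (w.conjTranspose * w) * (w.conjTranspose * w) := by
          rw [h2, ← h3]; simp only [Matrix.mul_assoc]
      _ = s := by rw [h4, e2]

theorem isStarProjection_submatrix {A : Type*} [Ring A] [StarRing A] {ι κ : Type*} [Fintype ι]
    [Fintype κ] {p : Matrix ι ι A} (hp : IsStarProjection p) (e : κ ≃ ι) :
    IsStarProjection (p.submatrix e e) := by
  have h1 : p.conjTranspose = p := hp.isSelfAdjoint
  have h2 : p * p = p := hp.isIdempotentElem
  constructor
  · change p.submatrix e e * p.submatrix e e = p.submatrix e e
    rw [Matrix.submatrix_mul_equiv, h2]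
  · change (p.submatrix e e).conjTranspose = p.submatrix e e
    rw [Matrix.conjTranspose_submatrix, h1]

theorem MvN.submatrix {A : Type*} [Ring A] [StarRing A] {ι κ : Type*} [Fintype ι]
    [Fintype κ] {p : Matrix ι ι A} (hp : IsStarProjection p) (e : κ ≃ ι) :
    MvN p (p.submatrix e e) := by
  have h1 : p.conjTranspose = p := hp.isSelfAdjoint
  have h2 : p * p = p := hp.isIdempotentElem
  refine ⟨p.submatrix id e, ?_, ?_⟩
  · rw [Matrix.conjTranspose_submatrix, h1, Matrix.submatrix_mul_equiv, h2, Matrix.submatrix_id_id]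
  · rw [Matrix.conjTranspose_submatrix, h1]
    have := Matrix.submatrix_mul_equiv p p e (Equiv.refl ι) e
    simpa [h2] using this

/-- The block diagonal sum of two square matrices. -/
def blockSum {A : Type*} [Ring A] {ι κ : Type*} (p : Matrix ι ι A) (q : Matrix κ κ A) :
    Matrix (ι ⊕ κ) (ι ⊕ κ) A :=
  Matrix.fromBlocks p 0 0 q

theorem isStarProjection_blockSum {A : Type*} [Ring A] [StarRing A] {ι κ : Type*} [Fintype ι]
    [Fintype κ] {p : Matrix ι ι A} {q : Matrix κ κ A} (hp : IsStarProjection p)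
    (hq : IsStarProjection q) : IsStarProjection (blockSum p q) := by
  have h1 : p.conjTranspose = p := hp.isSelfAdjoint
  have h2 : p * p = p := hp.isIdempotentElem
  have h3 : q.conjTranspose = q := hq.isSelfAdjoint
  have h4 : q * q = q := hq.isIdempotentElem
  constructor
  · change blockSum p q * blockSum p q = blockSum p q
    simp [blockSum, Matrix.fromBlocks_multiply, h2, h4]
  · change (blockSum p q).conjTranspose = blockSum p q
    simp [blockSum, Matrix.fromBlocks_conjTranspose, h1, h3]

theorem MvN.blockSum {A : Type*} [Ring A] [StarRing A] {ι κ ι' κ' : Type*} [Fintype ι]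
    [Fintype κ] [Fintype ι'] [Fintype κ'] {p : Matrix ι ι A} {q : Matrix κ κ A}
    {p' : Matrix ι' ι' A} {q' : Matrix κ' κ' A} (h : MvN p p') (h' : MvN q q') :
    MvN (blockSum p q) (blockSum p' q') := by
  obtain ⟨v, h1, h2⟩ := h
  obtain ⟨w, h3, h4⟩ := h'
  refine ⟨Matrix.fromBlocks v 0 0 w, ?_, ?_⟩ <;>
    simp [_root_.blockSum, Matrix.fromBlocks_multiply, Matrix.fromBlocks_conjTranspose, h1, h2,
      h3, h4]

/-- A projection in some matrix ring `M_n(A)`. -/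
structure MatProj (A : Type*) [Ring A] [StarRing A] where
  /-- the size of the matrix -/
  n : ℕ
  /-- the matrix -/
  p : Matrix (Fin n) (Fin n) A
  isProj : IsStarProjection p

/-- Murray–von Neumann equivalence on the projections in all the `M_n(A)`. -/
instance MatProj.setoid (A : Type*) [Ring A] [StarRing A] : Setoid (MatProj A) where
  r P Q := MvN P.p Q.p
  iseqv := ⟨fun P => MvN.refl P.isProj, fun h => h.symm,
    fun {P _ S} h h' => MvN.trans P.isProj S.isProj h h'⟩

/-- The direct sum of two matrix projections. -/
def MatProj.dsum {A : Type*} [Ring A] [StarRing A] (P Q : MatProj A) : MatProj A where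
  n := P.n + Q.n
  p := (blockSum P.p Q.p).submatrix finSumFinEquiv.symm finSumFinEquiv.symm
  isProj := isStarProjection_submatrix (isStarProjection_blockSum P.isProj Q.isProj) _

/-- The matrix projection of size zero. -/
def MatProj.zero (A : Type*) [Ring A] [StarRing A] : MatProj A where
  n := 0
  p := 0
  isProj := ⟨mul_zero _, star_zero _⟩

theorem MatProj.dsum_mvn {A : Type*} [Ring A] [StarRing A] (P Q : MatProj A) :
    MvN (blockSum P.p Q.p) (P.dsum Q).p :=
  MvN.submatrix (isStarProjection_blockSum P.isProj Q.isProj) _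

theorem MatProj.dsum_congr {A : Type*} [Ring A] [StarRing A] (P P' : MatProj A)
    (h : P ≈ P') (Q Q' : MatProj A) (h' : Q ≈ Q') : P.dsum Q ≈ P'.dsum Q' :=
  MvN.trans (P.dsum Q).isProj (P'.dsum Q').isProj (P.dsum_mvn Q).symm
    (MvN.trans (isStarProjection_blockSum P.isProj Q.isProj) (P'.dsum Q').isProj
      (MvN.blockSum h h') (P'.dsum_mvn Q'))

theorem MatProj.dsum_comm {A : Type*} [Ring A] [StarRing A] (P Q : MatProj A) :
    P.dsum Q ≈ Q.dsum P := by
  have key : MvN (blockSum P.p Q.p) (blockSum Q.p P.p) := by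
    have h := MvN.submatrix (isStarProjection_blockSum P.isProj Q.isProj) (Equiv.sumComm _ _)
    have e : (blockSum P.p Q.p).submatrix (Equiv.sumComm (Fin Q.n) (Fin P.n))
        (Equiv.sumComm (Fin Q.n) (Fin P.n)) = blockSum Q.p P.p := by
      ext i j
      rcases i with i | i <;> rcases j with j | j <;> simp [blockSum]
    rwa [e] at h
  exact MvN.trans (P.dsum Q).isProj (Q.dsum P).isProj (P.dsum_mvn Q).symm
    (MvN.trans (isStarProjection_blockSum P.isProj Q.isProj) (Q.dsum P).isProj key
      (Q.dsum_mvn P))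

theorem MatProj.dsum_assoc {A : Type*} [Ring A] [StarRing A] (P Q S : MatProj A) :
    (P.dsum Q).dsum S ≈ P.dsum (Q.dsum S) := by
  have hl := isStarProjection_blockSum (isStarProjection_blockSum P.isProj Q.isProj) S.isProj
  have hr := isStarProjection_blockSum P.isProj (isStarProjection_blockSum Q.isProj S.isProj)
  have key : MvN (blockSum (blockSum P.p Q.p) S.p) (blockSum P.p (blockSum Q.p S.p)) := by
    have h := MvN.submatrix hl (Equiv.sumAssoc _ _ _).symm
    have e : (blockSum (blockSum P.p Q.p) S.p).submatrix
        (Equiv.sumAssoc (Fin P.n) (Fin Q.n) (Fin S.n)).symm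
        (Equiv.sumAssoc (Fin P.n) (Fin Q.n) (Fin S.n)).symm
          = blockSum P.p (blockSum Q.p S.p) := by
      ext i j
      rcases i with i | i | i <;> rcases j with j | j | j <;> simp [blockSum]
    rwa [e] at h
  have h1 : MvN ((P.dsum Q).dsum S).p (blockSum (blockSum P.p Q.p) S.p) :=
    MvN.trans ((P.dsum Q).dsum S).isProj hl ((P.dsum Q).dsum_mvn S).symm
      (MvN.blockSum (P.dsum_mvn Q).symm (MvN.refl S.isProj))
  have h2 : MvN (blockSum P.p (blockSum Q.p S.p)) (P.dsum (Q.dsum S)).p :=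
    MvN.trans hr (P.dsum (Q.dsum S)).isProj
      (MvN.blockSum (MvN.refl P.isProj) (Q.dsum_mvn S)) (P.dsum_mvn (Q.dsum S))
  exact MvN.trans ((P.dsum Q).dsum S).isProj (P.dsum (Q.dsum S)).isProj h1
    (MvN.trans hl (P.dsum (Q.dsum S)).isProj key h2)

theorem MatProj.dsum_zero {A : Type*} [Ring A] [StarRing A] (P : MatProj A) :
    P.dsum (MatProj.zero A) ≈ P := by
  have h0 := isStarProjection_blockSum P.isProj (MatProj.zero A).isProj
  have key : MvN (blockSum P.p (MatProj.zero A).p) P.p := by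
    have h := MvN.submatrix h0 (Equiv.sumEmpty (Fin P.n) (Fin 0)).symm
    have e : (blockSum P.p (MatProj.zero A).p).submatrix
        (Equiv.sumEmpty (Fin P.n) (Fin 0)).symm (Equiv.sumEmpty (Fin P.n) (Fin 0)).symm
          = P.p := by
      ext i j
      rfl
    exact e ▸ h
  exact MvN.trans (P.dsum _).isProj P.isProj (P.dsum_mvn _).symm key

/-- The set `V(A)` of Murray–von Neumann classes of projections in matrices over `A`. -/
def MvNClass (A : Type*) [Ring A] [StarRing A] : Type _ := Quotient (MatProj.setoid A)

/-- Addition in `V(A)` is induced by the direct sum. -/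
instance MvNClass.add (A : Type*) [Ring A] [StarRing A] : Add (MvNClass A) where
  add := Quotient.map₂ MatProj.dsum (fun P P' h Q Q' h' => MatProj.dsum_congr P P' h Q Q' h')

instance MvNClass.zero (A : Type*) [Ring A] [StarRing A] : Zero (MvNClass A) where
  zero := Quotient.mk _ (MatProj.zero A)

/-- `V(A)` is a commutative monoid under direct sum. -/
instance MvNClass.addCommMonoid (A : Type*) [Ring A] [StarRing A] :
    AddCommMonoid (MvNClass A) where
  add_assoc := by
    rintro ⟨P⟩ ⟨Q⟩ ⟨S⟩
    exact Quotient.sound (P.dsum_assoc Q S)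
  add_comm := by
    rintro ⟨P⟩ ⟨Q⟩
    exact Quotient.sound (P.dsum_comm Q)
  add_zero := by
    rintro ⟨P⟩
    exact Quotient.sound P.dsum_zero
  zero_add := by
    rintro ⟨P⟩
    exact Quotient.sound (Setoid.trans ((MatProj.zero A).dsum_comm P) P.dsum_zero)
  nsmul := nsmulRec

/-- The group `K₀(A)` of a unital `C*`-algebra `A`: the Grothendieck group of `V(A)`. -/
abbrev KZero (A : Type*) [Ring A] [StarRing A] : Type _ :=
  Algebra.GrothendieckAddGroup (MvNClass A)

/-- The sum of the values of `τ` on the diagonal of a matrix. -/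
def matTrace {A B : Type*} [Ring A] [AddCommMonoid B] (τ : A →+ B) {ι : Type*} [Fintype ι]
    (p : Matrix ι ι A) : B :=
  ∑ i, τ (p i i)

theorem matTrace_eq_of_mvn {A B : Type*} [Ring A] [StarRing A] [AddCommMonoid B] (τ : A →+ B)
    (hτ : ∀ a b : A, τ (a * b) = τ (b * a)) {ι κ : Type*} [Fintype ι] [Fintype κ]
    {p : Matrix ι ι A} {q : Matrix κ κ A} (h : MvN p q) : matTrace τ p = matTrace τ q := by
  obtain ⟨v, rfl, rfl⟩ := h
  simp only [matTrace, Matrix.mul_apply, map_sum]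
  rw [Finset.sum_comm]
  exact Finset.sum_congr rfl fun j _ => Finset.sum_congr rfl fun i _ => hτ _ _

theorem matTrace_blockSum {A B : Type*} [Ring A] [AddCommMonoid B] (τ : A →+ B)
    {ι κ : Type*} [Fintype ι] [Fintype κ] (p : Matrix ι ι A) (q : Matrix κ κ A) :
    matTrace τ (blockSum p q) = matTrace τ p + matTrace τ q := by
  simp [matTrace, blockSum]

/-- The additive map `V(A) → B` induced by a tracial map `τ`. -/
def MvNClass.traceHom {A B : Type*} [Ring A] [StarRing A] [AddCommMonoid B] (τ : A →+ B)
    (hτ : ∀ a b : A, τ (a * b) = τ (b * a)) : MvNClass A →+ B where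
  toFun := Quotient.lift (fun P : MatProj A => matTrace τ P.p)
    (fun _ _ h => matTrace_eq_of_mvn τ hτ h)
  map_zero' := by
    change matTrace τ (MatProj.zero A).p = 0
    exact Finset.sum_of_isEmpty (ι := Fin 0) _
  map_add' := by
    rintro ⟨P⟩ ⟨Q⟩
    change matTrace τ (P.dsum Q).p = matTrace τ P.p + matTrace τ Q.p
    rw [← matTrace_eq_of_mvn τ hτ (P.dsum_mvn Q), matTrace_blockSum]

/-- The homomorphism `K₀(A) → B` induced by a tracial map `τ`; it sends the class of a
projection `p` to `∑ i, τ (p i i)`. -/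
noncomputable def KZero.traceHom {A B : Type*} [Ring A] [StarRing A] [AddCommGroup B]
    (τ : A →+ B) (hτ : ∀ a b : A, τ (a * b) = τ (b * a)) : KZero A →+ B :=
  Algebra.GrothendieckAddGroup.lift (MvNClass.traceHom τ hτ)

end KTheory

/-! ### The reduced group `C*`-algebra and its canonical trace -/

section ReducedGroupAlgebra

/-- The Hilbert space `l²(α)`. -/
abbrev LTwo (α : Type*) : Type _ := lp (fun _ : α => ℂ) 2

/-- The standard basis vector of `l²(α)` at `x`. -/
noncomputable def LTwo.delta {α : Type*} (x : α) : LTwo α := by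
  classical exact lp.single 2 x 1

theorem LTwo.inner_delta_left {α : Type*} (x : α) (f : LTwo α) : ⟪LTwo.delta x, f⟫ = f x := by
  classical
  have := lp.inner_single_left (𝕜 := ℂ) (G := fun _ : α => ℂ) x 1 f
  simpa [LTwo.delta] using this

theorem memlp_two_comp {α β : Type*} (e : β ≃ α) (f : LTwo α) :
    Memℓp (fun y => f (e y)) 2 := by
  have h := lp.memℓp f
  rw [memℓp_gen_iff (by norm_num)] at h ⊢
  exact (e.summable_iff (f := fun x => ‖f x‖ ^ (2 : ENNReal).toReal)).2 h

/-- The unitary `l²(α) ≃ l²(β)` induced by a bijection `e`: it sends the basis vector at `x` to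
the basis vector at `e x`. -/
noncomputable def LTwo.congr {α β : Type*} (e : α ≃ β) : LTwo α ≃ₗᵢ[ℂ] LTwo β where
  toFun f := ⟨fun y => f (e.symm y), memlp_two_comp e.symm f⟩
  invFun f := ⟨fun x => f (e x), memlp_two_comp e f⟩
  map_add' f g := rfl
  map_smul' c f := rfl
  left_inv f := by
    ext x
    exact congrArg f (e.symm_apply_apply x)
  right_inv f := by
    ext x
    exact congrArg f (e.apply_symm_apply x)
  norm_map' f := by
    rw [lp.norm_eq_tsum_rpow (by norm_num), lp.norm_eq_tsum_rpow (by norm_num)]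
    congr 1
    exact e.symm.tsum_eq (fun x => ‖f x‖ ^ (2 : ENNReal).toReal)

theorem LTwo.congr_apply {α β : Type*} (e : α ≃ β) (f : LTwo α) (y : β) :
    LTwo.congr e f y = f (e.symm y) := rfl

theorem LTwo.congr_delta {α β : Type*} (e : α ≃ β) (x : α) :
    LTwo.congr e (LTwo.delta x) = LTwo.delta (e x) := by
  classical
  ext y
  rw [LTwo.congr_apply]
  simp only [LTwo.delta, lp.single_apply, Pi.single_apply, Equiv.symm_apply_eq]

/-- The left regular representation: `(leftReg g f) x = f (g⁻¹ x)`. -/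
noncomputable def leftReg {G : Type*} [Group G] (g : G) : LTwo G →L[ℂ] LTwo G :=
  (LTwo.congr (Equiv.mulLeft g)).toContinuousLinearEquiv.toContinuousLinearMap

/-- The right translations: `(rightReg g f) x = f (x g⁻¹)`. -/
noncomputable def rightReg {G : Type*} [Group G] (g : G) : LTwo G →L[ℂ] LTwo G :=
  (LTwo.congr (Equiv.mulRight g)).toContinuousLinearEquiv.toContinuousLinearMap

/-- The reduced group `C*`-algebra: the norm closure, in the bounded operators on `l²(G)`, of the
`*`-algebra generated by the left regular representation. -/
noncomputable def ReducedCStar (G : Type*) [Group G] :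
    StarSubalgebra ℂ (LTwo G →L[ℂ] LTwo G) :=
  (StarAlgebra.adjoin ℂ (Set.range (leftReg (G := G)))).topologicalClosure

theorem leftReg_apply {G : Type*} [Group G] (g : G) (f : LTwo G) (x : G) :
    leftReg g f x = f (g⁻¹ * x) := rfl

theorem rightReg_apply {G : Type*} [Group G] (g : G) (f : LTwo G) (x : G) :
    rightReg g f x = f (x * g⁻¹) := rfl

theorem star_leftReg {G : Type*} [Group G] (g : G) : star (leftReg g) = leftReg g⁻¹ := by
  rw [ContinuousLinearMap.star_eq_adjoint]
  symm
  rw [ContinuousLinearMap.eq_adjoint_iff]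
  intro f f'
  rw [lp.inner_eq_tsum, lp.inner_eq_tsum, ← (Equiv.mulLeft g).symm.tsum_eq]
  exact tsum_congr fun x => by simp [leftReg_apply]

theorem ReducedCStar.commute_rightReg {G : Type*} [Group G] (a : ReducedCStar G) (g : G) :
    rightReg g * (a : LTwo G →L[ℂ] LTwo G) = a * rightReg g := by
  have hc : ∀ h k : G, leftReg h * rightReg k = rightReg k * leftReg h := by
    intro h k
    refine ContinuousLinearMap.ext fun f => lp.ext (funext fun x => ?_)
    change leftReg h (rightReg k f) x = rightReg k (leftReg h f) x
    simp only [leftReg_apply, rightReg_apply, mul_assoc]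
  have hle : ReducedCStar G ≤ StarSubalgebra.centralizer ℂ
      (StarSubalgebra.centralizer ℂ (Set.range (leftReg (G := G))) : Set _) :=
    StarSubalgebra.topologicalClosure_minimal
      (StarAlgebra.adjoin_le_centralizer_centralizer ℂ _) (Set.isClosed_centralizer _)
  refine ((StarSubalgebra.mem_centralizer_iff ℂ).1 (hle a.2) (rightReg g) ?_).1
  change rightReg g ∈ StarSubalgebra.centralizer ℂ _
  rw [StarSubalgebra.mem_centralizer_iff]
  rintro _ ⟨h, rfl⟩
  rw [star_leftReg]
  exact ⟨hc h g, hc h⁻¹ g⟩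

/-- The canonical trace `a ↦ ⟨δ₁, a δ₁⟩` on the reduced group `C*`-algebra, which extends
`∑ λ_g g ↦ λ_1`. -/
noncomputable def cstarTrace (G : Type*) [Group G] : ReducedCStar G →+ ℂ where
  toFun a := ⟪LTwo.delta (1 : G), (a : LTwo G →L[ℂ] LTwo G) (LTwo.delta 1)⟫
  map_zero' := by simp
  map_add' a b := by simp

theorem ReducedCStar.coeff {G : Type*} [Group G] (a : ReducedCStar G) (g : G) :
    ⟪LTwo.delta (1 : G), (a : LTwo G →L[ℂ] LTwo G) (LTwo.delta g)⟫
      = (a : LTwo G →L[ℂ] LTwo G) (LTwo.delta 1) g⁻¹ := by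
  have h1 : rightReg g (LTwo.delta 1) = LTwo.delta g := by
    have := LTwo.congr_delta (Equiv.mulRight g) (1 : G)
    simpa [rightReg] using this
  have h2 := DFunLike.congr_fun (ReducedCStar.commute_rightReg a g) (LTwo.delta 1)
  change rightReg g ((a : LTwo G →L[ℂ] LTwo G) (LTwo.delta 1))
    = (a : LTwo G →L[ℂ] LTwo G) (rightReg g (LTwo.delta 1)) at h2
  rw [LTwo.inner_delta_left, ← h1, ← h2, rightReg_apply, one_mul]

theorem cstarTrace_mul_comm {G : Type*} [Group G] (a b : ReducedCStar G) :
    cstarTrace G (a * b) = cstarTrace G (b * a) := by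
  have key : ∀ a b : ReducedCStar G, cstarTrace G (a * b) =
      ∑' g : G, (a : LTwo G →L[ℂ] LTwo G) (LTwo.delta 1) g⁻¹
        * (b : LTwo G →L[ℂ] LTwo G) (LTwo.delta 1) g := by
    intro a b
    change ⟪LTwo.delta (1 : G), (a : LTwo G →L[ℂ] LTwo G)
      ((b : LTwo G →L[ℂ] LTwo G) (LTwo.delta 1))⟫ = _
    rw [← ContinuousLinearMap.adjoint_inner_left, lp.inner_eq_tsum]
    refine tsum_congr fun g => ?_
    rw [← ReducedCStar.coeff a g, ← ContinuousLinearMap.adjoint_inner_left,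
      ← inner_conj_symm _ (LTwo.delta g), LTwo.inner_delta_left]
    simp [mul_comm]
  rw [key, key, ← (Equiv.inv G).tsum_eq]
  exact tsum_congr fun g => by simp [mul_comm]

theorem cstarTrace_star {G : Type*} [Group G] (a : ReducedCStar G) :
    cstarTrace G (star a) = star (cstarTrace G a) := by
  change ⟪LTwo.delta (1 : G), ContinuousLinearMap.adjoint (a : LTwo G →L[ℂ] LTwo G)
    (LTwo.delta 1)⟫ = star ⟪LTwo.delta (1 : G), (a : LTwo G →L[ℂ] LTwo G) (LTwo.delta 1)⟫
  rw [ContinuousLinearMap.adjoint_inner_right]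
  exact (inner_conj_symm _ _).symm

/-- The homomorphism `tr_G : K₀(C*_r G) → ℝ`; taking real parts loses nothing, see
`trKZero_ofReal`. -/
noncomputable def trKZero (G : Type*) [Group G] : KZero (ReducedCStar G) →+ ℝ :=
  Complex.reLm.toAddMonoidHom.comp
    (KZero.traceHom (cstarTrace G) cstarTrace_mul_comm)

theorem trKZero_ofReal {G : Type*} [Group G] (x : KZero (ReducedCStar G)) :
    ((trKZero G x : ℝ) : ℂ) = KZero.traceHom (cstarTrace G) cstarTrace_mul_comm x := by
  have h : ∀ y : MvNClass (ReducedCStar G),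
      (MvNClass.traceHom (cstarTrace G) cstarTrace_mul_comm y).im = 0 := by
    rintro ⟨P⟩
    change (∑ i, cstarTrace G (P.p i i)).im = 0
    rw [Complex.im_sum]
    refine Finset.sum_eq_zero fun i _ => ?_
    have h1 : star (P.p i i) = P.p i i := by
      have := congrFun (congrFun P.isProj.isSelfAdjoint i) i
      simpa using this
    have h2 := cstarTrace_star (P.p i i)
    rw [h1] at h2
    exact Complex.conj_eq_iff_im.1 h2.symm
  refine Complex.conj_eq_iff_re.1 (Complex.conj_eq_iff_im.2 ?_)
  rw [KZero.traceHom, Algebra.GrothendieckAddGroup.lift_apply, Complex.sub_im, h, h, sub_zero]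

end ReducedGroupAlgebra

/-!
The two actions of `G`, on `Δ` and (transported by `φ`) on `Ω`, give two `*`-homomorphisms `α`, `β`
from `M_n(C*_r G)` to the bounded operators on `ℓ²` of `n` copies of `Δ`: since `Δ` and `Ω'` are
free, both spaces are amplifications of `ℓ²(G)`, and `β` is defined to be zero on the part of `X`.
They take values in the operators commuting with `H`. A group element acts in the same way for both
outside of finitely many `H`-orbits, so `α(a) - β(a)` has, for a matrix `a` over `ℂG`, only finitely
many nonzero blocks relative to `Δ ≅ I × H`, all of them in `C*_r H` (`rep_sub_rep_mem_finiteRank`).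
For a projection `p` in `M_n(C*_r G)` the pair `α(p)`, `β(p)` thus represents a class in
`K₀(C*_r H)`, and the trace of this class is computed from the diagonal entries of `α(p) - β(p)`:
these are `tr p` on the `r` orbits of `X` and zero elsewhere, giving `r · tr_G(p)`
(`hTrace_rep_sub_rep`).

To make sense of the trace, `p` is first replaced by a spectral projection of a self-adjoint matrix
`a` over `ℂG` near the given one. The trace class used here (`traceClass`) consists of sums
`∑ b_k c_k` of products of equivariant Hilbert–Schmidt families, a form for which `tr(mx) = tr(xm)`
is a rearrangement of an absolutely convergent sum. With `A = α(a)`, `B = β(a)`, `P = α(p)`,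
`Q = β(p)`, the operator `P(1 - Q)` satisfies `A X - X B = P(A - B)(1 - Q)`, and `A` is near `1` on
the range of `P` while `B` is near `0` on the kernel of `Q`; solving this Sylvester equation by a
geometric series shows that `P - Q` is trace class (`sub_mem_traceClass`).

The class in `K₀` is made explicit by doubling the space. Let `e` be the projection onto the first
half. There is a symmetry `w`, built from `Q` and the flip of the two halves, for which
`S = e + w(P - Q)w` is a projection (`isStarProjection_add_conj`). It is approximated by the same
expression in `A` and `B`, which differs from `e` in finitely many blocks over `C*_r H`. Correcting
it on these blocks yields a projection `s` over `C*_r H`, and a nearby projection `S'` equal to `s`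
on these blocks and to `e` elsewhere (`exists_block_projection_near`). Close projections with trace
class difference have the same trace (`hTrace_sub_eq_zero`), so `tr(P - Q) = tr(S - e) = tr(S' - e)`
is a difference of traces of two projections in matrices over `C*_r H`.
-/

/-! ### Bounded operators on `ℓ²` and their matrix entries -/

section LTwoOperators

variable {α β γ : Type*}

/-- The bounded operators on `ℓ²(α)`. -/
abbrev LTwoOp (α : Type*) : Type _ := LTwo α →L[ℂ] LTwo α

theorem LTwo.delta_apply (x y : α) [Decidable (y = x)] :
    LTwo.delta x y = if y = x then 1 else 0 := by
  classical
  simp only [LTwo.delta, lp.single_apply, Pi.single_apply]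
  congr

theorem LTwo.delta_of_ne {x y : α} (h : y ≠ x) : LTwo.delta x y = 0 := by
  classical
  rw [LTwo.delta_apply, if_neg h]

theorem LTwo.hasSum_delta (f : LTwo α) : HasSum (fun x => f x • LTwo.delta x) f := by
  classical
  have h := lp.hasSum_single (E := fun _ : α => ℂ) (p := 2) (by norm_num) f
  refine h.congr_fun fun x => ?_
  rw [LTwo.delta, ← lp.single_smul]
  simp

theorem LTwo.hasSum_norm_sq (f : LTwo α) : HasSum (fun x => ‖f x‖ ^ 2) (‖f‖ ^ 2) := by
  have h := lp.hasSum_norm (p := 2) (by norm_num) f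
  simpa using h

theorem LTwo.clm_ext {F : Type*} [NormedAddCommGroup F] [NormedSpace ℂ F]
    {S T : LTwo α →L[ℂ] F} (h : ∀ x, S (LTwo.delta x) = T (LTwo.delta x)) : S = T := by
  ext1 f
  have h1 := (LTwo.hasSum_delta f).mapL S
  have h2 := (LTwo.hasSum_delta f).mapL T
  simp only [map_smul, h] at h1 h2
  exact h1.unique h2

/-- The matrix entry `⟨δ_a, T δ_b⟩` of an operator. -/
noncomputable def entry (T : LTwo β →L[ℂ] LTwo α) (a : α) (b : β) : ℂ := T (LTwo.delta b) a

theorem entry_eq_inner (T : LTwo β →L[ℂ] LTwo α) (a : α) (b : β) :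
    entry T a b = ⟪LTwo.delta a, T (LTwo.delta b)⟫ := (LTwo.inner_delta_left _ _).symm

theorem entry_ext {S T : LTwo β →L[ℂ] LTwo α} (h : ∀ a b, entry S a b = entry T a b) :
    S = T :=
  LTwo.clm_ext fun b => lp.ext (funext fun a => h a b)

theorem entry_adjoint (T : LTwo β →L[ℂ] LTwo α) (a : α) (b : β) :
    entry (ContinuousLinearMap.adjoint T) b a = star (entry T a b) := by
  rw [entry_eq_inner, entry_eq_inner, ContinuousLinearMap.adjoint_inner_right]
  exact (inner_conj_symm _ _).symm

theorem entry_star (T : LTwoOp α) (a b : α) : entry (star T) b a = star (entry T a b) :=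
  entry_adjoint T a b

theorem entry_add (S T : LTwo β →L[ℂ] LTwo α) (a : α) (b : β) :
    entry (S + T) a b = entry S a b + entry T a b := rfl

theorem entry_sub (S T : LTwo β →L[ℂ] LTwo α) (a : α) (b : β) :
    entry (S - T) a b = entry S a b - entry T a b := rfl

theorem entry_smul (c : ℂ) (T : LTwo β →L[ℂ] LTwo α) (a : α) (b : β) :
    entry (c • T) a b = c * entry T a b := rfl

theorem entry_zero (a : α) (b : β) : entry (0 : LTwo β →L[ℂ] LTwo α) a b = 0 := rfl

/-- Taking a matrix entry, as a continuous linear functional on operators. -/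
noncomputable def entryCLM (a : α) (b : β) : (LTwo β →L[ℂ] LTwo α) →L[ℂ] ℂ :=
  (innerSL ℂ (LTwo.delta a)).comp (ContinuousLinearMap.apply ℂ (LTwo α) (LTwo.delta b))

theorem entryCLM_apply (T : LTwo β →L[ℂ] LTwo α) (a : α) (b : β) :
    entryCLM a b T = entry T a b := (entry_eq_inner T a b).symm

theorem hasSum_entry_mul (S T : LTwoOp α) (a b : α) :
    HasSum (fun c => entry S a c * entry T c b) (entry (S * T) a b) := by
  have h := ((LTwo.hasSum_delta (T (LTwo.delta b))).mapL S).mapL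
    (innerSL ℂ (LTwo.delta a))
  have e : entry (S * T) a b = innerSL ℂ (LTwo.delta a) (S (T (LTwo.delta b))) :=
    entry_eq_inner (S * T) a b
  rw [e]
  refine h.congr_fun fun c => ?_
  simp only [map_smul, smul_eq_mul, innerSL_apply_apply, LTwo.inner_delta_left]
  exact mul_comm _ _

/-! ### Restriction and extension by zero along an injection -/

/-- The element of `ℓ²(α)` given by a square-summable function. -/
def LTwo.ofSummable (f : α → ℂ) (h : Summable fun x => ‖f x‖ ^ 2) : LTwo α :=
  ⟨f, (memℓp_gen_iff (by norm_num)).2 (by simpa using h)⟩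

theorem LTwo.ofSummable_apply (f : α → ℂ) (h : Summable fun x => ‖f x‖ ^ 2) (x : α) :
    LTwo.ofSummable f h x = f x := rfl

theorem LTwo.add_apply (f g : LTwo α) (x : α) : (f + g) x = f x + g x := rfl

theorem LTwo.smul_apply (c : ℂ) (f : LTwo α) (x : α) : (c • f) x = c * f x := rfl

theorem LTwo.summable_comp (e : α ↪ β) (f : LTwo β) : Summable fun x => ‖f (e x)‖ ^ 2 :=
  (LTwo.hasSum_norm_sq f).summable.comp_injective e.injective

/-- Restriction of square-summable functions along an injection. -/
noncomputable def restrict (e : α ↪ β) : LTwo β →L[ℂ] LTwo α :=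
  LinearMap.mkContinuous
    { toFun := fun f => LTwo.ofSummable (fun x => f (e x)) (LTwo.summable_comp e f)
      map_add' := fun f g => rfl
      map_smul' := fun c f => rfl } 1 fun f => by
    rw [one_mul]
    refine (sq_le_sq₀ (norm_nonneg _) (norm_nonneg _)).1 ?_
    rw [← (LTwo.hasSum_norm_sq _).tsum_eq, ← (LTwo.hasSum_norm_sq f).tsum_eq]
    exact (LTwo.summable_comp e f).tsum_le_tsum_of_inj e
      e.injective (fun _ _ => by positivity) (fun _ => le_rfl) (LTwo.hasSum_norm_sq f).summable

theorem restrict_apply (e : α ↪ β) (f : LTwo β) (x : α) : restrict e f x = f (e x) := rfl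

/-- Extension of square-summable functions by zero along an injection. -/
noncomputable def extendZero (e : α ↪ β) : LTwo α →L[ℂ] LTwo β :=
  ContinuousLinearMap.adjoint (restrict e)

theorem adjoint_restrict (e : α ↪ β) : ContinuousLinearMap.adjoint (restrict e) = extendZero e :=
  rfl

theorem adjoint_extendZero (e : α ↪ β) : ContinuousLinearMap.adjoint (extendZero e) = restrict e :=
  ContinuousLinearMap.adjoint_adjoint _

theorem norm_restrict_le (e : α ↪ β) : ‖restrict e‖ ≤ 1 :=
  LinearMap.mkContinuous_norm_le _ zero_le_one _

theorem norm_extendZero_le (e : α ↪ β) : ‖extendZero e‖ ≤ 1 := by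
  rw [extendZero, LinearIsometryEquiv.norm_map]
  exact norm_restrict_le e

theorem restrict_delta (e : α ↪ β) (x : α) : restrict e (LTwo.delta (e x)) = LTwo.delta x := by
  classical
  ext y
  rw [restrict_apply, LTwo.delta_apply, LTwo.delta_apply]
  simp

theorem restrict_delta_of_notMem (e : α ↪ β) {y : β} (h : y ∉ Set.range e) :
    restrict e (LTwo.delta y) = 0 := by
  ext x
  rw [restrict_apply, LTwo.delta_of_ne]
  · rfl
  · rintro rfl
    exact h ⟨x, rfl⟩

theorem extendZero_apply (e : α ↪ β) (f : LTwo α) (x : α) : extendZero e f (e x) = f x := by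
  rw [← LTwo.inner_delta_left, extendZero, ContinuousLinearMap.adjoint_inner_right, restrict_delta,
    LTwo.inner_delta_left]

theorem extendZero_apply_of_notMem (e : α ↪ β) (f : LTwo α) {y : β} (h : y ∉ Set.range e) :
    extendZero e f y = 0 := by
  rw [← LTwo.inner_delta_left, extendZero, ContinuousLinearMap.adjoint_inner_right,
    restrict_delta_of_notMem e h, inner_zero_left]

theorem extendZero_delta (e : α ↪ β) (x : α) : extendZero e (LTwo.delta x) = LTwo.delta (e x) := by
  classical
  ext y
  by_cases h : y ∈ Set.range e
  · obtain ⟨z, rfl⟩ := h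
    rw [extendZero_apply, LTwo.delta_apply, LTwo.delta_apply]
    simp
  · rw [extendZero_apply_of_notMem e _ h, LTwo.delta_of_ne]
    rintro rfl
    exact h ⟨x, rfl⟩

theorem restrict_extendZero (e : α ↪ β) (f : LTwo α) : restrict e (extendZero e f) = f := by
  ext x
  rw [restrict_apply, extendZero_apply]

theorem restrict_extendZero_of_disjoint (e : α ↪ γ) (e' : β ↪ γ)
    (h : ∀ x y, e x ≠ e' y) (f : LTwo β) :
    restrict e (extendZero e' f) = 0 := by
  ext x
  rw [restrict_apply, extendZero_apply_of_notMem]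
  · rfl
  · rintro ⟨y, hy⟩
    exact h x y hy.symm

theorem extendZero_trans (e : α ↪ β) (e' : β ↪ γ) :
    (extendZero e').comp (extendZero e) = extendZero (e.trans e') :=
  LTwo.clm_ext fun x => by simp [extendZero_delta]

/-- The operator on `ℓ²(β)` that acts as `T` on the image of `ℓ²(α)` and as `0` on its orthogonal
complement. -/
noncomputable def corner (e : α ↪ β) : LTwoOp α →⋆ₙₐ[ℂ] LTwoOp β where
  toFun T := (extendZero e).comp (T.comp (restrict e))
  map_smul' c T := by ext1 f; simp
  map_zero' := by ext1 f; simp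
  map_add' S T := by ext1 f; simp
  map_mul' S T := by ext1 f; simp [restrict_extendZero]
  map_star' T := by
    simp only [ContinuousLinearMap.star_eq_adjoint, ContinuousLinearMap.adjoint_comp,
      adjoint_extendZero, adjoint_restrict, ContinuousLinearMap.comp_assoc]

theorem corner_apply (e : α ↪ β) (T : LTwoOp α) (f : LTwo β) :
    corner e T f = extendZero e (T (restrict e f)) := rfl

theorem corner_one_apply (e : α ↪ β) (f : LTwo β) (y : β) [Decidable (y ∈ Set.range e)] :
    corner e 1 f y = if y ∈ Set.range e then f y else 0 := by
  split_ifs with h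
  · obtain ⟨x, rfl⟩ := h
    exact extendZero_apply e _ x
  · exact extendZero_apply_of_notMem e _ h

theorem corner_one_delta (e : α ↪ β) (y : β) [Decidable (y ∈ Set.range e)] :
    corner e 1 (LTwo.delta y) = if y ∈ Set.range e then LTwo.delta y else 0 := by
  rw [corner_apply]
  split_ifs with h
  · obtain ⟨x, rfl⟩ := h
    rw [restrict_delta]
    exact extendZero_delta e x
  · rw [restrict_delta_of_notMem e h, map_zero, map_zero]

theorem commute_corner_one (e : α ↪ γ) (e' : β ↪ γ) :
    Commute (corner e 1) (corner e' 1) := by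
  classical
  refine LTwo.clm_ext fun y => ?_
  simp only [mul_apply_eq_comp, corner_one_delta]
  by_cases h : y ∈ Set.range e <;> by_cases h' : y ∈ Set.range e' <;>
    simp only [h, h', if_true, if_false, corner_one_delta, map_zero]

theorem isStarProjection_corner {e : α ↪ β} {T : LTwoOp α} (hT : IsStarProjection T) :
    IsStarProjection (corner e T) :=
  hT.map (corner e)

theorem norm_corner_le (e : α ↪ β) (T : LTwoOp α) : ‖corner e T‖ ≤ ‖T‖ :=
  NonUnitalStarAlgHom.norm_apply_le _ _

/-! ### Amplification -/

/-- The embedding of the slice over `k`. -/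
def slice (S : Type*) {K : Type*} (k : K) : S ↪ K × S :=
  ⟨fun s => (k, s), fun _ _ h => (Prod.ext_iff.1 h).2⟩

theorem slice_apply (S : Type*) {K : Type*} (k : K) (s : S) : slice S k s = (k, s) := rfl

theorem hasSum_norm_sq_slice {S K : Type*} (f : LTwo (K × S)) :
    HasSum (fun k => ‖restrict (slice S k) f‖ ^ 2) (‖f‖ ^ 2) :=
  (LTwo.hasSum_norm_sq f).prod_fiberwise fun k => LTwo.hasSum_norm_sq (restrict (slice S k) f)

theorem summable_amp {S K : Type*} (T : LTwoOp S) (f : LTwo (K × S)) :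
    Summable (fun p : K × S => ‖T (restrict (slice S p.1) f) p.2‖ ^ 2) := by
  rw [summable_prod_of_nonneg (fun p => by positivity)]
  refine ⟨fun k => (LTwo.hasSum_norm_sq (T (restrict (slice S k) f))).summable, ?_⟩
  have h := (hasSum_norm_sq_slice f).summable.mul_left (‖T‖ ^ 2)
  refine Summable.of_nonneg_of_le (fun k => tsum_nonneg fun s => by positivity) (fun k => ?_) h
  refine (LTwo.hasSum_norm_sq (T (restrict (slice S k) f))).tsum_eq.trans_le ?_
  rw [← mul_pow]
  gcongr
  exact T.le_opNorm _

/-- The amplification `1 ⊗ T` of an operator on `ℓ²(S)` to `ℓ²(K × S)`, as a linear map. -/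
noncomputable def ampLM {S : Type*} (K : Type*) (T : LTwoOp S) :
    LTwo (K × S) →ₗ[ℂ] LTwo (K × S) where
  toFun f := LTwo.ofSummable (fun p => T (restrict (slice S p.1) f) p.2) (summable_amp T f)
  map_add' f g := by
    refine lp.ext (funext fun p => ?_)
    rw [LTwo.add_apply, LTwo.ofSummable_apply, map_add, map_add]
    rfl
  map_smul' c f := by
    refine lp.ext (funext fun p => ?_)
    rw [RingHom.id_apply, LTwo.smul_apply, LTwo.ofSummable_apply, map_smul, map_smul]
    rfl

theorem norm_ampLM_le {S : Type*} (K : Type*) (T : LTwoOp S) (f : LTwo (K × S)) :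
    ‖ampLM K T f‖ ≤ ‖T‖ * ‖f‖ := by
  refine (sq_le_sq₀ (norm_nonneg _) (by positivity)).1 ?_
  rw [mul_pow]
  refine hasSum_le (fun k => ?_) (hasSum_norm_sq_slice (ampLM K T f))
    ((hasSum_norm_sq_slice f).mul_left (‖T‖ ^ 2))
  rw [← mul_pow]
  have h : restrict (slice S k) (ampLM K T f) = T (restrict (slice S k) f) := rfl
  rw [h]
  gcongr
  exact T.le_opNorm _

/-- The amplification `1 ⊗ T` of an operator on `ℓ²(S)` to `ℓ²(K × S)`, as a bounded operator. -/
noncomputable def ampCLM {S : Type*} (K : Type*) (T : LTwoOp S) : LTwoOp (K × S) :=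
  (ampLM K T).mkContinuous ‖T‖ (norm_ampLM_le K T)

theorem ampCLM_apply {S : Type*} (K : Type*) (T : LTwoOp S) (f : LTwo (K × S)) (k : K) (s : S) :
    ampCLM K T f (k, s) = T (restrict (slice S k) f) s := rfl

theorem entry_ampCLM {S : Type*} (K : Type*) [DecidableEq K] (T : LTwoOp S) (k l : K) (s t : S) :
    entry (ampCLM K T) (k, s) (l, t) = if k = l then entry T s t else 0 := by
  rw [entry, ampCLM_apply]
  split_ifs with h
  · subst h
    exact congrArg (fun f => T f s) (restrict_delta (slice S k) t)
  · rw [restrict_delta_of_notMem, map_zero]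
    · rfl
    · rintro ⟨s', hs'⟩
      exact h (Prod.ext_iff.1 hs').1

/-- The amplification `T ↦ 1 ⊗ T` as a `*`-homomorphism. -/
noncomputable def amp (S K : Type*) : LTwoOp S →⋆ₙₐ[ℂ] LTwoOp (K × S) where
  toFun T := ampCLM K T
  map_smul' c T := rfl
  map_zero' := rfl
  map_add' S T := rfl
  map_mul' S T := rfl
  map_star' T := by
    classical
    refine entry_ext fun p q => ?_
    rw [entry_star, entry_ampCLM, entry_ampCLM, entry_star]
    by_cases h : p.1 = q.1
    · rw [if_pos h, if_pos h.symm]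
    · rw [if_neg h, if_neg (Ne.symm h), star_zero]

/-- The `*`-homomorphism `B(ℓ²(S)) → B(ℓ²(Y))` that acts on each of the copies of `S` given by the
injection `e : K × S → Y`, and by `0` outside of them. -/
noncomputable def inflate {S K Y : Type*} (e : K × S ↪ Y) : LTwoOp S →⋆ₙₐ[ℂ] LTwoOp Y :=
  (corner e).comp (amp S K)

theorem norm_inflate_le {S K Y : Type*} (e : K × S ↪ Y) (T : LTwoOp S) : ‖inflate e T‖ ≤ ‖T‖ :=
  NonUnitalStarAlgHom.norm_apply_le _ _

theorem continuous_inflate {S K Y : Type*} (e : K × S ↪ Y) : Continuous (inflate e) :=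
  map_continuous (inflate e)

theorem inflate_delta_of_notMem {S K Y : Type*} (e : K × S ↪ Y) (T : LTwoOp S) {y : Y}
    (h : y ∉ Set.range e) : inflate e T (LTwo.delta y) = 0 := by
  change corner e (amp S K T) (LTwo.delta y) = 0
  rw [corner_apply, restrict_delta_of_notMem e h, map_zero, map_zero]

theorem inflate_delta {S K Y : Type*} (e : K × S ↪ Y) (T : LTwoOp S) (k : K) (s : S) :
    inflate e T (LTwo.delta (e (k, s))) = extendZero ((slice S k).trans e) (T (LTwo.delta s)) := by
  classical
  change corner e (amp S K T) (LTwo.delta (e (k, s))) = _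
  rw [corner_apply, restrict_delta, ← extendZero_trans]
  refine congrArg (extendZero e) (lp.ext (funext fun p => ?_))
  have h := entry_ampCLM K T p.1 k p.2 s
  refine h.trans ?_
  obtain ⟨l, t⟩ := p
  split_ifs with hl
  · obtain rfl : l = k := hl
    exact (extendZero_apply (slice S l) _ t).symm
  · refine (extendZero_apply_of_notMem (slice S k) _ ?_).symm
    rintro ⟨s', hs'⟩
    exact hl (Prod.ext_iff.1 hs').1.symm

end LTwoOperators

/-! ### Operators on `ℓ²(J × H)` commuting with the right translations by `H` -/

section Equivariant

variable {J H : Type*} [Group H]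

/-- The right translation by `h` on `ℓ²(J × H)`. -/
noncomputable def shift (J : Type*) {H : Type*} [Group H] (h : H) : LTwoOp (J × H) :=
  (LTwo.congr
    ((Equiv.refl J).prodCongr (Equiv.mulRight h))).toContinuousLinearEquiv.toContinuousLinearMap

theorem shift_delta (k : H) (i : J) (h : H) :
    shift J k (LTwo.delta (i, h)) = LTwo.delta (i, h * k) :=
  LTwo.congr_delta _ _

theorem entry_shift_mul (k : H) (T : LTwoOp (J × H)) (p : J × H) (j : J) (h : H) :
    entry (shift J k * T) p (j, h) = entry T (p.1, p.2 * k⁻¹) (j, h) := rfl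

theorem entry_mul_shift (k : H) (T : LTwoOp (J × H)) (p : J × H) (j : J) (h : H) :
    entry (T * shift J k) p (j, h) = entry T p (j, h * k) := by
  change T (shift J k _) p = _
  rw [shift_delta]
  rfl

theorem star_shift (k : H) : star (shift J k) = shift J k⁻¹ := by
  classical
  refine entry_ext fun p q => ?_
  rw [entry_star, entry, entry, shift_delta, shift_delta, LTwo.delta_apply, LTwo.delta_apply]
  simp only [Prod.ext_iff, eq_mul_inv_iff_mul_eq, apply_ite star, star_one, star_zero]
  congr 1
  exact propext ⟨fun h => ⟨h.1.symm, h.2.symm⟩, fun h => ⟨h.1.symm, h.2.symm⟩⟩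

/-- The von Neumann algebra of bounded operators on `ℓ²(J × H)` commuting with the right
translations by elements of `H`. -/
noncomputable def equivariantOp (J H : Type*) [Group H] : StarSubalgebra ℂ (LTwoOp (J × H)) :=
  StarSubalgebra.centralizer ℂ (Set.range (shift J (H := H)))

theorem isClosed_equivariantOp : IsClosed (equivariantOp J H : Set (LTwoOp (J × H))) :=
  Set.isClosed_centralizer _

theorem mem_equivariantOp_iff_commute {T : LTwoOp (J × H)} :
    T ∈ equivariantOp J H ↔ ∀ k : H, shift J k * T = T * shift J k := by
  rw [equivariantOp, StarSubalgebra.mem_centralizer_iff]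
  refine ⟨fun h k => (h _ ⟨k, rfl⟩).1, ?_⟩
  rintro h _ ⟨k, rfl⟩
  rw [star_shift]
  exact ⟨h k, h k⁻¹⟩

theorem mem_equivariantOp_iff {T : LTwoOp (J × H)} :
    T ∈ equivariantOp J H ↔ ∀ (k : H) (i : J) (h : H) (j : J) (h' : H),
      entry T (i, h * k) (j, h' * k) = entry T (i, h) (j, h') := by
  rw [mem_equivariantOp_iff_commute]
  constructor
  · intro hT k i h j h'
    have := congrArg (fun S => entry S (i, h * k) (j, h')) (hT k)
    simp only [entry_shift_mul, entry_mul_shift, mul_inv_cancel_right] at this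
    exact this.symm
  · intro hT k
    refine entry_ext fun p q => ?_
    obtain ⟨i, h⟩ := p
    obtain ⟨j, h'⟩ := q
    rw [entry_shift_mul, entry_mul_shift, ← hT k i (h * k⁻¹), inv_mul_cancel_right]

theorem entry_one_left {T : LTwoOp (J × H)} (hT : T ∈ equivariantOp J H) (i j : J) (h : H) :
    entry T (i, 1) (j, h) = entry T (i, h⁻¹) (j, 1) := by
  rw [← mem_equivariantOp_iff.1 hT h⁻¹ i 1 j h, one_mul, mul_inv_cancel]

theorem entry_diag {T : LTwoOp (J × H)} (hT : T ∈ equivariantOp J H) (j : J) (h : H) :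
    entry T (j, h) (j, h) = entry T (j, 1) (j, 1) := by
  rw [← mem_equivariantOp_iff.1 hT h j 1 j 1, one_mul]

theorem inverse_mem_equivariantOp {T S : LTwoOp (J × H)} (hT : T ∈ equivariantOp J H)
    (h1 : T * S = 1) (h2 : S * T = 1) : S ∈ equivariantOp J H := by
  rw [mem_equivariantOp_iff_commute] at hT ⊢
  intro k
  calc shift J k * S = S * T * (shift J k * S) := by rw [h2, one_mul]
    _ = S * (T * shift J k) * S := by simp only [mul_assoc]
    _ = S * shift J k := by rw [← hT k, mul_assoc, mul_assoc, h1, mul_one]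

/-! ### Hilbert–Schmidt families, trace class operators and the trace -/

/-- A family of operators on `ℓ²(J × H)` is Hilbert–Schmidt relative to `H` if the sum of the
squares of the relative Hilbert–Schmidt norms `(∑_j ‖b_k δ_{(j, 1)}‖²)^{1/2}` is finite. -/
def HilbertSchmidtFamily {ι : Type*} (b : ι → LTwoOp (J × H)) : Prop :=
  Summable fun p : ι × J => ‖b p.1 (LTwo.delta (p.2, 1))‖ ^ 2

theorem hilbertSchmidtFamily_iff {ι : Type*} {b : ι → LTwoOp (J × H)} :
    HilbertSchmidtFamily b ↔
      Summable fun q : (ι × J) × (J × H) => ‖entry (b q.1.1) q.2 (q.1.2, 1)‖ ^ 2 := by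
  have h : ∀ p : ι × J, HasSum (fun y => ‖entry (b p.1) y (p.2, 1)‖ ^ 2)
      (‖b p.1 (LTwo.delta (p.2, 1))‖ ^ 2) := fun p => LTwo.hasSum_norm_sq _
  rw [summable_prod_of_nonneg (fun q => by positivity)]
  simp only [fun p => (h p).tsum_eq]
  exact ⟨fun hb => ⟨fun p => (h p).summable, hb⟩, fun hb => hb.2⟩

theorem HilbertSchmidtFamily.mul_left {ι : Type*} {b : ι → LTwoOp (J × H)}
    (hb : HilbertSchmidtFamily b) (m : LTwoOp (J × H)) :
    HilbertSchmidtFamily fun k => m * b k := by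
  refine Summable.of_nonneg_of_le (fun p => by positivity) (fun p => ?_)
    (Summable.mul_left (‖m‖ ^ 2) hb)
  rw [← mul_pow]
  gcongr
  exact m.le_opNorm _

/-- The involution underlying the invariance of the Hilbert–Schmidt norm under the adjoint. -/
def swapIndex (ι J H : Type*) [Group H] : (ι × J) × (J × H) ≃ (ι × J) × (J × H) where
  toFun q := ((q.1.1, q.2.1), (q.1.2, q.2.2⁻¹))
  invFun q := ((q.1.1, q.2.1), (q.1.2, q.2.2⁻¹))
  left_inv q := by simp
  right_inv q := by simp

theorem HilbertSchmidtFamily.star {ι : Type*} {b : ι → LTwoOp (J × H)}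
    (hb : HilbertSchmidtFamily b) (hN : ∀ k, b k ∈ equivariantOp J H) :
    HilbertSchmidtFamily fun k => star (b k) := by
  rw [hilbertSchmidtFamily_iff] at hb ⊢
  rw [← (swapIndex ι J H).summable_iff] at hb
  refine hb.congr fun q => ?_
  obtain ⟨⟨k, j⟩, i, h⟩ := q
  simp only [swapIndex, Equiv.coe_fn_mk, Function.comp]
  rw [entry_star, norm_star, entry_one_left (hN k)]

theorem HilbertSchmidtFamily.mul_right {ι : Type*} {b : ι → LTwoOp (J × H)}
    (hb : HilbertSchmidtFamily b) (hN : ∀ k, b k ∈ equivariantOp J H) {m : LTwoOp (J × H)}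
    (hm : m ∈ equivariantOp J H) : HilbertSchmidtFamily fun k => b k * m := by
  have h := ((hb.star hN).mul_left (Star.star m)).star
    fun k => mul_mem (star_mem hm) (star_mem (hN k))
  simpa only [star_mul, star_star] using h

theorem summable_entry_mul_entry {ι : Type*} {b c : ι → LTwoOp (J × H)}
    (hb : HilbertSchmidtFamily b) (hc : HilbertSchmidtFamily c)
    (hN : ∀ k, b k ∈ equivariantOp J H) :
    Summable fun q : (ι × J) × (J × H) =>
      entry (b q.1.1) (q.1.2, 1) q.2 * entry (c q.1.1) q.2 (q.1.2, 1) := by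
  have hb' := hilbertSchmidtFamily_iff.1 (hb.star hN)
  have hc' := hilbertSchmidtFamily_iff.1 hc
  refine Summable.of_norm_bounded (hb'.add hc') fun q => ?_
  rw [norm_mul, entry_star, norm_star]
  nlinarith [sq_nonneg (‖entry (b q.1.1) (q.1.2, 1) q.2‖ - ‖entry (c q.1.1) q.2 (q.1.2, 1)‖),
    sq_nonneg (‖entry (b q.1.1) (q.1.2, 1) q.2‖ + ‖entry (c q.1.1) q.2 (q.1.2, 1)‖)]

theorem hasSum_diag_mul {ι : Type*} {b c : ι → LTwoOp (J × H)}
    (hb : HilbertSchmidtFamily b) (hc : HilbertSchmidtFamily c)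
    (hN : ∀ k, b k ∈ equivariantOp J H) :
    HasSum (fun p : ι × J => entry (b p.1 * c p.1) (p.2, 1) (p.2, 1))
      (∑' q : (ι × J) × (J × H),
        entry (b q.1.1) (q.1.2, 1) q.2 * entry (c q.1.1) q.2 (q.1.2, 1)) := by
  have h := (summable_entry_mul_entry hb hc hN).hasSum
  refine h.prod_fiberwise (g := fun p : ι × J => entry (b p.1 * c p.1) (p.2, 1) (p.2, 1)) ?_
  exact fun p => hasSum_entry_mul (b p.1) (c p.1) (p.2, 1) (p.2, 1)

/-- The trace of `∑ b_k c_k` does not change when the factors are exchanged. -/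
theorem tsum_diag_mul_comm {ι : Type*} {b c : ι → LTwoOp (J × H)}
    (hb : HilbertSchmidtFamily b) (hc : HilbertSchmidtFamily c)
    (hbN : ∀ k, b k ∈ equivariantOp J H) (hcN : ∀ k, c k ∈ equivariantOp J H) :
    ∑' p : ι × J, entry (b p.1 * c p.1) (p.2, 1) (p.2, 1) =
      ∑' p : ι × J, entry (c p.1 * b p.1) (p.2, 1) (p.2, 1) := by
  rw [(hasSum_diag_mul hb hc hbN).tsum_eq, (hasSum_diag_mul hc hb hcN).tsum_eq,
    ← (swapIndex ι J H).tsum_eq]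
  refine tsum_congr fun q => ?_
  obtain ⟨⟨k, j⟩, i, h⟩ := q
  simp only [swapIndex, Equiv.coe_fn_mk]
  rw [entry_one_left (hbN k), entry_one_left (hcN k), inv_inv, mul_comm]

/-- An operator is nuclear relative to `H` if it is a sum of products of the members of two
equivariant Hilbert–Schmidt families. -/
def IsNuclear (T : LTwoOp (J × H)) : Prop :=
  ∃ b c : ℕ → LTwoOp (J × H), (∀ k, b k ∈ equivariantOp J H) ∧ (∀ k, c k ∈ equivariantOp J H) ∧
    HilbertSchmidtFamily b ∧ HilbertSchmidtFamily c ∧ HasSum (fun k => b k * c k) T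

/-- The trace class operators on `ℓ²(J × H)` relative to `H`. -/
noncomputable def traceClass (J H : Type*) [Group H] : Submodule ℂ (LTwoOp (J × H)) :=
  Submodule.span ℂ {T | IsNuclear T}

/-- The trace relative to `H`: the sum of the diagonal entries over one point of each orbit. -/
noncomputable def hTrace (T : LTwoOp (J × H)) : ℂ := ∑' j, entry T (j, 1) (j, 1)

theorem hasSum_diag_of_hasSum {b c : ℕ → LTwoOp (J × H)} {T : LTwoOp (J × H)}
    (hb : HilbertSchmidtFamily b) (hc : HilbertSchmidtFamily c)
    (hN : ∀ k, b k ∈ equivariantOp J H) (hT : HasSum (fun k => b k * c k) T) :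
    HasSum (fun j => entry T (j, 1) (j, 1))
      (∑' p : ℕ × J, entry (b p.1 * c p.1) (p.2, 1) (p.2, 1)) := by
  have h := (hasSum_diag_mul hb hc hN).summable.hasSum
  rw [← (Equiv.prodComm J ℕ).hasSum_iff] at h
  refine h.prod_fiberwise (g := fun j => entry T (j, 1) (j, 1)) fun j => ?_
  have h2 := hT.mapL (entryCLM (j, (1 : H)) (j, 1))
  simp only [entryCLM_apply] at h2
  exact h2

theorem summable_diag {T : LTwoOp (J × H)} (hT : T ∈ traceClass J H) :
    Summable fun j => entry T (j, 1) (j, 1) := by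
  induction hT using Submodule.span_induction with
  | mem T hT =>
    obtain ⟨b, c, hb, -, hbs, hcs, h⟩ := hT
    exact (hasSum_diag_of_hasSum hbs hcs hb h).summable
  | zero => exact summable_zero
  | add S T _ _ hS hT => exact hS.add hT
  | smul c T _ hT => exact hT.mul_left c

theorem hTrace_add {S T : LTwoOp (J × H)} (hS : S ∈ traceClass J H) (hT : T ∈ traceClass J H) :
    hTrace (S + T) = hTrace S + hTrace T :=
  (summable_diag hS).tsum_add (summable_diag hT)

theorem hTrace_sub {S T : LTwoOp (J × H)} (hS : S ∈ traceClass J H) (hT : T ∈ traceClass J H) :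
    hTrace (S - T) = hTrace S - hTrace T :=
  (summable_diag hS).tsum_sub (summable_diag hT)

theorem hTrace_smul (c : ℂ) (T : LTwoOp (J × H)) : hTrace (c • T) = c * hTrace T :=
  tsum_mul_left

theorem star_mem_traceClass {T : LTwoOp (J × H)} (hT : T ∈ traceClass J H) :
    star T ∈ traceClass J H := by
  induction hT using Submodule.span_induction with
  | mem T hT =>
    obtain ⟨b, c, hb, hc, hbs, hcs, h⟩ := hT
    refine Submodule.subset_span ⟨fun k => star (c k), fun k => star (b k),
      fun k => star_mem (hc k), fun k => star_mem (hb k), hcs.star hc, hbs.star hb, ?_⟩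
    simpa only [star_mul] using h.star
  | zero => rw [star_zero]; exact zero_mem _
  | add S T _ _ hS hT => rw [star_add]; exact add_mem hS hT
  | smul c T _ hT => rw [star_smul]; exact Submodule.smul_mem _ _ hT

theorem mul_mem_traceClass {m T : LTwoOp (J × H)} (hm : m ∈ equivariantOp J H)
    (hT : T ∈ traceClass J H) : m * T ∈ traceClass J H := by
  induction hT using Submodule.span_induction with
  | mem T hT =>
    obtain ⟨b, c, hb, hc, hbs, hcs, h⟩ := hT
    refine Submodule.subset_span ⟨fun k => m * b k, c, fun k => mul_mem hm (hb k), hc,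
      hbs.mul_left m, hcs, ?_⟩
    simpa only [mul_assoc] using h.mul_left m
  | zero => rw [mul_zero]; exact zero_mem _
  | add S T _ _ hS hT => rw [mul_add]; exact add_mem hS hT
  | smul c T _ hT => rw [mul_smul_comm]; exact Submodule.smul_mem _ _ hT

theorem mem_traceClass_mul {m T : LTwoOp (J × H)} (hm : m ∈ equivariantOp J H)
    (hT : T ∈ traceClass J H) : T * m ∈ traceClass J H := by
  simpa only [star_mul, star_star] using
    star_mem_traceClass (mul_mem_traceClass (star_mem hm) (star_mem_traceClass hT))

theorem hTrace_mul_comm {m T : LTwoOp (J × H)} (hm : m ∈ equivariantOp J H)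
    (hT : T ∈ traceClass J H) : hTrace (m * T) = hTrace (T * m) := by
  induction hT using Submodule.span_induction with
  | mem T hT =>
    obtain ⟨b, c, hb, hc, hbs, hcs, h⟩ := hT
    have hmb : ∀ k, m * b k ∈ equivariantOp J H := fun k => mul_mem hm (hb k)
    have hcm : ∀ k, c k * m ∈ equivariantOp J H := fun k => mul_mem (hc k) hm
    have h1 := hasSum_diag_of_hasSum (hbs.mul_left m) hcs hmb
      (by simpa only [mul_assoc] using h.mul_left m)
    have h2 := hasSum_diag_of_hasSum hbs (hcs.mul_right hc hm) hb
      (by simpa only [mul_assoc] using h.mul_right m)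
    rw [hTrace, hTrace, h1.tsum_eq, h2.tsum_eq,
      tsum_diag_mul_comm (hbs.mul_left m) hcs hmb hc,
      tsum_diag_mul_comm hbs (hcs.mul_right hc hm) hb hcm]
    simp only [mul_assoc]
  | zero => rw [mul_zero, zero_mul]
  | add S T hS' hT' hS hT =>
    rw [mul_add, add_mul, hTrace_add (mul_mem_traceClass hm hS') (mul_mem_traceClass hm hT'),
      hTrace_add (mem_traceClass_mul hm hS') (mem_traceClass_mul hm hT'), hS, hT]
  | smul c T _ hT => rw [mul_smul_comm, smul_mul_assoc, hTrace_smul, hTrace_smul, hT]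

/-- A product of two equivariant Hilbert–Schmidt operators is trace class. -/
theorem mul_mem_traceClass_of_hilbertSchmidt {b c : LTwoOp (J × H)}
    (hb : b ∈ equivariantOp J H) (hc : c ∈ equivariantOp J H)
    (hbs : HilbertSchmidtFamily fun _ : Unit => b) (hcs : HilbertSchmidtFamily fun _ : Unit => c) :
    b * c ∈ traceClass J H := by
  have key : ∀ a : LTwoOp (J × H), (HilbertSchmidtFamily fun _ : Unit => a) →
      HilbertSchmidtFamily (Pi.single 0 a : ℕ → LTwoOp (J × H)) := by
    intro a ha
    have hinj : Function.Injective (fun p : Unit × J => ((0 : ℕ), p.2)) :=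
      fun p q h => Prod.ext rfl (Prod.ext_iff.1 h).2
    refine (hinj.summable_iff fun p hp => ?_).1 (ha.congr fun p => ?_)
    · obtain ⟨k, j⟩ := p
      have hk : k ≠ 0 := by
        rintro rfl
        exact hp ⟨((), j), rfl⟩
      simp [Pi.single_eq_of_ne hk]
    · simp [Function.comp]
  have mem : ∀ a ∈ equivariantOp J H, ∀ k,
      (Pi.single 0 a : ℕ → LTwoOp (J × H)) k ∈ equivariantOp J H := by
    intro a ha k
    rcases eq_or_ne k 0 with rfl | hk
    · simpa using ha
    · rw [Pi.single_eq_of_ne hk]; exact zero_mem _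
  refine Submodule.subset_span ⟨_, _, mem b hb, mem c hc, key b hbs, key c hcs, ?_⟩
  have h := hasSum_single (f := fun k => (Pi.single 0 b : ℕ → LTwoOp (J × H)) k
    * (Pi.single 0 c : ℕ → LTwoOp (J × H)) k) 0 fun k hk => by
      rw [Pi.single_eq_of_ne hk, zero_mul]
  simpa using h

end Equivariant

/-! ### Projections near almost idempotent elements -/

section NearbyProjection

/-- A self-adjoint element that is almost idempotent is close to a projection, which can be chosen
in every closed `*`-subalgebra containing the element. -/
theorem exists_isStarProjection_near {A : Type*} [CStarAlgebra A] {x : A} (hx : IsSelfAdjoint x)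
    {δ : ℝ} (hδ : δ ≤ 1 / 16) (h : ‖x * x - x‖ ≤ δ) :
    ∃ q : A, IsStarProjection q ∧ ‖q - x‖ ≤ 2 * δ ∧ Commute q x ∧
      ∀ S : StarSubalgebra ℂ A, IsClosed (S : Set A) → x ∈ S → q ∈ S := by
  have hspec : ∀ t ∈ spectrum ℝ x, |t * t - t| ≤ δ := by
    intro t ht
    have h1 := norm_apply_le_norm_cfc (fun t : ℝ => t * t - t) x ht
    have h2 : cfc (fun t : ℝ => t * t - t) x = x * x - x := by
      rw [cfc_sub .., cfc_mul .., cfc_id' ..]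
    rw [h2] at h1
    exact h1.trans h
  have hne : ∀ t ∈ spectrum ℝ x, t ≠ 1 / 2 := by
    rintro t ht rfl
    have := abs_le.1 (hspec _ ht)
    norm_num at this
    linarith [this.1]
  -- the characteristic function of `[1/2, ∞)`, continuous on the spectrum of `x`
  let χ : ℝ → ℝ := fun t => if t < 1 / 2 then 0 else 1
  have hχ : ContinuousOn χ (spectrum ℝ x) := by
    intro t ht
    refine ContinuousAt.continuousWithinAt ?_
    rcases lt_or_gt_of_ne (hne t ht) with hlt | hgt
    · refine (continuousAt_const (y := (0 : ℝ))).congr ?_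
      filter_upwards [Iio_mem_nhds hlt] with s hs
      exact (if_pos hs).symm
    · refine (continuousAt_const (y := (1 : ℝ))).congr ?_
      filter_upwards [Ioi_mem_nhds hgt] with s hs
      exact (if_neg (not_lt.2 (le_of_lt hs))).symm
  have hcomm : Commute (cfc χ x) x := by
    have h1 := cfc_commute_cfc χ (fun t : ℝ => t) x
    rwa [cfc_id' ..] at h1
  refine ⟨cfc χ x, ⟨?_, cfc_predicate χ x⟩, ?_, hcomm, fun S hS hxS => ?_⟩
  · rw [IsIdempotentElem, ← cfc_mul χ χ x hχ hχ]
    refine cfc_congr fun t _ => ?_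
    simp only [χ]
    split_ifs <;> norm_num
  · have e : cfc χ x - x = cfc (fun t => χ t - t) x := by
      rw [cfc_sub χ (fun t => t) x hχ, cfc_id' ..]
    have hδ0 : 0 ≤ δ := (norm_nonneg _).trans h
    rw [e]
    refine norm_cfc_le (by positivity) fun t ht => ?_
    have h1 := abs_le.1 (hspec t ht)
    rw [Real.norm_eq_abs, abs_le]
    simp only [χ]
    split_ifs with h2
    · constructor <;> nlinarith
    · constructor <;> nlinarith
  · have := hS
    exact cfc_mem χ hxS

/-- Conjugating by the symmetry `w` turns `q + σ (e - q) σ` into `e`; therefore the difference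
`p - q` of two projections is conjugate to the difference of a projection and `e`. The projection is
the conjugate of `p + σ (e - q) σ`, whose summands lie below `e` and `1 - e`. -/
theorem isStarProjection_add_conj {R : Type*} [Ring R] [StarRing R] {p q e σ w : R}
    (hp : IsStarProjection p) (hq : IsStarProjection q) (he : IsStarProjection e)
    (hσ : star σ = σ) (hσ2 : σ * σ = 1) (hσe : σ * e * σ = 1 - e) (hpe : p * e = p)
    (hqe : q * e = q) (hw : w = q + σ * q * σ + σ * (1 - (q + σ * q * σ))) :
    star w = w ∧ w * w = 1 ∧ IsStarProjection (e + w * (p - q) * w) := by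
  have hp1 : p * p = p := hp.isIdempotentElem
  have hp2 : star p = p := hp.isSelfAdjoint
  have hq1 : q * q = q := hq.isIdempotentElem
  have hq2 : star q = q := hq.isSelfAdjoint
  have he1 : e * e = e := he.isIdempotentElem
  have he2 : star e = e := he.isSelfAdjoint
  have hep : e * p = p := by simpa [hp2, he2] using congrArg star hpe
  have heq : e * q = q := by simpa [hq2, he2] using congrArg star hqe
  have heσe : e * σ * e = 0 := by
    have h1 : σ * (1 - e) = e * σ := by rw [← hσe, ← mul_assoc, ← mul_assoc, hσ2, one_mul]
    rw [← h1, mul_assoc, sub_mul, one_mul, he1, sub_self, mul_zero]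
  have hzero : ∀ a b : R, a * e = a → e * b = b → a * σ * b = 0 := by
    intro a b ha hb
    rw [← ha, ← hb, show a * e * σ * (e * b) = a * (e * σ * e) * b by simp only [mul_assoc],
      heσe, mul_zero, zero_mul]
  obtain ⟨s, hs⟩ : ∃ s, s = q + σ * q * σ := ⟨_, rfl⟩
  rw [← hs] at hw
  have hσσ : ∀ a b : R, a * σ * (σ * b) = a * b := fun a b => by
    rw [mul_assoc, ← mul_assoc σ, hσ2, one_mul]
  have hqs : q * s = q := by
    rw [hs, mul_add, hq1, ← mul_assoc, ← mul_assoc, hzero q q hqe heq, zero_mul, add_zero]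
  have hstar : star s = s := by
    rw [hs]; simp only [star_add, star_mul, hq2, hσ, mul_assoc]
  have hsq : s * q = q := by simpa [hstar, hq2] using congrArg star hqs
  have hsσ : s * σ = σ * s := by
    rw [hs, add_mul, mul_add, mul_assoc (σ * q), hσ2, mul_one, ← mul_assoc, ← mul_assoc, hσ2,
      one_mul, add_comm]
  have hss : s * s = s := by
    have h1 : s * (σ * q * σ) = σ * q * σ := by
      rw [← mul_assoc, ← mul_assoc, hsσ, mul_assoc σ, hsq]
    conv_lhs => rw [hs, mul_add, ← hs, hsq, h1, ← hs]
  have hes : e * s = q := by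
    rw [hs, mul_add, heq, ← mul_assoc, ← mul_assoc, hzero e q he1 heq, zero_mul, add_zero]
  have hse : s * e = q := by simpa [hstar, hq2, he2] using congrArg star hes
  have hsc : s * (1 - s) = 0 := by rw [mul_sub, mul_one, hss, sub_self]
  have hcs : (1 - s) * s = 0 := by rw [sub_mul, one_mul, hss, sub_self]
  have hcc : (1 - s) * (1 - s) = 1 - s := by rw [mul_sub, mul_one, hcs, sub_zero]
  have hcσ : (1 - s) * σ = σ * (1 - s) := by rw [sub_mul, mul_sub, hsσ, one_mul, mul_one]
  have hw1 : star w = w := by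
    rw [hw, star_add, star_mul, star_sub, star_one, hσ, hstar, hcσ]
  have hw2 : w * w = 1 := by
    have h1 : s * (σ * (1 - s)) = 0 := by rw [← mul_assoc, hsσ, mul_assoc, hsc, mul_zero]
    have h2 : σ * (1 - s) * s = 0 := by rw [mul_assoc, hcs, mul_zero]
    have h3 : σ * (1 - s) * (σ * (1 - s)) = 1 - s := by
      calc σ * (1 - s) * (σ * (1 - s)) = (1 - s) * σ * (σ * (1 - s)) := by rw [hcσ]
        _ = 1 - s := by rw [hσσ, hcc]
    rw [hw, add_mul, mul_add, mul_add, hss, h1, h2, h3]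
    abel
  have hwe : w * e = q + σ * (e - q) := by
    rw [hw, add_mul, hse, mul_assoc, sub_mul, one_mul, hse]
  have hqw : q * w = q := by
    rw [hw, mul_add, hqs, ← hcσ, ← mul_assoc, mul_sub, mul_one, hqs, sub_self, zero_mul, add_zero]
  have hew : e * w = q + (e - q) * σ := by
    simpa [hw1, he2, hq2, hσ] using congrArg star hwe
  have hwew : w * e * w = q + σ * (e - q) * σ := by
    rw [hwe, add_mul, hqw, mul_assoc σ, sub_mul e, hew, hqw, add_sub_cancel_left, mul_assoc]
  have hT : IsStarProjection (p + σ * (e - q) * σ) := by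
    have h1 : p * (σ * (e - q) * σ) = 0 := by
      rw [← mul_assoc, ← mul_assoc, hzero p (e - q) hpe (by rw [mul_sub, he1, heq]), zero_mul]
    have h2 : σ * (e - q) * σ * p = 0 := by
      rw [mul_assoc σ, mul_assoc σ, hzero (e - q) p (by rw [sub_mul, he1, hqe]) hep, mul_zero]
    have h3 : σ * (e - q) * σ * (σ * (e - q) * σ) = σ * (e - q) * σ := by
      have h4 : (e - q) * (e - q) = e - q := by
        rw [sub_mul, mul_sub, mul_sub, he1, heq, hqe, hq1, sub_self, sub_zero]
      calc σ * (e - q) * σ * (σ * (e - q) * σ) = σ * (e - q) * σ * (σ * ((e - q) * σ)) := by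
            rw [mul_assoc σ (e - q) σ]
        _ = σ * ((e - q) * (e - q)) * σ := by rw [hσσ, ← mul_assoc, mul_assoc σ]
        _ = σ * (e - q) * σ := by rw [h4]
    refine ⟨?_, ?_⟩
    · rw [IsIdempotentElem, add_mul, mul_add, mul_add, hp1, h1, h2, h3, zero_add, add_zero]
    · rw [IsSelfAdjoint, star_add, star_mul, star_mul, star_sub, hp2, hq2, he2, hσ, mul_assoc]
  have hS : e + w * (p - q) * w = w * (p + σ * (e - q) * σ) * w := by
    have : p + σ * (e - q) * σ = w * e * w + (p - q) := by rw [hwew]; abel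
    rw [this, mul_add, add_mul]
    congr 1
    rw [← mul_assoc, ← mul_assoc, hw2, one_mul, mul_assoc, hw2, mul_one]
  refine ⟨hw1, hw2, ?_⟩
  rw [hS]
  refine ⟨?_, ?_⟩
  · have h1 : (p + σ * (e - q) * σ) * (p + σ * (e - q) * σ) = _ := hT.isIdempotentElem
    rw [IsIdempotentElem, mul_assoc, ← mul_assoc w, ← mul_assoc w, hw2, one_mul, ← mul_assoc,
      mul_assoc w, h1]
  · have h1 : star (p + σ * (e - q) * σ) = _ := hT.isSelfAdjoint
    rw [IsSelfAdjoint, star_mul, star_mul, h1, hw1]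
    exact (mul_assoc _ _ _).symm

end NearbyProjection

/-! ### Differences of projections and the trace -/

section ProjectionTrace

variable {J H : Type*} [Group H]

theorem norm_one_LTwoOp_le (α : Type*) : ‖(1 : LTwoOp α)‖ ≤ 1 := ContinuousLinearMap.norm_id_le

theorem IsStarProjection.norm_LTwoOp_le {α : Type*} {p : LTwoOp α} (hp : IsStarProjection p) :
    ‖p‖ ≤ 1 := by
  have h1 : star p * p = p := by rw [hp.isSelfAdjoint.star_eq, hp.isIdempotentElem.eq]
  have h2 := CStarRing.norm_star_mul_self (x := p)
  rw [h1] at h2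
  nlinarith [norm_nonneg p, sq_nonneg (‖p‖ - 1)]

/-- Two nearby projections whose difference is trace class have the same trace: they are conjugate
by an invertible operator that is a trace class perturbation of the identity. -/
theorem hTrace_sub_eq_zero {p q : LTwoOp (J × H)} (hp : IsStarProjection p)
    (hq : IsStarProjection q) (hpN : p ∈ equivariantOp J H) (hqN : q ∈ equivariantOp J H)
    (hT : q - p ∈ traceClass J H) (hn : ‖q - p‖ < 1 / 4) : hTrace (q - p) = 0 := by
  have hp1 : p * p = p := hp.isIdempotentElem
  have hq1 : q * q = q := hq.isIdempotentElem
  obtain ⟨κ, hκ⟩ : ∃ κ, κ = (q - p) * (p + p - 1) := ⟨_, rfl⟩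
  have hκn : ‖-κ‖ < 1 := by
    have h1 : ‖p + p - 1‖ ≤ 3 := by
      refine (norm_sub_le _ _).trans ?_
      linarith [norm_add_le p p, hp.norm_LTwoOp_le, norm_one_LTwoOp_le (J × H)]
    rw [norm_neg, hκ]
    refine (norm_mul_le _ _).trans_lt ?_
    nlinarith [norm_nonneg (q - p), norm_nonneg (p + p - 1)]
  have hκN : κ ∈ equivariantOp J H := by
    rw [hκ]
    exact mul_mem (sub_mem hqN hpN) (sub_mem (add_mem hpN hpN) (one_mem _))
  have hκT : κ ∈ traceClass J H := by
    rw [hκ]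
    exact mem_traceClass_mul (sub_mem (add_mem hpN hpN) (one_mem _)) hT
  obtain ⟨z, hz⟩ := isUnit_one_sub_of_norm_lt_one hκn
  rw [sub_neg_eq_add] at hz
  have hzN : (z : LTwoOp (J × H)) ∈ equivariantOp J H := hz ▸ add_mem (one_mem _) hκN
  have hwN : ((z⁻¹ : (LTwoOp (J × H))ˣ) : LTwoOp (J × H)) ∈ equivariantOp J H :=
    inverse_mem_equivariantOp hzN z.mul_inv z.inv_mul
  have hzp : (z : LTwoOp (J × H)) * p = q * z := by
    rw [hz, hκ]
    have h1 : (1 + (q - p) * (p + p - 1)) * p = q * p := by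
      have : (1 + (q - p) * (p + p - 1)) * p
        = p + (q * (p * p) + q * (p * p) - q * p - (p * (p * p) + p * (p * p) - p * p)) := by
        noncomm_ring
      rw [this]; simp only [hp1]; abel
    have h2 : q * (1 + (q - p) * (p + p - 1)) = q * p := by
      have : q * (1 + (q - p) * (p + p - 1))
        = q + (q * q * p + q * q * p - q * q - (q * (p * p) + q * (p * p) - q * p)) := by
        noncomm_ring
      rw [this]; simp only [hp1, hq1]; abel
    rw [h1, h2]
  set w : LTwoOp (J × H) := ((z⁻¹ : (LTwoOp (J × H))ˣ) : LTwoOp (J × H)) with hw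
  have hzw : (z : LTwoOp (J × H)) * w = 1 := z.mul_inv
  have hwz : w * (z : LTwoOp (J × H)) = 1 := z.inv_mul
  have hw1 : w = 1 - κ * w := by
    rw [eq_sub_iff_add_eq, ← hzw, hz, add_mul, one_mul]
  have hdiff : q - p = κ * p - z * p * (κ * w) := by
    have h1 : q = z * p * w := by rw [hzp, mul_assoc, hzw, mul_one]
    have h2 : q = z * p - z * p * (κ * w) := by
      conv_lhs => rw [h1, hw1, mul_sub, mul_one]
    have h3 : (z : LTwoOp (J × H)) * p = p + κ * p := by rw [hz, add_mul, one_mul]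
    calc q - p = z * p - z * p * (κ * w) - p := by rw [← h2]
      _ = p + κ * p - z * p * (κ * w) - p := congrArg (fun y => y - z * p * (κ * w) - p) h3
      _ = κ * p - z * p * (κ * w) := by abel
  have hκw := mem_traceClass_mul hwN hκT
  have hzpN := mul_mem hzN hpN
  rw [hdiff, hTrace_sub (mem_traceClass_mul hpN hκT) (mul_mem_traceClass hzpN hκw),
    hTrace_mul_comm hzpN hκw]
  have : κ * w * (z * p) = κ * p := by rw [mul_assoc, ← mul_assoc w, hwz, one_mul]
  rw [this, sub_self]

theorem hilbertSchmidtFamily_unit {s : LTwoOp (J × H)} :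
    (HilbertSchmidtFamily fun _ : Unit => s) ↔
      Summable fun j => ‖s (LTwo.delta (j, 1))‖ ^ 2 :=
  (Equiv.punitProd J).summable_iff (f := fun j => ‖s (LTwo.delta (j, (1 : H)))‖ ^ 2)

theorem HilbertSchmidtFamily.geometric {s : LTwoOp (J × H)}
    (hs : HilbertSchmidtFamily fun _ : Unit => s) {m : ℕ → LTwoOp (J × H)} {C ρ : ℝ}
    (hρ : 0 ≤ ρ) (hρ1 : ρ < 1) (hm : ∀ k, ‖m k‖ ≤ C * ρ ^ k) :
    HilbertSchmidtFamily fun k => m k * s := by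
  have hC : 0 ≤ C := by simpa using (norm_nonneg _).trans (hm 0)
  have h1 : Summable fun k : ℕ => (C * ρ ^ k) ^ 2 := by
    have : ∀ k : ℕ, (C * ρ ^ k) ^ 2 = C ^ 2 * (ρ ^ 2) ^ k := fun k => by ring
    simp only [this]
    exact (summable_geometric_of_lt_one (by positivity) (by nlinarith)).mul_left _
  refine Summable.of_nonneg_of_le (fun p => by positivity) (fun p => ?_)
    (h1.mul_of_nonneg (hilbertSchmidtFamily_unit.1 hs) (fun k => by positivity)
      (fun j => by positivity))
  rw [← mul_pow]
  refine pow_le_pow_left₀ (norm_nonneg _) (((m p.1).le_opNorm _).trans ?_) 2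
  exact mul_le_mul_of_nonneg_right (hm _) (norm_nonneg _)

theorem norm_pow_le_of_norm_le {A : Type*} [NormedRing A] (h1 : ‖(1 : A)‖ ≤ 1) {x : A} {c : ℝ}
    (hx : ‖x‖ ≤ c) (k : ℕ) : ‖x ^ k‖ ≤ c ^ k := by
  have hc : 0 ≤ c := (norm_nonneg x).trans hx
  induction k with
  | zero => simpa using h1
  | succ k ih =>
    rw [pow_succ, pow_succ]
    exact (norm_mul_le _ _).trans (mul_le_mul ih hx (norm_nonneg _) (by positivity))

/-- The solution of the Sylvester equation `X = W Y + W X v` with `‖W‖ ‖v‖ < 1` is the sum of the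
series obtained by iteration. -/
theorem hasSum_sylvester {A : Type*} [NormedRing A] [CompleteSpace A] (h1 : ‖(1 : A)‖ ≤ 1)
    {W X Y v : A} (hW : ‖W‖ ≤ 4 / 3) (hv : ‖v‖ ≤ 1 / 4) (hfix : X = W * Y + W * X * v) :
    HasSum (fun k : ℕ => W ^ (k + 1) * Y * v ^ k) X := by
  have hpartial : ∀ n : ℕ, ∑ k ∈ Finset.range n, W ^ (k + 1) * Y * v ^ k
      = X - W ^ n * X * v ^ n := by
    intro n
    induction n with
    | zero => simp
    | succ n ih =>
      have h3 : W ^ n * X * v ^ n = W ^ (n + 1) * Y * v ^ n + W ^ (n + 1) * X * v ^ (n + 1) := by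
        conv_lhs => rw [hfix]
        rw [pow_succ, pow_succ' v]
        simp only [mul_add, add_mul, mul_assoc]
      rw [Finset.sum_range_succ, ih, h3]
      abel
  have hbound : ∀ (n m : ℕ) (Z : A),
      ‖W ^ n * Z * v ^ m‖ ≤ (4 / 3) ^ n * ‖Z‖ * (1 / 4) ^ m := by
    intro n m Z
    refine (norm_mul_le _ _).trans
      (mul_le_mul ?_ (norm_pow_le_of_norm_le h1 hv m) (norm_nonneg _) (by positivity))
    exact (norm_mul_le _ _).trans
      (mul_le_mul_of_nonneg_right (norm_pow_le_of_norm_le h1 hW n) (norm_nonneg _))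
  have hsummable : Summable fun k : ℕ => W ^ (k + 1) * Y * v ^ k := by
    refine Summable.of_norm_bounded
      ((summable_geometric_of_lt_one (r := 1 / 3) (by norm_num) (by norm_num)).mul_left
        (4 / 3 * ‖Y‖)) fun k => (hbound (k + 1) k Y).trans_eq ?_
    rw [show (1 / 3 : ℝ) = 4 / 3 * (1 / 4) by norm_num, mul_pow]
    ring
  rw [hsummable.hasSum_iff_tendsto_nat]
  simp only [hpartial]
  have h0 : Filter.Tendsto (fun n : ℕ => W ^ n * X * v ^ n) Filter.atTop (nhds 0) := by
    refine squeeze_zero_norm (a := fun n : ℕ => ‖X‖ * (1 / 3) ^ n) (fun n => ?_) ?_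
    · refine (hbound n n X).trans_eq ?_
      rw [show (1 / 3 : ℝ) = 4 / 3 * (1 / 4) by norm_num, mul_pow]
      ring
    · simpa using (tendsto_pow_atTop_nhds_zero_of_lt_one (r := (1 / 3 : ℝ)) (by norm_num)
        (by norm_num)).const_mul ‖X‖
  simpa using h0.const_sub X

/-- If `a` is close to `1` on the range of the idempotent `p` and `b` is close to `0` on the kernel
of the idempotent `q`, and `a - b` is a product of Hilbert–Schmidt operators, then `p (1 - q)` is
trace class. -/
theorem mul_one_sub_mem_traceClass {a b p q s t : LTwoOp (J × H)}
    (haN : a ∈ equivariantOp J H) (hbN : b ∈ equivariantOp J H) (hpN : p ∈ equivariantOp J H)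
    (hqN : q ∈ equivariantOp J H) (hsN : s ∈ equivariantOp J H) (htN : t ∈ equivariantOp J H)
    (hp : p * p = p) (hq : q * q = q) (hap : a * p = p * a) (hbq : b * q = q * b)
    (hpn : ‖p - a * p‖ ≤ 1 / 4) (hqn : ‖b - b * q‖ ≤ 1 / 4)
    (hs : HilbertSchmidtFamily fun _ : Unit => s) (ht : HilbertSchmidtFamily fun _ : Unit => t)
    (hab : a - b = s * t) : p * (1 - q) ∈ traceClass J H := by
  set u := p - a * p with hu
  set v := b - b * q with hv
  have huN : u ∈ equivariantOp J H := sub_mem hpN (mul_mem haN hpN)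
  have hvN : v ∈ equivariantOp J H := sub_mem hbN (mul_mem hbN hqN)
  obtain ⟨z, hz⟩ := isUnit_one_sub_of_norm_lt_one (x := u) (by linarith)
  obtain ⟨W, hWdef⟩ : ∃ W, W = ((z⁻¹ : (LTwoOp (J × H))ˣ) : LTwoOp (J × H)) := ⟨_, rfl⟩
  have hzW : (1 - u) * W = 1 := by rw [hWdef, ← hz]; exact z.mul_inv
  have hWz : W * (1 - u) = 1 := by rw [hWdef, ← hz]; exact z.inv_mul
  have hWN : W ∈ equivariantOp J H :=
    inverse_mem_equivariantOp (sub_mem (one_mem _) huN) hzW hWz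
  have hWn : ‖W‖ ≤ 4 / 3 := by
    have h1 : W = 1 + u * W := by
      rw [sub_mul, one_mul, sub_eq_iff_eq_add] at hzW
      exact hzW
    have h2 : ‖W‖ ≤ 1 + 1 / 4 * ‖W‖ := by
      conv_lhs => rw [h1]
      refine (norm_add_le _ _).trans (add_le_add (norm_one_LTwoOp_le _) ?_)
      exact (norm_mul_le _ _).trans (mul_le_mul_of_nonneg_right hpn (norm_nonneg _))
    linarith
  -- `p (1 - q)` solves the Sylvester equation `X = W Y + W X v`, to be iterated
  set X := p * (1 - q) with hX
  set Y := p * (a - b) * (1 - q) with hY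
  have hq' : (1 - q) * b * (1 - q) = b * (1 - q) := by
    have h1 : b * (1 - q) = (1 - q) * b := by rw [mul_sub, sub_mul, hbq, one_mul, mul_one]
    rw [← h1, mul_assoc, mul_sub, mul_one, sub_mul, one_mul, hq, sub_self, sub_zero]
  have hSyl : (1 - u) * X = Y + X * v := by
    have h1 : (1 - u) * X = p * a * (1 - q) := by
      have : (1 - u) * X = (p - p * p + a * (p * p)) * (1 - q) := by
        rw [hu, hX]; noncomm_ring
      rw [this, hp, sub_self, zero_add, hap]
    have h2 : X * v = p * (b * (1 - q)) := by
      rw [← hq', hv, hX]; noncomm_ring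
    rw [h1, h2, hY]
    noncomm_ring
  have hfix : X = W * Y + W * X * v := by
    calc X = W * ((1 - u) * X) := by rw [← mul_assoc, hWz, one_mul]
      _ = W * Y + W * X * v := by rw [hSyl, mul_add, ← mul_assoc W X]
  have hsum := hasSum_sylvester (norm_one_LTwoOp_le (J × H)) hWn hqn hfix
  have hWpow := norm_pow_le_of_norm_le (norm_one_LTwoOp_le (J × H)) hWn
  have hvpow := norm_pow_le_of_norm_le (norm_one_LTwoOp_le (J × H)) hqn
  -- distribute the powers of `2` so that both factors decay geometrically
  have hqc : (1 - q) ∈ equivariantOp J H := sub_mem (one_mem _) hqN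
  have hcN : ∀ k : ℕ, (2 : ℂ) ^ k • (t * (1 - q) * v ^ k) ∈ equivariantOp J H := fun k =>
    SMulMemClass.smul_mem _ (mul_mem (mul_mem htN hqc) (pow_mem hvN k))
  refine Submodule.subset_span ⟨fun k => ((1 / 2 : ℂ) ^ k • (W ^ (k + 1) * p)) * s,
    fun k => (2 : ℂ) ^ k • (t * (1 - q) * v ^ k), fun k => ?_, hcN, ?_, ?_, ?_⟩
  · exact mul_mem (SMulMemClass.smul_mem _ (mul_mem (pow_mem hWN _) hpN)) hsN
  · refine hs.geometric (C := 4 / 3 * ‖p‖) (ρ := 2 / 3) (by norm_num) (by norm_num) fun k => ?_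
    rw [norm_smul, norm_pow]
    have h1 : ‖W ^ (k + 1) * p‖ ≤ (4 / 3) ^ (k + 1) * ‖p‖ :=
      (norm_mul_le _ _).trans (mul_le_mul_of_nonneg_right (hWpow _) (norm_nonneg _))
    refine (mul_le_mul_of_nonneg_left h1 (by positivity)).trans_eq ?_
    rw [show (2 / 3 : ℝ) = 1 / 2 * (4 / 3) by norm_num, mul_pow]
    norm_num
    ring
  · have h1 : HilbertSchmidtFamily fun k : ℕ =>
        ((2 : ℂ) ^ k • (star v ^ k * star (1 - q))) * star t := by
      refine (ht.star fun _ => htN).geometric (C := ‖star (1 - q)‖) (ρ := 1 / 2) (by norm_num)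
        (by norm_num) fun k => ?_
      rw [norm_smul, norm_pow]
      have h1 : ‖star v ^ k * star (1 - q)‖ ≤ (1 / 4) ^ k * ‖star (1 - q)‖ := by
        refine (norm_mul_le _ _).trans (mul_le_mul_of_nonneg_right ?_ (norm_nonneg _))
        rw [← star_pow]
        exact (norm_star (v ^ k)).trans_le (hvpow k)
      refine (mul_le_mul_of_nonneg_left h1 (by positivity)).trans_eq ?_
      rw [show (1 / 2 : ℝ) = 2 * (1 / 4) by norm_num, mul_pow]
      norm_num
      ring
    have h2 := h1.star fun k => mul_mem (SMulMemClass.smul_mem _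
      (mul_mem (pow_mem (star_mem hvN) _) (star_mem hqc))) (star_mem htN)
    have h3 : ∀ k : ℕ, star ((2 : ℂ) ^ k • (star v ^ k * star (1 - q)) * star t)
        = (2 : ℂ) ^ k • (t * (1 - q) * v ^ k) := by
      intro k
      rw [star_mul, star_star, star_smul, star_mul, star_star, star_pow (star v), star_star,
        mul_smul_comm, mul_assoc]
      simp
    simpa only [h3] using h2
  · refine hsum.congr_fun fun k => ?_
    beta_reduce
    have h1 : ((1 / 2 : ℂ) ^ k) * (2 : ℂ) ^ k = 1 := by rw [← mul_pow]; norm_num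
    rw [hY, hab, smul_mul_assoc, smul_mul_assoc, mul_smul_comm, smul_smul, h1, one_smul]
    simp only [mul_assoc]

/-- Two projections obtained by perturbation from operators whose difference is a product of
Hilbert–Schmidt operators have a trace class difference. -/
theorem sub_mem_traceClass {a b p q s t : LTwoOp (J × H)}
    (haN : a ∈ equivariantOp J H) (hbN : b ∈ equivariantOp J H) (hpN : p ∈ equivariantOp J H)
    (hqN : q ∈ equivariantOp J H) (hsN : s ∈ equivariantOp J H) (htN : t ∈ equivariantOp J H)
    (hp : IsStarProjection p) (hq : IsStarProjection q) (hap : a * p = p * a)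
    (hbq : b * q = q * b) (hp1 : ‖p - a * p‖ ≤ 1 / 4) (hp2 : ‖a - a * p‖ ≤ 1 / 4)
    (hq1 : ‖q - b * q‖ ≤ 1 / 4) (hq2 : ‖b - b * q‖ ≤ 1 / 4)
    (hs : HilbertSchmidtFamily fun _ : Unit => s) (ht : HilbertSchmidtFamily fun _ : Unit => t)
    (hab : a - b = s * t) : p - q ∈ traceClass J H := by
  have hpi : p * p = p := hp.isIdempotentElem
  have hqi : q * q = q := hq.isIdempotentElem
  have h1 := mul_one_sub_mem_traceClass haN hbN hpN hqN hsN htN hpi hqi hap hbq hp1 hq2 hs ht hab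
  have hns : HilbertSchmidtFamily fun _ : Unit => -s := by
    simpa using hs.mul_left (-1)
  have h2 := mul_one_sub_mem_traceClass hbN haN hqN hpN (neg_mem hsN) htN hqi hpi hbq hap hq1 hp2
    hns ht (by rw [neg_mul, ← hab, neg_sub])
  have h3 := sub_mem h1 (star_mem_traceClass h2)
  rw [star_mul, star_sub, star_one, hp.isSelfAdjoint.star_eq, hq.isSelfAdjoint.star_eq] at h3
  have h4 : p - q = p * (1 - q) - (1 - p) * q := by noncomm_ring
  rwa [h4]

end ProjectionTrace

/-! ### Blocks of operators on `ℓ²(J × H)` -/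

section Blocks

variable {J H : Type*}

/-- The operator on `ℓ²(J × H)` whose block at `(i, j)` is `c` and whose other blocks vanish. -/
noncomputable def unitOp (i j : J) (c : LTwoOp H) : LTwoOp (J × H) :=
  (extendZero (slice H i)).comp (c.comp (restrict (slice H j)))

/-- The block at `(i, j)` of an operator on `ℓ²(J × H)`. -/
noncomputable def block (i j : J) (T : LTwoOp (J × H)) : LTwoOp H :=
  (restrict (slice H i)).comp (T.comp (extendZero (slice H j)))

theorem slice_ne {i j : J} (hij : i ≠ j) (x y : H) : slice H i x ≠ slice H j y :=
  fun h => hij (Prod.ext_iff.1 h).1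

theorem unitOp_apply (i j : J) (c : LTwoOp H) (f : LTwo (J × H)) :
    unitOp i j c f = extendZero (slice H i) (c (restrict (slice H j) f)) := rfl

theorem block_apply (i j : J) (T : LTwoOp (J × H)) (f : LTwo H) :
    block i j T f = restrict (slice H i) (T (extendZero (slice H j) f)) := rfl

theorem entry_block (i j : J) (T : LTwoOp (J × H)) (h h' : H) :
    entry (block i j T) h h' = entry T (i, h) (j, h') :=
  congrArg (fun f => T f (i, h)) (extendZero_delta (slice H j) h')

theorem block_ext {S T : LTwoOp (J × H)} (h : ∀ i j, block i j S = block i j T) : S = T :=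
  entry_ext fun p q => by rw [← entry_block p.1 q.1 S p.2 q.2, h, entry_block]

theorem block_add (i j : J) (S T : LTwoOp (J × H)) :
    block i j (S + T) = block i j S + block i j T :=
  entry_ext fun h h' => by simp only [entry_block, entry_add]

theorem block_smul (i j : J) (c : ℂ) (T : LTwoOp (J × H)) :
    block i j (c • T) = c • block i j T :=
  entry_ext fun h h' => by simp only [entry_block, entry_smul]

theorem block_zero (i j : J) : block i j (0 : LTwoOp (J × H)) = 0 :=
  entry_ext fun h h' => by simp only [entry_block, entry_zero]

theorem block_star (i j : J) (T : LTwoOp (J × H)) : block i j (star T) = star (block j i T) :=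
  entry_ext fun h h' => by rw [entry_block, entry_star, entry_star, entry_block]

theorem restrict_slice_extendZero_slice [DecidableEq J] (i j : J) (f : LTwo H) :
    restrict (slice H i) (extendZero (slice H j) f) = if i = j then f else 0 := by
  split_ifs with h
  · subst h; exact restrict_extendZero _ f
  · exact restrict_extendZero_of_disjoint _ _ (slice_ne h) f

theorem block_one [DecidableEq J] (i j : J) :
    block i j (1 : LTwoOp (J × H)) = if i = j then 1 else 0 := by
  ext1 f
  rw [block_apply]
  refine (restrict_slice_extendZero_slice i j f).trans ?_
  split_ifs <;> rfl

theorem block_unitOp [DecidableEq J] (i j i' j' : J) (c : LTwoOp H) :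
    block i j (unitOp i' j' c) = if i = i' ∧ j = j' then c else 0 := by
  ext1 f
  rw [block_apply, unitOp_apply, restrict_slice_extendZero_slice, restrict_slice_extendZero_slice]
  by_cases h1 : i = i' <;> by_cases h2 : j = j' <;> simp [h1, h2, eq_comm (a := j')]

theorem star_unitOp (i j : J) (c : LTwoOp H) : star (unitOp i j c) = unitOp j i (star c) := by
  simp only [unitOp, ContinuousLinearMap.star_eq_adjoint, ContinuousLinearMap.adjoint_comp,
    adjoint_extendZero, adjoint_restrict, ContinuousLinearMap.comp_assoc]

theorem continuous_block (i j : J) : Continuous (block (H := H) i j) :=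
  ((ContinuousLinearMap.compL ℂ (LTwo H) (LTwo (J × H)) (LTwo H) (restrict (slice H i))).comp
    ((ContinuousLinearMap.compL ℂ (LTwo H) (LTwo (J × H)) (LTwo (J × H))).flip
      (extendZero (slice H j)))).continuous

/-- Placing an operator in the block at `(i, j)`, as a continuous linear map. -/
noncomputable def unitOpCLM (i j : J) : LTwoOp H →L[ℂ] LTwoOp (J × H) :=
  (ContinuousLinearMap.compL ℂ (LTwo (J × H)) (LTwo H) (LTwo (J × H)) (extendZero (slice H i))).comp
    ((ContinuousLinearMap.compL ℂ (LTwo (J × H)) (LTwo H) (LTwo H)).flip (restrict (slice H j)))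

theorem sum_extendZero_restrict_slice [Fintype J] (f : LTwo (J × H)) :
    ∑ k, extendZero (slice H k) (restrict (slice H k) f) = f := by
  classical
  have h : ∑ k, unitOp k k (1 : LTwoOp H) = (1 : LTwoOp (J × H)) := by
    refine LTwo.clm_ext fun p => ?_
    obtain ⟨j, h⟩ := p
    rw [sum_apply, Finset.sum_eq_single j]
    · rw [unitOp_apply]
      exact (congrArg _ (restrict_delta (slice H j) h)).trans (extendZero_delta _ _)
    · intro k _ hk
      rw [unitOp_apply, restrict_delta_of_notMem, map_zero, map_zero]
      rintro ⟨y, hy⟩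
      exact hk (Prod.ext_iff.1 hy).1
    · intro h; exact absurd (Finset.mem_univ j) h
  have h2 := DFunLike.congr_fun h f
  rw [sum_apply] at h2
  exact h2

theorem block_mul [Fintype J] (i j : J) (S T : LTwoOp (J × H)) :
    block i j (S * T) = ∑ k, block i k S * block k j T := by
  ext1 f
  rw [sum_apply, block_apply, mul_apply_eq_comp,
    ← sum_extendZero_restrict_slice (T (extendZero (slice H j) f)), map_sum, map_sum]
  rfl

theorem eq_sum_unitOp_block [Fintype J] (T : LTwoOp (J × H)) :
    T = ∑ i, ∑ j, unitOp i j (block i j T) := by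
  classical
  refine block_ext fun i j => ?_
  have hsum : ∀ (s : Finset J) (F : J → LTwoOp (J × H)),
      block i j (∑ k ∈ s, F k) = ∑ k ∈ s, block i j (F k) := fun s F =>
    map_sum (⟨⟨block i j, block_zero i j⟩, block_add i j⟩ : LTwoOp (J × H) →+ LTwoOp H) F s
  simp only [hsum, block_unitOp, ite_and]
  rw [Finset.sum_comm]
  simp

/-- The injection of `I × H` into `J × H` induced by an injection of index sets. -/
def indexEmb {I J : Type*} (H : Type*) (e : I ↪ J) : I × H ↪ J × H :=
  e.prodMap (Function.Embedding.refl H)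

theorem mem_range_indexEmb {I : Type*} (e : I ↪ J) (j : J) (h : H) :
    (j, h) ∈ Set.range (indexEmb H e) ↔ j ∈ Set.range e := by
  constructor
  · rintro ⟨⟨i, k⟩, hi⟩
    exact ⟨i, (Prod.ext_iff.1 hi).1⟩
  · rintro ⟨i, rfl⟩
    exact ⟨(i, h), rfl⟩

theorem corner_unitOp {I : Type*} (e : I ↪ J) (i j : I) (c : LTwoOp H) :
    corner (indexEmb H e) (unitOp i j c) = unitOp (e i) (e j) c := by
  ext1 f
  rw [corner_apply, unitOp_apply, unitOp_apply]
  exact DFunLike.congr_fun (extendZero_trans (slice H i) (indexEmb H e)) _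

end Blocks

/-! ### Operators with finitely many blocks in the reduced group `C*`-algebra -/

section FiniteRank

variable {J H : Type*} [Group H]

theorem leftReg_mem (h : H) : leftReg h ∈ ReducedCStar H :=
  StarSubalgebra.le_topologicalClosure _ (StarAlgebra.subset_adjoin ℂ _ ⟨h, rfl⟩)

theorem leftReg_delta (g h : H) : leftReg g (LTwo.delta h) = LTwo.delta (g * h) :=
  LTwo.congr_delta _ _

theorem isClosed_reducedCStar : IsClosed (ReducedCStar H : Set (LTwoOp H)) :=
  StarSubalgebra.isClosed_topologicalClosure _

theorem shift_extendZero_slice (k : H) (i : J) (f : LTwo H) :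
    shift J k (extendZero (slice H i) f) = extendZero (slice H i) (rightReg k f) := by
  have :
    (shift J k).comp (extendZero (slice H i)) = (extendZero (slice H i)).comp (rightReg k) := by
    refine LTwo.clm_ext fun h => ?_
    have h1 : rightReg k (LTwo.delta h) = LTwo.delta (h * k) := LTwo.congr_delta _ _
    simp only [ContinuousLinearMap.comp_apply, extendZero_delta, h1, slice_apply, shift_delta]
  exact DFunLike.congr_fun this f

theorem unitOp_mem_equivariantOp (i j : J) {c : LTwoOp H} (hc : c ∈ ReducedCStar H) :
    unitOp i j c ∈ equivariantOp J H := by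
  rw [mem_equivariantOp_iff_commute]
  intro k
  ext1 f
  have h1 := DFunLike.congr_fun (ReducedCStar.commute_rightReg ⟨c, hc⟩ k) (restrict (slice H j) f)
  change rightReg k (c (restrict (slice H j) f)) = c (rightReg k (restrict (slice H j) f)) at h1
  change shift J k (unitOp i j c f) = unitOp i j c (shift J k f)
  rw [unitOp_apply, unitOp_apply, shift_extendZero_slice, h1]
  rfl

/-- The operators on `ℓ²(J × H)` that have only finitely many nonzero blocks, all of them in
`C*_r H`. -/
noncomputable def finiteRank (J H : Type*) [Group H] : Submodule ℂ (LTwoOp (J × H)) :=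
  Submodule.span ℂ {T | ∃ (i j : J) (c : LTwoOp H), c ∈ ReducedCStar H ∧ T = unitOp i j c}

theorem unitOp_mem_finiteRank (i j : J) {c : LTwoOp H} (hc : c ∈ ReducedCStar H) :
    unitOp i j c ∈ finiteRank J H :=
  Submodule.subset_span ⟨i, j, c, hc, rfl⟩

theorem finiteRank_le_equivariantOp {T : LTwoOp (J × H)} (hT : T ∈ finiteRank J H) :
    T ∈ equivariantOp J H := by
  induction hT using Submodule.span_induction with
  | mem T hT =>
    obtain ⟨i, j, c, hc, rfl⟩ := hT
    exact unitOp_mem_equivariantOp i j hc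
  | zero => exact zero_mem _
  | add S T _ _ hS hT => exact add_mem hS hT
  | smul c T _ hT => exact SMulMemClass.smul_mem c hT

theorem star_mem_finiteRank {T : LTwoOp (J × H)} (hT : T ∈ finiteRank J H) :
    star T ∈ finiteRank J H := by
  induction hT using Submodule.span_induction with
  | mem T hT =>
    obtain ⟨i, j, c, hc, rfl⟩ := hT
    rw [star_unitOp]
    exact unitOp_mem_finiteRank j i (star_mem hc)
  | zero => rw [star_zero]; exact zero_mem _
  | add S T _ _ hS hT => rw [star_add]; exact add_mem hS hT
  | smul c T _ hT => rw [star_smul]; exact Submodule.smul_mem _ _ hT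

theorem block_mem_reducedCStar_of_finiteRank {T : LTwoOp (J × H)} (hT : T ∈ finiteRank J H)
    (i j : J) : block i j T ∈ ReducedCStar H := by
  classical
  induction hT using Submodule.span_induction with
  | mem T hT =>
    obtain ⟨i', j', c, hc, rfl⟩ := hT
    rw [block_unitOp]
    split_ifs
    · exact hc
    · exact zero_mem _
  | zero => rw [block_zero]; exact zero_mem _
  | add S T _ _ hS hT => rw [block_add]; exact add_mem hS hT
  | smul c T _ hT => rw [block_smul]; exact SMulMemClass.smul_mem c hT

theorem exists_finset_support {T : LTwoOp (J × H)} (hT : T ∈ finiteRank J H) :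
    ∃ F : Finset J, (∀ i ∉ F, ∀ f : LTwo (J × H), restrict (slice H i) (T f) = 0) ∧
      ∀ j ∉ F, ∀ h : H, T (LTwo.delta (j, h)) = 0 := by
  classical
  induction hT using Submodule.span_induction with
  | mem T hT =>
    obtain ⟨i, j, c, hc, rfl⟩ := hT
    refine ⟨{i, j}, fun k hk f => ?_, fun k hk h => ?_⟩
    · rw [unitOp_apply, restrict_slice_extendZero_slice, if_neg]
      rintro rfl
      exact hk (by simp)
    · rw [unitOp_apply, restrict_delta_of_notMem, map_zero, map_zero]
      rintro ⟨y, hy⟩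
      obtain rfl : j = k := (Prod.ext_iff.1 hy).1
      exact hk (by simp)
  | zero => exact ⟨∅, fun k _ f => map_zero _, fun _ _ _ => rfl⟩
  | add S T _ _ hS hT =>
    obtain ⟨F, h1, h2⟩ := hS
    obtain ⟨F', h3, h4⟩ := hT
    refine ⟨F ∪ F', fun k hk f => ?_, fun k hk h => ?_⟩
    · rw [Finset.mem_union, not_or] at hk
      change restrict _ (S f + T f) = 0
      rw [map_add, h1 k hk.1, h3 k hk.2, add_zero]
    · rw [Finset.mem_union, not_or] at hk
      change S _ + T _ = 0
      rw [h2 k hk.1, h4 k hk.2, add_zero]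
  | smul c T _ hT =>
    obtain ⟨F, h1, h2⟩ := hT
    refine ⟨F, fun k hk f => ?_, fun k hk h => ?_⟩
    · change restrict _ (c • T f) = 0
      rw [map_smul, h1 k hk, smul_zero]
    · change c • T _ = 0
      rw [h2 k hk, smul_zero]

theorem exists_embedding_support {T : LTwoOp (J × H)} (hT : T ∈ finiteRank J H) :
    ∃ (n : ℕ) (e : Fin n ↪ J), corner (indexEmb H e) 1 * T = T ∧
      T * corner (indexEmb H e) 1 = T := by
  classical
  obtain ⟨F, h1, h2⟩ := exists_finset_support hT
  let e : Fin F.card ↪ J := F.equivFin.symm.toEmbedding.trans (Function.Embedding.subtype _)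
  have he : ∀ j, j ∈ Set.range e ↔ j ∈ F := by
    intro j
    constructor
    · rintro ⟨a, rfl⟩
      exact (F.equivFin.symm a).2
    · intro hj
      exact ⟨F.equivFin ⟨j, hj⟩, by simp [e]⟩
  refine ⟨F.card, e, ?_, ?_⟩
  · ext1 f
    refine lp.ext (funext fun p => ?_)
    obtain ⟨j, h⟩ := p
    rw [mul_apply_eq_comp, corner_one_apply, mem_range_indexEmb, he]
    split_ifs with hj
    · rfl
    · exact (congrArg (fun f => f h) (h1 j hj f)).symm
  · refine LTwo.clm_ext fun p => ?_
    obtain ⟨j, h⟩ := p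
    rw [mul_apply_eq_comp, corner_one_delta, mem_range_indexEmb, he]
    split_ifs with hj
    · rfl
    · rw [map_zero, h2 j hj]

theorem corner_one_mem_equivariantOp {I : Type*} (e : I ↪ J) :
  corner (indexEmb H e) 1 ∈ equivariantOp J H := by
  classical
  rw [mem_equivariantOp_iff_commute]
  intro k
  refine LTwo.clm_ext fun p => ?_
  obtain ⟨j, h⟩ := p
  simp only [mul_apply_eq_comp, corner_one_delta, shift_delta, mem_range_indexEmb]
  split_ifs
  · rw [shift_delta]
  · rw [map_zero]

theorem hilbertSchmidtFamily_of_finite {T : LTwoOp (J × H)} (F : Finset J)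
    (hT : ∀ j ∉ F, T (LTwo.delta (j, 1)) = 0) : HilbertSchmidtFamily fun _ : Unit => T := by
  rw [hilbertSchmidtFamily_unit]
  refine summable_of_ne_finset_zero (s := F) fun j hj => ?_
  rw [hT j hj]
  simp

/-- Finite rank operators are products of Hilbert–Schmidt operators. -/
theorem exists_hilbertSchmidt_factorization {T : LTwoOp (J × H)} (hT : T ∈ finiteRank J H) :
    ∃ s t : LTwoOp (J × H), s ∈ equivariantOp J H ∧ t ∈ equivariantOp J H ∧
      (HilbertSchmidtFamily fun _ : Unit => s) ∧ (HilbertSchmidtFamily fun _ : Unit => t) ∧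
      T = s * t := by
  classical
  obtain ⟨n, e, -, h⟩ := exists_embedding_support hT
  have h0 : ∀ j ∉ Finset.univ.map e, corner (indexEmb H e) 1 (LTwo.delta (j, (1 : H))) = 0 := by
    intro j hj
    rw [corner_one_delta, mem_range_indexEmb, if_neg]
    simpa using hj
  refine ⟨T, corner (indexEmb H e) 1, finiteRank_le_equivariantOp hT,
    corner_one_mem_equivariantOp e,
    hilbertSchmidtFamily_of_finite (Finset.univ.map e) fun j hj => ?_,
    hilbertSchmidtFamily_of_finite (Finset.univ.map e) h0, h.symm⟩
  rw [← h, mul_apply_eq_comp, h0 j hj, map_zero]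

theorem finiteRank_le_traceClass : finiteRank J H ≤ traceClass J H := by
  intro T hT
  obtain ⟨s, t, hs, ht, hss, hts, rfl⟩ := exists_hilbertSchmidt_factorization hT
  exact mul_mem_traceClass_of_hilbertSchmidt hs ht hss hts

theorem mem_traceClass_of_finite [Finite J] {T : LTwoOp (J × H)} (hT : T ∈ equivariantOp J H) :
    T ∈ traceClass J H := by
  have := Fintype.ofFinite J
  rw [← mul_one T]
  exact mul_mem_traceClass_of_hilbertSchmidt hT (one_mem _)
    (hilbertSchmidtFamily_of_finite Finset.univ fun j hj => absurd (Finset.mem_univ j) hj)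
    (hilbertSchmidtFamily_of_finite Finset.univ fun j hj => absurd (Finset.mem_univ j) hj)

/-! ### Left multipliers of the finite rank operators -/

/-- The operators `U` such that `U T` has finite rank for all `T` of finite rank. -/
noncomputable def leftMultiplier (J H : Type*) [Group H] : Subalgebra ℂ (LTwoOp (J × H)) where
  carrier := {U | ∀ T ∈ finiteRank J H, U * T ∈ finiteRank J H}
  mul_mem' {U V} hU hV T hT := by rw [mul_assoc]; exact hU _ (hV T hT)
  add_mem' {U V} hU hV T hT := by rw [add_mul]; exact add_mem (hU T hT) (hV T hT)
  algebraMap_mem' c T hT := by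
    rw [← Algebra.smul_def]
    exact Submodule.smul_mem _ c hT

theorem mem_leftMultiplier_of_monomial {U : LTwoOp (J × H)}
    (hU : ∀ j, (∀ h, U (LTwo.delta (j, h)) = 0) ∨
      ∃ i k, ∀ h, U (LTwo.delta (j, h)) = LTwo.delta (i, k * h)) :
    U ∈ leftMultiplier J H := by
  intro T hT
  induction hT using Submodule.span_induction with
  | mem T hT =>
    obtain ⟨j, j', c, hc, rfl⟩ := hT
    rcases hU j with h0 | ⟨i, k, hk⟩
    · have h1 : U.comp (extendZero (slice H j)) = 0 :=
        LTwo.clm_ext fun h => by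
          rw [ContinuousLinearMap.comp_apply, extendZero_delta]
          exact h0 h
      have h2 : U * unitOp j j' c = 0 := by
        ext1 f
        exact DFunLike.congr_fun h1 (c (restrict (slice H j') f))
      rw [h2]
      exact zero_mem _
    · have h1 : U.comp (extendZero (slice H j)) = (extendZero (slice H i)).comp (leftReg k) :=
        LTwo.clm_ext fun h => by
          rw [ContinuousLinearMap.comp_apply, ContinuousLinearMap.comp_apply, extendZero_delta,
            leftReg_delta, extendZero_delta]
          exact hk h
      have h2 : U * unitOp j j' c = unitOp i j' (leftReg k * c) := by
        ext1 f
        exact DFunLike.congr_fun h1 (c (restrict (slice H j') f))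
      rw [h2]
      exact unitOp_mem_finiteRank _ _ (mul_mem (leftReg_mem k) hc)
  | zero => rw [mul_zero]; exact zero_mem _
  | add S T _ _ hS hT => rw [mul_add]; exact add_mem hS hT
  | smul c T _ hT => rw [mul_smul_comm]; exact Submodule.smul_mem _ _ hT

theorem mul_mem_finiteRank_of_star {U T : LTwoOp (J × H)} (hU : star U ∈ leftMultiplier J H)
    (hT : T ∈ finiteRank J H) : T * U ∈ finiteRank J H := by
  simpa only [star_mul, star_star] using star_mem_finiteRank (hU _ (star_mem_finiteRank hT))

/-- A left multiplier that vanishes outside of finitely many columns has finite rank. -/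
theorem mem_finiteRank_of_leftMultiplier {U : LTwoOp (J × H)} (hU : U ∈ leftMultiplier J H)
    (F : Finset J) (hF : ∀ j ∉ F, ∀ h, U (LTwo.delta (j, h)) = 0) : U ∈ finiteRank J H := by
  classical
  have h : U = ∑ j ∈ F, U * unitOp j j (1 : LTwoOp H) := by
    refine LTwo.clm_ext fun p => ?_
    obtain ⟨j, h⟩ := p
    have h1 : ∀ k, (U * unitOp k k (1 : LTwoOp H)) (LTwo.delta (j, h))
        = if j = k then U (LTwo.delta (j, h)) else 0 := by
      intro k
      rw [mul_apply_eq_comp, unitOp_apply]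
      split_ifs with hk
      · subst hk
        exact congrArg U ((congrArg _ (restrict_delta (slice H j) h)).trans (extendZero_delta _ _))
      · rw [restrict_delta_of_notMem, map_zero, map_zero, map_zero]
        rintro ⟨y, hy⟩
        exact hk (Prod.ext_iff.1 hy).1.symm
    rw [sum_apply]
    simp only [h1, Finset.sum_ite_eq]
    split_ifs with hj
    · rfl
    · exact hF j hj h
  rw [h]
  exact sum_mem fun j _ => hU _ (unitOp_mem_finiteRank j j (one_mem _))

end FiniteRank

/-! ### Matrices over the reduced group `C*`-algebra as operators on `ℓ²(J × G)` -/

section MatrixAlgebra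

variable {J G : Type*} [Group G]

/-- The operators on `ℓ²(J × G)`, for a finite set `J`, all of whose blocks lie in `C*_r G`: the
matrix algebra `M_J(C*_r G)`. -/
noncomputable def blockAlgebra (J G : Type*) [Group G] [Fintype J] :
    StarSubalgebra ℂ (LTwoOp (J × G)) where
  carrier := {T | ∀ i j, block i j T ∈ ReducedCStar G}
  mul_mem' {S T} hS hT i j := by
    rw [block_mul]
    exact sum_mem fun k _ => mul_mem (hS i k) (hT k j)
  add_mem' {S T} hS hT i j := by
    rw [block_add]
    exact add_mem (hS i j) (hT i j)
  algebraMap_mem' c i j := by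
    classical
    rw [Algebra.algebraMap_eq_smul_one, block_smul, block_one]
    split_ifs
    · exact SMulMemClass.smul_mem c (one_mem _)
    · rw [smul_zero]; exact zero_mem _
  star_mem' {T} hT i j := by
    rw [block_star]
    exact star_mem (hT j i)

theorem isClosed_blockAlgebra [Fintype J] :
    IsClosed (blockAlgebra J G : Set (LTwoOp (J × G))) := by
  have h : (blockAlgebra J G : Set (LTwoOp (J × G)))
      = ⋂ i, ⋂ j, block i j ⁻¹' (ReducedCStar G : Set (LTwoOp G)) := by
    ext T
    simp only [Set.mem_iInter]
    exact Iff.rfl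
  rw [h]
  exact isClosed_iInter fun i => isClosed_iInter fun j =>
    isClosed_reducedCStar.preimage (continuous_block i j)

theorem mem_finiteRank_of_blockAlgebra [Fintype J] {T : LTwoOp (J × G)}
    (hT : T ∈ blockAlgebra J G) : T ∈ finiteRank J G := by
  rw [eq_sum_unitOp_block T]
  exact sum_mem fun i _ => sum_mem fun j _ => unitOp_mem_finiteRank i j (hT i j)

theorem corner_mem_finiteRank {I : Type*} [Fintype I] (e : I ↪ J) {T : LTwoOp (I × G)}
    (hT : T ∈ blockAlgebra I G) : corner (indexEmb G e) T ∈ finiteRank J G := by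
  rw [eq_sum_unitOp_block T]
  simp only [map_sum, corner_unitOp]
  exact sum_mem fun i _ => sum_mem fun j _ => unitOp_mem_finiteRank _ _ (hT i j)

theorem cstarTrace_eq_entry (c : ReducedCStar G) : cstarTrace G c = entry (c : LTwoOp G) 1 1 :=
  (entry_eq_inner _ _ _).symm

theorem hTrace_eq_sum [Fintype J] (T : LTwoOp (J × G)) :
    hTrace T = ∑ j, entry (block j j T) 1 1 := by
  simp only [hTrace, tsum_fintype, entry_block]

theorem hTrace_corner {I : Type*} [Fintype I] (e : I ↪ J) (T : LTwoOp (I × G)) :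
    hTrace (corner (indexEmb G e) T) = hTrace T := by
  have h : ∀ j ∉ Set.range e, entry (corner (indexEmb G e) T) (j, 1) (j, 1) = 0 := by
    intro j hj
    exact extendZero_apply_of_notMem (indexEmb G e) _ (by rwa [mem_range_indexEmb])
  rw [hTrace, hTrace, ← e.injective.tsum_eq fun j hj => by_contra fun hj' => hj (h j hj')]
  refine tsum_congr fun i => ?_
  rw [entry, corner_apply]
  exact (extendZero_apply (indexEmb G e) _ (i, 1)).trans
    (congrArg (fun f => T f (i, 1)) (restrict_delta (indexEmb G e) (i, 1)))

/-- The operator on `ℓ²(J × G)` given by a matrix over `C*_r G`. -/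
noncomputable def matrixOp [Fintype J] (m : Matrix J J (ReducedCStar G)) : LTwoOp (J × G) :=
  ∑ i, ∑ j, unitOp i j (m i j : LTwoOp G)

theorem block_matrixOp [Fintype J] (m : Matrix J J (ReducedCStar G)) (i j : J) :
    block i j (matrixOp m) = m i j := by
  classical
  have hsum : ∀ (F : J → LTwoOp (J × G)), block i j (∑ k, F k) = ∑ k, block i j (F k) := fun F =>
    map_sum (⟨⟨block i j, block_zero i j⟩, block_add i j⟩ : LTwoOp (J × G) →+ LTwoOp G) F _
  simp only [matrixOp, hsum, block_unitOp, ite_and]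
  rw [Finset.sum_comm]
  simp

theorem matrixOp_mem [Fintype J] (m : Matrix J J (ReducedCStar G)) :
    matrixOp m ∈ blockAlgebra J G := fun i j => by
  rw [block_matrixOp]
  exact (m i j).2

theorem coe_matrix_mul [Fintype J] (m m' : Matrix J J (ReducedCStar G)) (i j : J) :
    ((m * m') i j : LTwoOp G) = ∑ k, (m i k : LTwoOp G) * (m' k j : LTwoOp G) := by
  simp only [Matrix.mul_apply, AddSubmonoidClass.coe_finsetSum, MulMemClass.coe_mul]

theorem isStarProjection_matrixOp [Fintype J] {m : Matrix J J (ReducedCStar G)}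
    (hm : IsStarProjection m) : IsStarProjection (matrixOp m) := by
  have h1 : m * m = m := hm.isIdempotentElem
  have h2 : star m = m := hm.isSelfAdjoint
  refine ⟨block_ext fun i j => ?_, block_ext fun i j => ?_⟩
  · rw [block_mul, block_matrixOp]
    have := congrArg (fun x : ReducedCStar G => (x : LTwoOp G)) (congrFun (congrFun h1 i) j)
    simpa only [block_matrixOp, coe_matrix_mul] using this
  · rw [block_star, block_matrixOp, block_matrixOp]
    exact congrArg (fun x : ReducedCStar G => (x : LTwoOp G)) (congrFun (congrFun h2 i) j)

theorem exists_matrixOp_eq [Fintype J] {T : LTwoOp (J × G)} (hT : T ∈ blockAlgebra J G)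
    (hp : IsStarProjection T) :
    ∃ m : Matrix J J (ReducedCStar G), IsStarProjection m ∧ matrixOp m = T := by
  refine ⟨fun i j => ⟨block i j T, hT i j⟩, ⟨?_, ?_⟩, block_ext fun i j => block_matrixOp _ i j⟩
  · refine Matrix.ext fun i j => Subtype.ext ?_
    have h := congrArg (block i j) hp.isIdempotentElem.eq
    rw [block_mul] at h
    exact (coe_matrix_mul _ _ i j).trans h
  · refine Matrix.ext fun i j => Subtype.ext ?_
    have h := congrArg (block i j) hp.isSelfAdjoint.star_eq
    rwa [block_star] at h

theorem matTrace_eq_hTrace [Fintype J] (m : Matrix J J (ReducedCStar G)) :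
    matTrace (cstarTrace G) m = hTrace (matrixOp m) := by
  simp only [hTrace_eq_sum, block_matrixOp, matTrace, cstarTrace_eq_entry]

/-- The trace of a projection in `M_n(C*_r G)` is a value of `tr_G` on `K₀`. -/
theorem exists_trKZero_eq {n : ℕ} {T : LTwoOp (Fin n × G)} (hT : T ∈ blockAlgebra (Fin n) G)
    (hp : IsStarProjection T) : ∃ x : KZero (ReducedCStar G), (trKZero G x : ℂ) = hTrace T := by
  obtain ⟨m, hm, rfl⟩ := exists_matrixOp_eq hT hp
  refine ⟨Algebra.GrothendieckAddGroup.of (M := MvNClass (ReducedCStar G))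
    (Quotient.mk _ ⟨n, m, hm⟩), ?_⟩
  rw [trKZero_ofReal, ← matTrace_eq_hTrace, KZero.traceHom]
  have h := DFunLike.congr_fun ((Algebra.GrothendieckAddGroup.lift
    (M := MvNClass (ReducedCStar G))).symm_apply_apply
      (MvNClass.traceHom (cstarTrace G) cstarTrace_mul_comm)) (Quotient.mk _ ⟨n, m, hm⟩)
  exact h

/-- Every value of `tr_G` on `K₀` is a difference of traces of projections in `M_n(C*_r G)`. -/
theorem trKZero_eq_sub (x : KZero (ReducedCStar G)) :
    ∃ (n m : ℕ) (S : LTwoOp (Fin n × G)) (T : LTwoOp (Fin m × G)),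
      S ∈ blockAlgebra (Fin n) G ∧ T ∈ blockAlgebra (Fin m) G ∧ IsStarProjection S ∧
      IsStarProjection T ∧ (trKZero G x : ℂ) = hTrace S - hTrace T := by
  rw [trKZero_ofReal, KZero.traceHom, Algebra.GrothendieckAddGroup.lift_apply]
  generalize (AddLocalization.addMonoidOf _).sec x = y
  obtain ⟨P, Q, -⟩ := y
  induction P using Quotient.inductionOn with | _ P =>
  induction Q using Quotient.inductionOn with | _ Q =>
  refine ⟨P.n, Q.n, matrixOp P.p, matrixOp Q.p, matrixOp_mem _, matrixOp_mem _,
    isStarProjection_matrixOp P.isProj, isStarProjection_matrixOp Q.isProj, ?_⟩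
  rw [← matTrace_eq_hTrace, ← matTrace_eq_hTrace]
  rfl

/-! ### Density of the group ring -/

/-- The matrices over the group ring `ℂG`, as operators on `ℓ²(J × G)`. -/
noncomputable def groupRingOp (J G : Type*) [Group G] : Submodule ℂ (LTwoOp (J × G)) :=
  Submodule.span ℂ {T | ∃ (i j : J) (g : G), T = unitOp i j (leftReg g)}

theorem leftReg_mul (g h : G) : leftReg (g * h) = leftReg g * leftReg h :=
  LTwo.clm_ext fun x => by
    rw [mul_apply_eq_comp, leftReg_delta, leftReg_delta, leftReg_delta, mul_assoc]

theorem leftReg_one : leftReg (1 : G) = 1 :=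
  LTwo.clm_ext fun x => by
    rw [leftReg_delta, one_mul]
    rfl

theorem mem_span_leftReg {c : LTwoOp G}
    (hc : c ∈ StarAlgebra.adjoin ℂ (Set.range (leftReg (G := G)))) :
    c ∈ Submodule.span ℂ (Set.range (leftReg (G := G))) := by
  have h1 : c ∈ Subalgebra.toSubmodule
    (StarAlgebra.adjoin ℂ (Set.range (leftReg (G := G)))).toSubalgebra := hc
  rw [StarAlgebra.adjoin_eq_span] at h1
  refine Submodule.span_mono ?_ h1
  let M : Submonoid (LTwoOp G) := MonoidHom.mrange
    (⟨⟨leftReg, leftReg_one⟩, leftReg_mul⟩ : G →* LTwoOp G)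
  have hM : Submonoid.closure (Set.range (leftReg (G := G)) ∪ star (Set.range leftReg)) ≤ M := by
    rw [Submonoid.closure_le]
    rintro T (⟨g, rfl⟩ | hT)
    · exact ⟨g, rfl⟩
    · obtain ⟨g, hg⟩ := hT
      refine ⟨g⁻¹, ?_⟩
      change leftReg g⁻¹ = T
      rw [← star_leftReg, hg, star_star]
  exact hM

theorem mem_closure_groupRingOp [Fintype J] {T : LTwoOp (J × G)} (hT : T ∈ blockAlgebra J G) :
    T ∈ closure (groupRingOp J G : Set (LTwoOp (J × G))) := by
  have key : ∀ i j, ∀ c ∈ ReducedCStar G, unitOp i j c ∈ (groupRingOp J G).topologicalClosure := by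
    intro i j c hc
    have h1 : c ∈ closure (StarAlgebra.adjoin ℂ (Set.range (leftReg (G := G))) :
      Set (LTwoOp G)) := hc
    refine map_mem_closure (unitOpCLM i j).continuous h1 fun d hd => ?_
    have h2 : Submodule.span ℂ (Set.range (leftReg (G := G)))
        ≤ (groupRingOp J G).comap (unitOpCLM i j).toLinearMap := by
      rw [Submodule.span_le]
      rintro _ ⟨g, rfl⟩
      exact Submodule.subset_span ⟨i, j, g, rfl⟩
    exact h2 (mem_span_leftReg hd)
  change T ∈ (groupRingOp J G).topologicalClosure
  rw [eq_sum_unitOp_block T]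
  exact sum_mem fun i _ => sum_mem fun j _ => key i j _ (hT i j)

theorem groupRingOp_le_blockAlgebra [Fintype J] {T : LTwoOp (J × G)} (hT : T ∈ groupRingOp J G) :
    T ∈ blockAlgebra J G := by
  classical
  induction hT using Submodule.span_induction with
  | mem T hT =>
    obtain ⟨i, j, g, rfl⟩ := hT
    intro i' j'
    rw [block_unitOp]
    split_ifs
    · exact leftReg_mem g
    · exact zero_mem _
  | zero => exact zero_mem _
  | add S T _ _ hS hT => exact add_mem hS hT
  | smul c T _ hT => exact SMulMemClass.smul_mem c hT

theorem star_mem_groupRingOp {T : LTwoOp (J × G)} (hT : T ∈ groupRingOp J G) :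
    star T ∈ groupRingOp J G := by
  induction hT using Submodule.span_induction with
  | mem T hT =>
    obtain ⟨i, j, g, rfl⟩ := hT
    rw [star_unitOp, star_leftReg]
    exact Submodule.subset_span ⟨j, i, g⁻¹, rfl⟩
  | zero => rw [star_zero]; exact zero_mem _
  | add S T _ _ hS hT => rw [star_add]; exact add_mem hS hT
  | smul c T _ hT => rw [star_smul]; exact Submodule.smul_mem _ _ hT

theorem exists_groupRingOp_near [Fintype J] {T : LTwoOp (J × G)} (hT : T ∈ blockAlgebra J G)
    (hsa : IsSelfAdjoint T) {ε : ℝ} (hε : 0 < ε) :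
    ∃ a ∈ groupRingOp J G, IsSelfAdjoint a ∧ ‖a - T‖ < ε := by
  obtain ⟨b, hb, hbT⟩ := Metric.mem_closure_iff.1 (mem_closure_groupRingOp hT) ε hε
  rw [dist_comm, dist_eq_norm] at hbT
  refine ⟨(1 / 2 : ℂ) • (b + star b),
    Submodule.smul_mem _ _ (add_mem hb (star_mem_groupRingOp hb)), ?_, ?_⟩
  · rw [IsSelfAdjoint, star_smul, star_add, star_star, add_comm (star b)]
    simp
  · have h1 : (1 / 2 : ℂ) • (b + star b) - T = (1 / 2 : ℂ) • ((b - T) + star (b - T)) := by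
      rw [star_sub, hsa.star_eq, show b - T + (star b - T) = (b + star b) - (2 : ℂ) • T by
        rw [two_smul]; abel, smul_sub, smul_smul]
      norm_num
    have h2 : ‖star (b - T)‖ = ‖b - T‖ := norm_star (b - T)
    have h3 := norm_add_le (b - T) (star (b - T))
    rw [h1, norm_smul, show ‖(1 / 2 : ℂ)‖ = 1 / 2 by norm_num]
    linarith

end MatrixAlgebra

/-! ### Compressions -/

section Compression

variable {α β : Type*}

/-- The compression of an operator on `ℓ²(β)` to the image of `ℓ²(α)`. -/
noncomputable def compress (e : α ↪ β) (T : LTwoOp β) : LTwoOp α :=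
  (restrict e).comp (T.comp (extendZero e))

theorem compress_sub (e : α ↪ β) (S T : LTwoOp β) :
    compress e (S - T) = compress e S - compress e T := by
  ext1 f
  exact map_sub (restrict e) _ _

theorem norm_compress_le (e : α ↪ β) (T : LTwoOp β) : ‖compress e T‖ ≤ ‖T‖ := by
  have h1 := (restrict e).opNorm_comp_le (T.comp (extendZero e))
  have h2 := T.opNorm_comp_le (extendZero e)
  have h3 := norm_restrict_le e
  have h4 := norm_extendZero_le e
  calc ‖compress e T‖ ≤ ‖restrict e‖ * ‖T.comp (extendZero e)‖ := h1
    _ ≤ 1 * (‖T‖ * 1) := by gcongr; exact h2.trans (by gcongr)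
    _ = ‖T‖ := by ring

theorem star_compress (e : α ↪ β) (T : LTwoOp β) : star (compress e T) = compress e (star T) := by
  simp only [compress, ContinuousLinearMap.star_eq_adjoint, ContinuousLinearMap.adjoint_comp,
    adjoint_extendZero, adjoint_restrict, ContinuousLinearMap.comp_assoc]

theorem corner_compress (e : α ↪ β) (T : LTwoOp β) :
    corner e (compress e T) = corner e 1 * T * corner e 1 := rfl

theorem compress_mul_compress (e : α ↪ β) {S T : LTwoOp β} (hT : Commute (corner e 1) T) :
    compress e S * compress e T = compress e (S * T) := by
  ext1 f
  have h := DFunLike.congr_fun hT.eq (extendZero e f)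
  change corner e 1 (T (extendZero e f)) = T (extendZero e (restrict e (extendZero e f))) at h
  rw [restrict_extendZero] at h
  exact congrArg (fun y => restrict e (S y)) h

theorem block_compress {J I H : Type*} (e : I ↪ J) (T : LTwoOp (J × H)) (i j : I) :
    block i j (compress (indexEmb H e) T) = block (e i) (e j) T := by
  ext1 f
  have h := DFunLike.congr_fun (extendZero_trans (slice H j) (indexEmb H e)) f
  exact congrArg (fun y => restrict (slice H (e i)) (T y)) h

theorem isStarProjection_compress (e : α ↪ β) {T : LTwoOp β} (hT : IsStarProjection T)
    (hc : Commute (corner e 1) T) : IsStarProjection (compress e T) := by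
  refine ⟨?_, ?_⟩
  · rw [IsIdempotentElem, compress_mul_compress e hc, hT.isIdempotentElem.eq]
  · rw [IsSelfAdjoint, star_compress, hT.isSelfAdjoint.star_eq]

end Compression

/-! ### The doubled index set -/

section Doubling

variable {J H : Type*}

/-- The projection onto the first half of `ℓ²((J ⊕ J) × H)`. -/
noncomputable def leftProj (J H : Type*) : LTwoOp ((J ⊕ J) × H) :=
  corner (indexEmb H Function.Embedding.inl) 1

/-- The symmetry exchanging the two halves of `ℓ²((J ⊕ J) × H)`. -/
noncomputable def swapOp (J H : Type*) : LTwoOp ((J ⊕ J) × H) :=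
  (LTwo.congr
    ((Equiv.sumComm J J).prodCongr (Equiv.refl H))).toContinuousLinearEquiv.toContinuousLinearMap

theorem swapOp_delta (j : J ⊕ J) (h : H) :
    swapOp J H (LTwo.delta (j, h)) = LTwo.delta (j.swap, h) := LTwo.congr_delta _ _

theorem leftProj_delta_inl (j : J) (h : H) :
    leftProj J H (LTwo.delta (Sum.inl j, h)) = LTwo.delta (Sum.inl j, h) := by
  classical
  rw [leftProj, corner_one_delta, mem_range_indexEmb, if_pos ⟨j, rfl⟩]

theorem leftProj_delta_inr (j : J) (h : H) :
    leftProj J H (LTwo.delta (Sum.inr j, h)) = 0 := by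
  classical
  rw [leftProj, corner_one_delta, mem_range_indexEmb, if_neg]
  rintro ⟨i, hi⟩
  exact Sum.inl_ne_inr hi

theorem isStarProjection_leftProj : IsStarProjection (leftProj J H) :=
  isStarProjection_corner ⟨mul_one _, star_one _⟩

theorem swapOp_mul_self : swapOp J H * swapOp J H = 1 := by
  refine LTwo.clm_ext fun p => ?_
  obtain ⟨j, h⟩ := p
  rw [mul_apply_eq_comp, swapOp_delta, swapOp_delta, Sum.swap_swap]
  rfl

theorem star_swapOp : star (swapOp J H) = swapOp J H := by
  classical
  refine entry_ext fun p q => ?_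
  obtain ⟨i, h⟩ := p
  obtain ⟨j, h'⟩ := q
  rw [entry_star, entry, entry, swapOp_delta, swapOp_delta, LTwo.delta_apply, LTwo.delta_apply]
  rcases i with i | i <;> rcases j with j | j <;>
    simp [Prod.ext_iff, eq_comm, apply_ite]

theorem swapOp_conj_leftProj : swapOp J H * leftProj J H * swapOp J H = 1 - leftProj J H := by
  refine LTwo.clm_ext fun p => ?_
  obtain ⟨j | j, h⟩ := p
  · rw [mul_apply_eq_comp, mul_apply_eq_comp, swapOp_delta]
    change swapOp J H (leftProj J H (LTwo.delta (Sum.inr j, h)))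
      = LTwo.delta (Sum.inl j, h) - leftProj J H (LTwo.delta (Sum.inl j, h))
    rw [leftProj_delta_inr, leftProj_delta_inl, map_zero, sub_self]
  · rw [mul_apply_eq_comp, mul_apply_eq_comp, swapOp_delta]
    change swapOp J H (leftProj J H (LTwo.delta (Sum.inl j, h)))
      = LTwo.delta (Sum.inr j, h) - leftProj J H (LTwo.delta (Sum.inr j, h))
    rw [leftProj_delta_inl, leftProj_delta_inr, swapOp_delta, sub_zero]
    rfl

theorem leftProj_mem_equivariantOp [Group H] : leftProj J H ∈ equivariantOp (J ⊕ J) H :=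
  corner_one_mem_equivariantOp _

theorem swapOp_mem_equivariantOp [Group H] : swapOp J H ∈ equivariantOp (J ⊕ J) H := by
  rw [mem_equivariantOp_iff_commute]
  intro k
  refine LTwo.clm_ext fun p => ?_
  obtain ⟨j, h⟩ := p
  rw [mul_apply_eq_comp, mul_apply_eq_comp, swapOp_delta, shift_delta, shift_delta, swapOp_delta]

theorem leftProj_mem_leftMultiplier [Group H] : leftProj J H ∈ leftMultiplier (J ⊕ J) H := by
  refine mem_leftMultiplier_of_monomial fun j => ?_
  rcases j with j | j
  · exact Or.inr ⟨Sum.inl j, 1, fun h => by rw [one_mul, leftProj_delta_inl]⟩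
  · exact Or.inl fun h => leftProj_delta_inr j h

theorem swapOp_mem_leftMultiplier [Group H] : swapOp J H ∈ leftMultiplier (J ⊕ J) H :=
  mem_leftMultiplier_of_monomial fun j =>
    Or.inr ⟨j.swap, 1, fun h => by rw [one_mul, swapOp_delta]⟩

theorem block_leftProj_mem [Group H] (i j : J ⊕ J) : block i j (leftProj J H) ∈ ReducedCStar H := by
  classical
  rcases j with j | j
  · have h : block i (Sum.inl j) (leftProj J H) = block i (Sum.inl j) 1 :=
      LTwo.clm_ext fun h => by
        rw [block_apply, block_apply, extendZero_delta]
        exact congrArg _ (leftProj_delta_inl j h)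
    rw [h, block_one]
    split_ifs
    · exact one_mem _
    · exact zero_mem _
  · have h : block i (Sum.inr j) (leftProj J H) = 0 :=
      LTwo.clm_ext fun h => by
        rw [block_apply, extendZero_delta]
        exact (congrArg _ (leftProj_delta_inr j h)).trans (map_zero _)
    rw [h]
    exact zero_mem _

theorem norm_le_one_of_symmetry {α : Type*} {w : LTwoOp α} (h1 : star w = w) (h2 : w * w = 1) :
    ‖w‖ ≤ 1 := by
  have h := CStarRing.norm_star_mul_self (x := w)
  rw [h1, h2] at h
  have h3 := norm_one_LTwoOp_le α
  nlinarith [norm_nonneg w]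

theorem norm_mul_self_sub_self_le {α : Type*} {p x : LTwoOp α} (hp : IsStarProjection p)
    {ε : ℝ} (hx : ‖x - p‖ ≤ ε) (hε : ε ≤ 1) : ‖x * x - x‖ ≤ 4 * ε := by
  have hε0 : 0 ≤ ε := (norm_nonneg _).trans hx
  have hp1 : p * p = p := hp.isIdempotentElem
  have h : x * x - x = (x - p) * x + p * (x - p) - (x - p) := by
    have : (x - p) * x + p * (x - p) - (x - p) = x * x - x + (p - p * p) := by noncomm_ring
    rw [this, hp1, sub_self, add_zero]
  have hxn : ‖x‖ ≤ 2 := by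
    have := norm_add_le (x - p) p
    rw [sub_add_cancel] at this
    linarith [hp.norm_LTwoOp_le]
  have h1 : ‖(x - p) * x‖ ≤ ε * 2 :=
    (norm_mul_le _ _).trans (mul_le_mul hx hxn (norm_nonneg _) hε0)
  have h2 : ‖p * (x - p)‖ ≤ 1 * ε :=
    (norm_mul_le _ _).trans (mul_le_mul hp.norm_LTwoOp_le hx (norm_nonneg _) zero_le_one)
  rw [h]
  linarith [norm_sub_le ((x - p) * x + p * (x - p)) (x - p),
    norm_add_le ((x - p) * x) (p * (x - p))]

/-- The symmetry attached to a projection `x` below `leftProj` (and its perturbations), as in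
`isStarProjection_add_conj`. -/
noncomputable def doubleSymm (x : LTwoOp ((J ⊕ J) × H)) : LTwoOp ((J ⊕ J) × H) :=
  x + swapOp J H * x * swapOp J H
    + swapOp J H * (1 - (x + swapOp J H * x * swapOp J H))

theorem star_doubleSymm {x : LTwoOp ((J ⊕ J) × H)} (hx : star x = x) :
    star (doubleSymm x) = doubleSymm x := by
  have h : swapOp J H * (x + swapOp J H * x * swapOp J H)
      = (x + swapOp J H * x * swapOp J H) * swapOp J H := by
    rw [mul_add, add_mul, mul_assoc _ (swapOp J H) (swapOp J H), swapOp_mul_self, mul_one,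
      ← mul_assoc, ← mul_assoc, swapOp_mul_self, one_mul, add_comm]
  have h1 : star (x + swapOp J H * x * swapOp J H) = x + swapOp J H * x * swapOp J H := by
    rw [star_add, star_mul, star_mul, hx, star_swapOp, mul_assoc]
  rw [doubleSymm, star_add, h1, star_mul, star_sub, star_one, h1, star_swapOp, mul_sub, sub_mul, h,
    one_mul, mul_one]

theorem norm_swapOp_le : ‖swapOp J H‖ ≤ 1 :=
  norm_le_one_of_symmetry star_swapOp swapOp_mul_self

theorem norm_doubleSymm_sub_le (x y : LTwoOp ((J ⊕ J) × H)) :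
    ‖doubleSymm x - doubleSymm y‖ ≤ 4 * ‖x - y‖ := by
  have h : doubleSymm x - doubleSymm y = (x - y) + swapOp J H * (x - y) * swapOp J H
      - swapOp J H * ((x - y) + swapOp J H * (x - y) * swapOp J H) := by
    rw [doubleSymm, doubleSymm]
    noncomm_ring
  have hσ := norm_swapOp_le (J := J) (H := H)
  have h1 : ∀ z : LTwoOp ((J ⊕ J) × H), ‖swapOp J H * z‖ ≤ ‖z‖ := fun z =>
    (norm_mul_le _ _).trans (mul_le_of_le_one_left (norm_nonneg _) hσ)
  have h2 : ∀ z : LTwoOp ((J ⊕ J) × H), ‖z * swapOp J H‖ ≤ ‖z‖ := fun z =>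
    (norm_mul_le _ _).trans (mul_le_of_le_one_right (norm_nonneg _) hσ)
  have h3 : ‖(x - y) + swapOp J H * (x - y) * swapOp J H‖ ≤ 2 * ‖x - y‖ := by
    linarith [norm_add_le (x - y) (swapOp J H * (x - y) * swapOp J H),
      h2 (swapOp J H * (x - y)), h1 (x - y)]
  rw [h]
  linarith [norm_sub_le ((x - y) + swapOp J H * (x - y) * swapOp J H)
    (swapOp J H * ((x - y) + swapOp J H * (x - y) * swapOp J H)),
    h1 ((x - y) + swapOp J H * (x - y) * swapOp J H)]

theorem doubleSymm_mem {S : Subalgebra ℂ (LTwoOp ((J ⊕ J) × H))} (hσ : swapOp J H ∈ S)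
    {x : LTwoOp ((J ⊕ J) × H)} (hx : x ∈ S) : doubleSymm x ∈ S := by
  have h := add_mem hx (mul_mem (mul_mem hσ hx) hσ)
  exact add_mem h (mul_mem hσ (sub_mem (one_mem _) h))

end Doubling

/-! ### The `K₀`-class of a finite rank perturbation -/

section IndexClass

theorem IsStarProjection.add_one_sub_mul {A : Type*} [Ring A] [StarRing A] {c r e : A}
    (hc : IsStarProjection c) (hr : IsStarProjection r) (he : IsStarProjection e)
    (hcr : c * r = c) (hre : r * e = e * r) : IsStarProjection (c + (1 - r) * e) := by
  have hc1 : c * c = c := hc.isIdempotentElem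
  have hr1 : r * r = r := hr.isIdempotentElem
  have he1 : e * e = e := he.isIdempotentElem
  have hrc : r * c = c := by
    simpa [hc.isSelfAdjoint.star_eq, hr.isSelfAdjoint.star_eq] using congrArg star hcr
  have hcomm : (1 - r) * e = e * (1 - r) := by rw [sub_mul, mul_sub, hre, one_mul, mul_one]
  have h1 : c * ((1 - r) * e) = 0 := by
    rw [← mul_assoc, mul_sub, mul_one, hcr, sub_self, zero_mul]
  have h2 : (1 - r) * e * c = 0 := by
    rw [hcomm, mul_assoc, sub_mul, one_mul, hrc, sub_self, mul_zero]
  have h3 : (1 - r) * e * ((1 - r) * e) = (1 - r) * e := by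
    have h4 : (1 - r) * (1 - r) = 1 - r := by
      rw [mul_sub, mul_one, sub_mul, one_mul, hr1, sub_self, sub_zero]
    calc (1 - r) * e * ((1 - r) * e) = (1 - r) * (e * (1 - r)) * e := by simp only [mul_assoc]
      _ = (1 - r) * (1 - r) * (e * e) := by rw [← hcomm]; simp only [mul_assoc]
      _ = (1 - r) * e := by rw [h4, he1]
  refine ⟨?_, ?_⟩
  · rw [IsIdempotentElem, add_mul, mul_add, mul_add, hc1, h1, h2, h3, zero_add, add_zero]
  · rw [IsSelfAdjoint, star_add, hc.isSelfAdjoint.star_eq, star_mul, star_sub,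
      star_one, hr.isSelfAdjoint.star_eq, he.isSelfAdjoint.star_eq, hcomm]

variable {J H : Type*} [Group H]

theorem norm_conj_sub_conj_le {α : Type*} {w w' d d' : LTwoOp α} {η : ℝ} (hη : η ≤ 1 / 4)
    (hw : ‖w‖ ≤ 1) (hd : ‖d‖ ≤ 2) (hw' : ‖w' - w‖ ≤ 4 * η) (hd' : ‖d' - d‖ ≤ 2 * η) :
    ‖w' * d' * w' - w * d * w‖ ≤ 36 * η := by
  have hη0 : 0 ≤ η := by linarith [norm_nonneg (d' - d)]
  have h : w' * d' * w' - w * d * w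
      = (w' - w) * d' * w' + w * (d' - d) * w' + w * d * (w' - w) := by noncomm_ring
  have h1 : ‖w'‖ ≤ 2 := by
    have := norm_add_le (w' - w) w
    rw [sub_add_cancel] at this
    linarith
  have h2 : ‖d'‖ ≤ 3 := by
    have := norm_add_le (d' - d) d
    rw [sub_add_cancel] at this
    linarith
  have n1 : ‖(w' - w) * d' * w'‖ ≤ 4 * η * 3 * 2 :=
    (norm_mul_le _ _).trans (mul_le_mul ((norm_mul_le _ _).trans
      (mul_le_mul hw' h2 (norm_nonneg _) (by positivity))) h1 (norm_nonneg _) (by positivity))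
  have n2 : ‖w * (d' - d) * w'‖ ≤ 1 * (2 * η) * 2 :=
    (norm_mul_le _ _).trans (mul_le_mul ((norm_mul_le _ _).trans
      (mul_le_mul hw hd' (norm_nonneg _) (by positivity))) h1 (norm_nonneg _) (by positivity))
  have n3 : ‖w * d * (w' - w)‖ ≤ 1 * 2 * (4 * η) :=
    (norm_mul_le _ _).trans (mul_le_mul ((norm_mul_le _ _).trans
      (mul_le_mul hw hd (norm_nonneg _) (by positivity))) hw' (norm_nonneg _) (by positivity))
  rw [h]
  linarith [norm_add_le ((w' - w) * d' * w' + w * (d' - d) * w') (w * d * (w' - w)),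
    norm_add_le ((w' - w) * d' * w') (w * (d' - d) * w')]

/-- A projection close to a self-adjoint finite rank perturbation `e + Z` of `e = leftProj J H` is
close to a projection that agrees with `e` outside of finitely many blocks: compress `e + Z` to
these blocks and correct it there to a projection. -/
theorem exists_block_projection_near {S Z : LTwoOp ((J ⊕ J) × H)} {ζ : ℝ} (hζ : ζ ≤ 1 / 64)
    (hS : IsStarProjection S) (hZ : Z ∈ finiteRank (J ⊕ J) H) (hZsa : star Z = Z)
    (hn : ‖leftProj J H + Z - S‖ ≤ ζ) :
    ∃ (n : ℕ) (f : Fin n ↪ J ⊕ J) (s : LTwoOp (Fin n × H)), s ∈ blockAlgebra (Fin n) H ∧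
      IsStarProjection s ∧
      ‖corner (indexEmb H f) s + (1 - corner (indexEmb H f) 1) * leftProj J H - S‖ < 1 / 4 := by
  have he : IsStarProjection (leftProj J H) := isStarProjection_leftProj
  obtain ⟨n, f, hRZ, hZR⟩ := exists_embedding_support hZ
  have hRe : Commute (corner (indexEmb H f) 1) (leftProj J H) := commute_corner_one _ _
  obtain ⟨E, hE⟩ : ∃ E, E = indexEmb H f := ⟨_, rfl⟩
  obtain ⟨e, hedef⟩ : ∃ e, e = leftProj J H := ⟨_, rfl⟩
  obtain ⟨R, hR⟩ : ∃ R, R = corner E (1 : LTwoOp (Fin n × H)) := ⟨_, rfl⟩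
  rw [← hE, ← hR] at hRZ hZR hRe
  rw [← hedef] at hn he hRe
  have hRe' : R * e = e * R := hRe
  have hR1 : R * R = R := by rw [hR, ← map_mul, one_mul]
  have hcomm : Commute (corner E 1) (e + Z) := by
    rw [← hR]
    change R * (e + Z) = (e + Z) * R
    rw [mul_add, add_mul, hRe', hRZ, hZR]
  obtain ⟨s₀, hs₀⟩ : ∃ s₀, s₀ = compress E (e + Z) := ⟨_, rfl⟩
  have hs₀sa : IsSelfAdjoint s₀ := by
    rw [hs₀, IsSelfAdjoint, star_compress, star_add, hZsa, he.isSelfAdjoint.star_eq]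
  have hs₀n : ‖s₀ * s₀ - s₀‖ ≤ 4 * ζ := by
    rw [hs₀, compress_mul_compress E hcomm, ← compress_sub]
    exact (norm_compress_le _ _).trans (norm_mul_self_sub_self_le hS hn (by linarith))
  have hs₀m : s₀ ∈ blockAlgebra (Fin n) H := by
    intro i j
    rw [hs₀, hE, block_compress, block_add, hedef]
    exact add_mem (block_leftProj_mem _ _) (block_mem_reducedCStar_of_finiteRank hZ _ _)
  obtain ⟨s, hs, hsn, -, hsm⟩ := exists_isStarProjection_near hs₀sa (by linarith) hs₀n
  refine ⟨n, f, s, hsm _ isClosed_blockAlgebra hs₀m, hs, ?_⟩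
  rw [← hE, ← hedef, ← hR]
  have h2 : corner E s₀ = e * R + Z := by
    rw [hs₀, corner_compress, ← hR, mul_add, add_mul, hRZ, hZR, hRe', mul_assoc, hR1]
  have h1 : corner E s + (1 - R) * e - S = corner E (s - s₀) + (e + Z - S) := by
    rw [map_sub, h2, sub_mul, one_mul, hRe']
    abel
  have h3 := (norm_corner_le E (s - s₀)).trans hsn
  rw [h1]
  linarith [norm_add_le (corner E (s - s₀)) (e + Z - S)]

/-- If a projection `S` is close to a self-adjoint finite rank perturbation of `leftProj` and
differs from `leftProj` by a trace class operator, then the trace of the latter is a value of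
`tr_H`. -/
theorem exists_trKZero_eq_of_near {S Z : LTwoOp ((J ⊕ J) × H)} {ζ : ℝ} (hζ : ζ ≤ 1 / 64)
    (hS : IsStarProjection S) (hSN : S ∈ equivariantOp (J ⊕ J) H)
    (hST : S - leftProj J H ∈ traceClass (J ⊕ J) H) (hZ : Z ∈ finiteRank (J ⊕ J) H)
    (hZsa : star Z = Z) (hn : ‖leftProj J H + Z - S‖ ≤ ζ) :
    ∃ x : KZero (ReducedCStar H), (trKZero H x : ℂ) = hTrace (S - leftProj J H) := by
  have he : IsStarProjection (leftProj J H) := isStarProjection_leftProj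
  obtain ⟨n, f, s, hsB, hs, hnear⟩ := exists_block_projection_near hζ hS hZ hZsa hn
  have hRp : IsStarProjection (corner (indexEmb H f) 1) :=
    isStarProjection_corner ⟨mul_one _, star_one _⟩
  have hRe : Commute (corner (indexEmb H f) 1) (leftProj J H) := commute_corner_one _ _
  have hsR : corner (indexEmb H f) s * corner (indexEmb H f) 1 = corner (indexEmb H f) s := by
    rw [← map_mul, mul_one]
  have hRfin : corner (indexEmb H f) 1 ∈ finiteRank (J ⊕ J) H :=
    corner_mem_finiteRank f (one_mem _)
  have heR := leftProj_mem_leftMultiplier _ hRfin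
  have hsfin : corner (indexEmb H f) s ∈ finiteRank (J ⊕ J) H := corner_mem_finiteRank f hsB
  have hceR : corner (indexEmb H f) (compress (indexEmb H f) (leftProj J H))
      = leftProj J H * corner (indexEmb H f) 1 := by
    rw [corner_compress, hRe.eq, mul_assoc, hRp.isIdempotentElem.eq]
  obtain ⟨x, hx⟩ := exists_trKZero_eq hsB hs
  obtain ⟨y, hy⟩ := exists_trKZero_eq (T := compress (indexEmb H f) (leftProj J H))
    (fun i j => by rw [block_compress]; exact block_leftProj_mem _ _)
    (isStarProjection_compress _ he hRe)
  rw [← hTrace_corner f] at hx hy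
  rw [hceR] at hy
  have hS'p := (isStarProjection_corner hs).add_one_sub_mul hRp he hsR hRe
  have hS'N := add_mem (finiteRank_le_equivariantOp hsfin) (mul_mem
    (sub_mem (one_mem _) (finiteRank_le_equivariantOp hRfin)) leftProj_mem_equivariantOp)
  generalize corner (indexEmb H f) 1 = R at *
  generalize corner (indexEmb H f) s = c at *
  have hdiff : c + (1 - R) * leftProj J H - S
      = c - leftProj J H * R - (S - leftProj J H) := by
    rw [sub_mul, one_mul, hRe.eq]
    abel
  have hT1 := finiteRank_le_traceClass (sub_mem hsfin heR)
  have hzero := hTrace_sub_eq_zero hS hS'p hSN hS'N (hdiff ▸ sub_mem hT1 hST) hnear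
  rw [hdiff, hTrace_sub hT1 hST, hTrace_sub (finiteRank_le_traceClass hsfin)
    (finiteRank_le_traceClass heR), sub_eq_zero] at hzero
  exact ⟨x - y, by rw [map_sub, Complex.ofReal_sub, hx, hy, hzero]⟩

/-- Let `p`, `q` be equivariant projections near self-adjoint operators `a`, `b` whose difference
has finite rank. Then `p - q` is trace class, and its trace is a value of `tr_H` on `K₀(C*_r H)`.
The conjugation by `doubleSymm` enlarges the distance by the factor `36`, and
`36 / 2304 = 1 / 64` is what `exists_trKZero_eq_of_near` admits. -/
theorem exists_trKZero_eq_hTrace_sub {a b p q : LTwoOp ((J ⊕ J) × H)}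
    (haN : a ∈ equivariantOp (J ⊕ J) H) (hbN : b ∈ equivariantOp (J ⊕ J) H)
    (hpN : p ∈ equivariantOp (J ⊕ J) H) (hqN : q ∈ equivariantOp (J ⊕ J) H)
    (ha : star a = a) (hb : star b = b) (hp : IsStarProjection p) (hq : IsStarProjection q)
    (hpe : p * leftProj J H = p) (hqe : q * leftProj J H = q) (hap : a * p = p * a)
    (hbq : b * q = q * b) (han : ‖a - p‖ ≤ 1 / 2304) (hbn : ‖b - q‖ ≤ 1 / 2304)
    (hab : a - b ∈ finiteRank (J ⊕ J) H) (hbM : b ∈ leftMultiplier (J ⊕ J) H) :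
    p - q ∈ traceClass (J ⊕ J) H ∧
      ∃ x : KZero (ReducedCStar H), (trKZero H x : ℂ) = hTrace (p - q) := by
  have hnp : ∀ x y : LTwoOp ((J ⊕ J) × H), IsStarProjection y → ‖x - y‖ ≤ 1 / 2304 →
      ‖y - x * y‖ ≤ 1 / 4 ∧ ‖x - x * y‖ ≤ 1 / 4 := by
    intro x y hy hxy
    have hy1 : y * y = y := hy.isIdempotentElem
    have h1 : ‖(x - y) * y‖ ≤ 1 / 2304 * 1 :=
      (norm_mul_le _ _).trans (mul_le_mul hxy hy.norm_LTwoOp_le (norm_nonneg _) (by norm_num))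
    have h2 : y - x * y = -((x - y) * y) := by rw [sub_mul, hy1]; abel
    have h3 : x - x * y = (x - y) - (x - y) * y := by rw [sub_mul, hy1]; abel
    refine ⟨?_, ?_⟩
    · rw [h2, norm_neg]; linarith
    · rw [h3]; linarith [norm_sub_le (x - y) ((x - y) * y)]
  obtain ⟨s, t, hsN, htN, hs, ht, hst⟩ := exists_hilbertSchmidt_factorization hab
  have hpqT : p - q ∈ traceClass (J ⊕ J) H :=
    sub_mem_traceClass haN hbN hpN hqN hsN htN hp hq hap hbq (hnp a p hp han).1 (hnp a p hp han).2
      (hnp b q hq hbn).1 (hnp b q hq hbn).2 hs ht hst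
  refine ⟨hpqT, ?_⟩
  obtain ⟨hw1, hw2, hSp⟩ := isStarProjection_add_conj (w := doubleSymm q) hp hq
    isStarProjection_leftProj star_swapOp swapOp_mul_self swapOp_conj_leftProj hpe hqe rfl
  have hwN : doubleSymm q ∈ equivariantOp (J ⊕ J) H :=
    doubleSymm_mem (S := (equivariantOp (J ⊕ J) H).toSubalgebra) swapOp_mem_equivariantOp hqN
  have hconjT : doubleSymm q * (p - q) * doubleSymm q ∈ traceClass (J ⊕ J) H :=
    mem_traceClass_mul hwN (mul_mem_traceClass hwN hpqT)
  have hwbM : doubleSymm b ∈ leftMultiplier (J ⊕ J) H :=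
    doubleSymm_mem swapOp_mem_leftMultiplier hbM
  have hwb : star (doubleSymm b) = doubleSymm b := star_doubleSymm hb
  have hZ : doubleSymm b * (a - b) * doubleSymm b ∈ finiteRank (J ⊕ J) H :=
    mul_mem_finiteRank_of_star (hwb.symm ▸ hwbM) (hwbM _ hab)
  have hn : ‖doubleSymm b * (a - b) * doubleSymm b - doubleSymm q * (p - q) * doubleSymm q‖
      ≤ 36 * (1 / 2304) := by
    refine norm_conj_sub_conj_le (by norm_num) (norm_le_one_of_symmetry hw1 hw2) ?_ ?_ ?_
    · linarith [norm_sub_le p q, hp.norm_LTwoOp_le, hq.norm_LTwoOp_le]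
    · linarith [norm_doubleSymm_sub_le b q]
    · rw [show a - b - (p - q) = (a - p) - (b - q) by abel]
      linarith [norm_sub_le (a - p) (b - q)]
  have hTr : hTrace (leftProj J H + doubleSymm q * (p - q) * doubleSymm q - leftProj J H)
      = hTrace (p - q) := by
    rw [add_sub_cancel_left, mul_assoc, hTrace_mul_comm hwN (mem_traceClass_mul hwN hpqT),
      mul_assoc, hw2, mul_one]
  rw [← hTr]
  refine exists_trKZero_eq_of_near (ζ := 1 / 64) le_rfl hSp
    (add_mem leftProj_mem_equivariantOp (mul_mem (mul_mem hwN (sub_mem hpN hqN)) hwN))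
    (by rwa [add_sub_cancel_left]) hZ ?_ ?_
  · rw [star_mul, star_mul, star_sub, ha, hb, hwb, mul_assoc]
  · rw [add_sub_add_left_eq_sub]
    exact hn.trans (by norm_num)

end IndexClass

/-! ### Representations on `ℓ²` of a free right `H`-set -/

section FreeSets

/-- An invariant subset on which a group acts freely is a disjoint union of copies of the group. -/
theorem exists_transversal {M Z : Type*} [Group M] [MulAction M Z] (Z₀ : Set Z)
    (hinv : ∀ (m : M), ∀ x ∈ Z₀, m • x ∈ Z₀) (hfree : ∀ (m : M), ∀ x ∈ Z₀, m • x = x → m = 1) :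
    ∃ K : Set Z, Function.Injective (fun p : K × M => p.2 • (p.1 : Z)) ∧
      Set.range (fun p : K × M => p.2 • (p.1 : Z)) = Z₀ := by
  let rep : Z → Z := fun x => (Quotient.mk (MulAction.orbitRel M Z) x).out
  have hrep : ∀ x, ∃ m : M, m • rep x = x := fun x => by
    have h : (MulAction.orbitRel M Z) (rep x) x := Quotient.mk_out x
    exact ((MulAction.orbitRel M Z).symm h)
  have hrep_smul : ∀ (m : M) x, rep (m • x) = rep x := fun m x =>
    congrArg Quotient.out (Quotient.sound (s := MulAction.orbitRel M Z) ⟨m, rfl⟩)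
  refine ⟨{x | x ∈ Z₀ ∧ rep x = x}, ?_, ?_⟩
  · rintro ⟨⟨x, hx, hxr⟩, m⟩ ⟨⟨y, hy, hyr⟩, m'⟩ h
    change m • x = m' • y at h
    have hxy : x = y := by
      rw [← hxr, ← hyr, ← hrep_smul m x, ← hrep_smul m' y, h]
    subst hxy
    have h1 : m'⁻¹ * m = 1 := hfree _ x hx (by rw [mul_smul, h, inv_smul_smul])
    rw [inv_mul_eq_one] at h1
    rw [h1]
  · ext x
    constructor
    · rintro ⟨⟨⟨y, hy, -⟩, m⟩, rfl⟩
      exact hinv m y hy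
    · intro hx
      obtain ⟨m, hm⟩ := hrep x
      have h1 : rep x ∈ Z₀ := by
        rw [eq_inv_smul_iff.2 hm]
        exact hinv _ _ hx
      have h2 : rep (rep x) = rep x := by
        conv_rhs => rw [← hm]
        rw [hrep_smul]
      exact ⟨⟨⟨rep x, h1, h2⟩, m⟩, hm⟩

/-- An action of `G` on `Δ` by `H`-equivariant maps, together with a parametrization by `K × G` of
an `H`-invariant subset on which `G` acts freely, `K` being a set of representatives of the
`G`-orbits. -/
structure PartialFreeAction (G H Δ K : Type*) [Group G] [Group H] [MulAction Hᵐᵒᵖ Δ] where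
  /-- the action -/
  act : G → Δ → Δ
  act_smul : ∀ g (h : Hᵐᵒᵖ) x, act g (h • x) = h • act g x
  /-- the parametrization of the free part -/
  emb : K × G ↪ Δ
  emb_mul : ∀ k g g', emb (k, g * g') = act g (emb (k, g'))
  smul_mem_range : ∀ (h : Hᵐᵒᵖ) x, h • x ∈ Set.range emb ↔ x ∈ Set.range emb

/-- Every projection in `M_ι(C*_r G)` has the same trace as a projection `p` that is a spectral
projection of a nearby self-adjoint matrix `a` over the group ring. -/
theorem exists_groupRingOp_projection {G ι : Type*} [Group G] [Fintype ι] {T : LTwoOp (ι × G)}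
    (hT : T ∈ blockAlgebra ι G) (hTp : IsStarProjection T) :
    ∃ a p : LTwoOp (ι × G), a ∈ groupRingOp ι G ∧ IsSelfAdjoint a ∧ IsStarProjection p ∧
      p ∈ blockAlgebra ι G ∧ Commute p a ∧ ‖p - a‖ ≤ 1 / 2304 ∧ hTrace p = hTrace T := by
  have hBN : ∀ S ∈ blockAlgebra ι G, S ∈ equivariantOp ι G := fun S hS =>
    finiteRank_le_equivariantOp (mem_finiteRank_of_blockAlgebra hS)
  obtain ⟨a, ha, hasa, han⟩ := exists_groupRingOp_near hT hTp.isSelfAdjoint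
    (ε := 1 / 18432) (by norm_num)
  obtain ⟨p, hp, hpn, hpa, hpB⟩ := exists_isStarProjection_near hasa (δ := 4 * (1 / 18432))
    (by norm_num) (norm_mul_self_sub_self_le hTp han.le (by norm_num))
  have hpB := hpB _ isClosed_blockAlgebra (groupRingOp_le_blockAlgebra ha)
  have hpT : hTrace (p - T) = 0 := by
    refine hTrace_sub_eq_zero hTp hp (hBN T hT) (hBN p hpB)
      (mem_traceClass_of_finite (hBN _ (sub_mem hpB hT))) ?_
    rw [show p - T = (p - a) + (a - T) by abel]
    linarith [norm_add_le (p - a) (a - T)]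
  rw [hTrace_sub (mem_traceClass_of_finite (hBN p hpB)) (mem_traceClass_of_finite (hBN T hT)),
    sub_eq_zero] at hpT
  exact ⟨a, p, ha, hasa, hp, hpB, hpa, hpn.trans (by norm_num), hpT⟩

/-- The point of the doubled index set `((ι × I) ⊕ (ι × I)) × H` corresponding to a point of
`ι × Δ`, where `Δ` is identified with `I × H`; only the first half is used. -/
def chartPoint {H Δ I ι : Type*} (θ : Δ ≃ I × H) (i : ι) (x : Δ) : ((ι × I) ⊕ (ι × I)) × H :=
  (Sum.inl (i, (θ x).1), (θ x).2)

theorem chartPoint_injective {H Δ I ι : Type*} (θ : Δ ≃ I × H) {i j : ι} {x y : Δ}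
    (h : chartPoint θ i x = chartPoint θ j y) : i = j ∧ x = y := by
  simp only [chartPoint, Prod.ext_iff, Sum.inl.injEq] at h
  exact ⟨h.1.1, θ.injective (Prod.ext h.1.2 h.2)⟩

variable {G H Δ I ι : Type*} [Group G] [Group H] [MulAction Hᵐᵒᵖ Δ]

/-- The chart `θ` identifies `Δ` with the free right `H`-set `I × H`. -/
def IsEquivariantChart (θ : Δ ≃ I × H) : Prop :=
  ∀ (k : H) (x : Δ), θ (MulOpposite.op k • x) = ((θ x).1, (θ x).2 * k)

namespace PartialFreeAction

variable {K : Type*} (Φ : PartialFreeAction G H Δ K) (θ : Δ ≃ I × H)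

/-- The points of the free part, as points of the doubled index set. -/
def chart (ι : Type*) : K × (ι × G) ↪ ((ι × I) ⊕ (ι × I)) × H where
  toFun p := chartPoint θ p.2.1 (Φ.emb (p.1, p.2.2))
  inj' := by
    rintro ⟨k, i, g⟩ ⟨l, j, g'⟩ h
    obtain ⟨h1, h2⟩ := chartPoint_injective θ h
    have h3 := Φ.emb.injective h2
    simp only [Prod.ext_iff] at h1 h3 ⊢
    exact ⟨h3.1, h1, h3.2⟩

theorem chartPoint_mem_range_chart {i : ι} {x : Δ} :
    chartPoint θ i x ∈ Set.range (Φ.chart θ ι) ↔ x ∈ Set.range Φ.emb := by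
  constructor
  · rintro ⟨⟨k, j, g⟩, h⟩
    exact ⟨(k, g), (chartPoint_injective θ h).2⟩
  · rintro ⟨⟨k, g⟩, rfl⟩
    exact ⟨(k, i, g), rfl⟩

theorem inr_notMem_range_chart (j : ι × I) (h : H) :
    (Sum.inr j, h) ∉ Set.range (Φ.chart θ ι) := by
  rintro ⟨p, hp⟩
  exact Sum.inl_ne_inr (Prod.ext_iff.1 hp).1

/-- The representation of `M_ι(C*_r G)` on `ℓ²(ι × Δ)`, in the first half of the doubled space,
that vanishes outside of the free part. -/
noncomputable def rep (ι : Type*) :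
    LTwoOp (ι × G) →⋆ₙₐ[ℂ] LTwoOp (((ι × I) ⊕ (ι × I)) × H) :=
  inflate (Φ.chart θ ι)

theorem rep_delta_inr (T : LTwoOp (ι × G)) (j : ι × I) (h : H) :
    Φ.rep θ ι T (LTwo.delta (Sum.inr j, h)) = 0 :=
  inflate_delta_of_notMem _ _ (Φ.inr_notMem_range_chart θ j h)

theorem rep_delta_of_notMem (T : LTwoOp (ι × G)) {i : ι} {x : Δ} (hx : x ∉ Set.range Φ.emb) :
    Φ.rep θ ι T (LTwo.delta (chartPoint θ i x)) = 0 :=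
  inflate_delta_of_notMem _ _ fun h => hx ((Φ.chartPoint_mem_range_chart θ).1 h)

theorem rep_mul_leftProj (T : LTwoOp (ι × G)) :
    Φ.rep θ ι T * leftProj (ι × I) H = Φ.rep θ ι T := by
  refine LTwo.clm_ext fun p => ?_
  obtain ⟨j | j, h⟩ := p
  · rw [mul_apply_eq_comp, leftProj_delta_inl]
  · rw [mul_apply_eq_comp, leftProj_delta_inr, rep_delta_inr, map_zero]

theorem rep_unitOp_delta [DecidableEq ι] (i j j' : ι) (g : G) {x : Δ}
    (hx : x ∈ Set.range Φ.emb) :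
    Φ.rep θ ι (unitOp i j (leftReg g)) (LTwo.delta (chartPoint θ j' x))
      = if j' = j then LTwo.delta (chartPoint θ i (Φ.act g x)) else 0 := by
  obtain ⟨⟨k, g'⟩, rfl⟩ := hx
  have h1 := inflate_delta (Φ.chart θ ι) (unitOp i j (leftReg g)) k (j', g')
  refine h1.trans ?_
  rw [unitOp_apply]
  split_ifs with h
  · subst h
    have h2 : restrict (slice G j') (LTwo.delta (j', g')) = LTwo.delta g' :=
      restrict_delta (slice G j') g'
    rw [h2, leftReg_delta, extendZero_delta, extendZero_delta, ← Φ.emb_mul]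
    rfl
  · rw [restrict_delta_of_notMem, map_zero, map_zero, map_zero]
    rintro ⟨y, hy⟩
    exact h (Prod.ext_iff.1 hy).1.symm

variable {θ}

theorem chartPoint_symm (hθ : IsEquivariantChart θ) (i : ι) (a : I) (h : H) :
    ((Sum.inl (i, a), h) : ((ι × I) ⊕ (ι × I)) × H)
      = chartPoint θ i (MulOpposite.op h • θ.symm (a, 1)) := by
  simp [chartPoint, hθ h]

theorem shift_delta_chartPoint (hθ : IsEquivariantChart θ) (i : ι) (k : H) (x : Δ) :
    shift ((ι × I) ⊕ (ι × I)) k (LTwo.delta (chartPoint θ i x))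
      = LTwo.delta (chartPoint θ i (MulOpposite.op k • x)) := by
  rw [chartPoint, shift_delta, chartPoint, hθ]

theorem rep_unitOp_mem_equivariantOp (hθ : IsEquivariantChart θ) (i j : ι) (g : G) :
    Φ.rep θ ι (unitOp i j (leftReg g)) ∈ equivariantOp ((ι × I) ⊕ (ι × I)) H := by
  classical
  rw [mem_equivariantOp_iff_commute]
  intro k
  refine LTwo.clm_ext fun p => ?_
  rw [mul_apply_eq_comp, mul_apply_eq_comp]
  obtain ⟨⟨j', a⟩ | j', h⟩ := p
  · rw [chartPoint_symm hθ, shift_delta_chartPoint hθ]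
    generalize MulOpposite.op h • θ.symm (a, 1) = x
    by_cases hx : x ∈ Set.range Φ.emb
    · rw [rep_unitOp_delta Φ θ i j j' g hx,
        rep_unitOp_delta Φ θ i j j' g ((Φ.smul_mem_range _ _).2 hx), Φ.act_smul]
      split_ifs
      · exact shift_delta_chartPoint hθ _ _ _
      · exact map_zero _
    · rw [rep_delta_of_notMem Φ θ _ hx,
        rep_delta_of_notMem Φ θ _ fun h' => hx ((Φ.smul_mem_range _ _).1 h'), map_zero]
  · rw [shift_delta, rep_delta_inr, rep_delta_inr, map_zero]

theorem rep_mem_equivariantOp [Fintype ι] (hθ : IsEquivariantChart θ) {T : LTwoOp (ι × G)}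
    (hT : T ∈ blockAlgebra ι G) : Φ.rep θ ι T ∈ equivariantOp ((ι × I) ⊕ (ι × I)) H := by
  have h1 : ∀ a ∈ groupRingOp ι G, Φ.rep θ ι a ∈ equivariantOp ((ι × I) ⊕ (ι × I)) H := by
    intro a ha
    induction ha using Submodule.span_induction with
    | mem T hT =>
      obtain ⟨i, j, g, rfl⟩ := hT
      exact Φ.rep_unitOp_mem_equivariantOp hθ i j g
    | zero => rw [map_zero]; exact zero_mem _
    | add S T _ _ hS hT => rw [map_add]; exact add_mem hS hT
    | smul c T _ hT => rw [map_smul]; exact SMulMemClass.smul_mem c hT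
  have h2 := map_mem_closure (continuous_inflate (Φ.chart θ ι)) (mem_closure_groupRingOp hT) h1
  rwa [isClosed_equivariantOp.closure_eq] at h2

theorem rep_mem_leftMultiplier (hθ : IsEquivariantChart θ) {T : LTwoOp (ι × G)}
    (hT : T ∈ groupRingOp ι G) : Φ.rep θ ι T ∈ leftMultiplier ((ι × I) ⊕ (ι × I)) H := by
  classical
  induction hT using Submodule.span_induction with
  | mem T hT =>
    obtain ⟨i, j, g, rfl⟩ := hT
    refine mem_leftMultiplier_of_monomial fun p => ?_
    obtain ⟨j', a⟩ | j' := p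
    · by_cases hx : j' = j ∧ θ.symm (a, 1) ∈ Set.range Φ.emb
      · obtain ⟨rfl, hx⟩ := hx
        refine Or.inr ⟨Sum.inl (i, (θ (Φ.act g (θ.symm (a, 1)))).1),
          (θ (Φ.act g (θ.symm (a, 1)))).2, fun h => ?_⟩
        rw [chartPoint_symm hθ, rep_unitOp_delta Φ θ i j' j' g ((Φ.smul_mem_range _ _).2 hx),
          if_pos rfl, Φ.act_smul, chartPoint, hθ]
      · refine Or.inl fun h => ?_
        rw [chartPoint_symm hθ]
        by_cases hx' : MulOpposite.op h • θ.symm (a, 1) ∈ Set.range Φ.emb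
        · rw [rep_unitOp_delta Φ θ i j j' g hx', if_neg]
          exact fun hj => hx ⟨hj, (Φ.smul_mem_range _ _).1 hx'⟩
        · exact rep_delta_of_notMem Φ θ _ hx'
    · exact Or.inl fun h => Φ.rep_delta_inr θ _ j' h
  | zero => rw [map_zero]; exact zero_mem _
  | add S T _ _ hS hT => rw [map_add]; exact add_mem hS hT
  | smul c T _ hT => rw [map_smul]; exact Subalgebra.smul_mem _ hT c

/-- If each group element acts in the same way on the free parts of two actions, up to finitely many
`H`-orbits, then the two representations agree on the group ring up to finite rank operators. -/
theorem rep_sub_rep_mem_finiteRank [Fintype ι] {K' : Type*} (Ψ : PartialFreeAction G H Δ K')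
    (hθ : IsEquivariantChart θ)
    (hfin : ∀ g : G, ∃ F : Finset I, ∀ a ∉ F, θ.symm (a, 1) ∈ Set.range Φ.emb ∧
      θ.symm (a, 1) ∈ Set.range Ψ.emb ∧ Φ.act g (θ.symm (a, 1)) = Ψ.act g (θ.symm (a, 1)))
    {T : LTwoOp (ι × G)} (hT : T ∈ groupRingOp ι G) :
    Φ.rep θ ι T - Ψ.rep θ ι T ∈ finiteRank ((ι × I) ⊕ (ι × I)) H := by
  classical
  induction hT using Submodule.span_induction with
  | mem T hT =>
    obtain ⟨i, j, g, rfl⟩ := hT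
    have hmem : unitOp i j (leftReg g) ∈ groupRingOp ι G := Submodule.subset_span ⟨i, j, g, rfl⟩
    obtain ⟨F, hF⟩ := hfin g
    refine mem_finiteRank_of_leftMultiplier
      (sub_mem (Φ.rep_mem_leftMultiplier hθ hmem) (Ψ.rep_mem_leftMultiplier hθ hmem))
      ((Finset.univ ×ˢ F).map Function.Embedding.inl) fun p hp h => ?_
    obtain ⟨j', a⟩ | j' := p
    · have ha : a ∉ F := fun ha => hp (by simpa using ha)
      obtain ⟨h1, h2, h3⟩ := hF a ha
      rw [sub_apply, chartPoint_symm hθ,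
        rep_unitOp_delta Φ θ i j j' g ((Φ.smul_mem_range _ _).2 h1),
        rep_unitOp_delta Ψ θ i j j' g ((Ψ.smul_mem_range _ _).2 h2), Φ.act_smul, Ψ.act_smul, h3,
        sub_self]
    · rw [sub_apply, rep_delta_inr, rep_delta_inr, sub_zero]
  | zero => rw [map_zero, map_zero, sub_zero]; exact zero_mem _
  | add S T _ _ hS hT =>
    rw [map_add, map_add, add_sub_add_comm]
    exact add_mem hS hT
  | smul c T _ hT =>
    rw [map_smul, map_smul, ← smul_sub]
    exact Submodule.smul_mem _ c hT

theorem entry_rep_inr (T : LTwoOp (ι × G)) (p : ((ι × I) ⊕ (ι × I)) × H) (j : ι × I) (h : H) :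
    entry (Φ.rep θ ι T) p (Sum.inr j, h) = 0 := by
  rw [entry, rep_delta_inr]
  rfl

theorem entry_rep_diag (hθ : IsEquivariantChart θ) {T : LTwoOp (ι × G)}
    (hT : T ∈ equivariantOp ι G) (i : ι) (a : I)
    [Decidable (θ.symm (a, 1) ∈ Set.range Φ.emb)] :
    entry (Φ.rep θ ι T) (Sum.inl (i, a), 1) (Sum.inl (i, a), 1)
      = if θ.symm (a, 1) ∈ Set.range Φ.emb then entry T (i, 1) (i, 1) else 0 := by
  rw [chartPoint_symm hθ, MulOpposite.op_one, one_smul]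
  split_ifs with hx
  · obtain ⟨⟨k, g⟩, hkg⟩ := hx
    rw [← hkg, ← entry_diag hT i g]
    exact (congrArg (fun f => f (Φ.chart θ ι (k, i, g)))
      (inflate_delta (Φ.chart θ ι) T k (i, g))).trans
        (extendZero_apply ((slice (ι × G) k).trans (Φ.chart θ ι)) _ (i, g))
  · rw [entry, rep_delta_of_notMem Φ θ T hx]
    rfl

/-- The difference of two representations, one of which is free and the other one free outside of
`r` orbits of `H`, multiplies the trace by `r`. -/
theorem hTrace_rep_sub_rep [Fintype ι] {K' : Type*} (Ψ : PartialFreeAction G H Δ K')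
    (hθ : IsEquivariantChart θ) {T : LTwoOp (ι × G)} (hT : T ∈ equivariantOp ι G)
    (hΦ : ∀ x, x ∈ Set.range Φ.emb) {r : ℕ} (s : Fin r ↪ I)
    (hΨ : ∀ a, θ.symm (a, 1) ∈ Set.range Ψ.emb ↔ a ∉ Set.range s) :
    hTrace (Φ.rep θ ι T - Ψ.rep θ ι T) = r * hTrace T := by
  classical
  let e : ι × Fin r ↪ (ι × I) ⊕ (ι × I) :=
    ((Function.Embedding.refl ι).prodMap s).trans Function.Embedding.inl
  have hval : ∀ i a, entry (Φ.rep θ ι T - Ψ.rep θ ι T) (Sum.inl (i, a), 1) (Sum.inl (i, a), 1)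
      = if a ∈ Set.range s then entry T (i, 1) (i, 1) else 0 := by
    intro i a
    rw [entry_sub, entry_rep_diag Φ hθ hT, entry_rep_diag Ψ hθ hT, if_pos (hΦ _), hΨ]
    by_cases ha : a ∈ Set.range s
    · rw [if_neg (not_not.2 ha), if_pos ha, sub_zero]
    · rw [if_pos ha, if_neg ha, sub_self]
  have hsupp : Function.support (fun j : (ι × I) ⊕ (ι × I) =>
      entry (Φ.rep θ ι T - Ψ.rep θ ι T) (j, 1) (j, 1)) ⊆ Set.range e := by
    rintro (⟨i, a⟩ | j) hj
    · rw [Function.mem_support, hval] at hj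
      obtain ⟨b, rfl⟩ : a ∈ Set.range s := by
        by_contra h
        exact hj (if_neg h)
      exact ⟨(i, b), rfl⟩
    · refine absurd ?_ hj
      beta_reduce
      rw [entry_sub, entry_rep_inr, entry_rep_inr, sub_zero]
  have hval' : ∀ p : ι × Fin r, entry (Φ.rep θ ι T - Ψ.rep θ ι T) (e p, 1) (e p, 1)
      = entry T (p.1, 1) (p.1, 1) := fun p => (hval p.1 (s p.2)).trans (if_pos ⟨p.2, rfl⟩)
  rw [hTrace, ← e.injective.tsum_eq hsupp, tsum_fintype, hTrace, tsum_fintype,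
    Fintype.sum_prod_type, Finset.mul_sum]
  refine Finset.sum_congr rfl fun i _ => ?_
  simp only [hval', Finset.sum_const, Finset.card_univ, Fintype.card_fin, nsmul_eq_mul]

theorem star_rep (θ : Δ ≃ I × H) {a : LTwoOp (ι × G)} (ha : IsSelfAdjoint a) :
    star (Φ.rep θ ι a) = Φ.rep θ ι a := by
  rw [← map_star, ha.star_eq]

theorem rep_commute (θ : Δ ≃ I × H) {a p : LTwoOp (ι × G)} (h : Commute p a) :
    Φ.rep θ ι a * Φ.rep θ ι p = Φ.rep θ ι p * Φ.rep θ ι a := by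
  rw [← map_mul, ← map_mul, h.eq]

theorem norm_rep_sub_rep_le (θ : Δ ≃ I × H) (a p : LTwoOp (ι × G)) :
    ‖Φ.rep θ ι a - Φ.rep θ ι p‖ ≤ ‖p - a‖ := by
  rw [← map_sub, norm_sub_rev p a]
  exact norm_inflate_le _ _

/-- For two actions as above, `r` times the trace of a projection in `M_n(C*_r G)` is a value of
`tr_H` on `K₀(C*_r H)`. -/
theorem exists_trKZero_eq_mul_hTrace {n : ℕ} {K' : Type*} (Ψ : PartialFreeAction G H Δ K')
    (hθ : IsEquivariantChart θ)
    (hfin : ∀ g : G, ∃ F : Finset I, ∀ a ∉ F, θ.symm (a, 1) ∈ Set.range Φ.emb ∧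
      θ.symm (a, 1) ∈ Set.range Ψ.emb ∧ Φ.act g (θ.symm (a, 1)) = Ψ.act g (θ.symm (a, 1)))
    (hΦ : ∀ x, x ∈ Set.range Φ.emb) {r : ℕ} (s : Fin r ↪ I)
    (hΨ : ∀ a, θ.symm (a, 1) ∈ Set.range Ψ.emb ↔ a ∉ Set.range s)
    {T : LTwoOp (Fin n × G)} (hT : T ∈ blockAlgebra (Fin n) G) (hTp : IsStarProjection T) :
    ∃ x : KZero (ReducedCStar H), (trKZero H x : ℂ) = r * hTrace T := by
  obtain ⟨a, p, ha, hasa, hp, hpB, hpa, hpn, hpT⟩ := exists_groupRingOp_projection hT hTp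
  have haB := groupRingOp_le_blockAlgebra ha
  obtain ⟨-, x, hx⟩ := exists_trKZero_eq_hTrace_sub (Φ.rep_mem_equivariantOp hθ haB)
    (Ψ.rep_mem_equivariantOp hθ haB) (Φ.rep_mem_equivariantOp hθ hpB)
    (Ψ.rep_mem_equivariantOp hθ hpB) (Φ.star_rep θ hasa) (Ψ.star_rep θ hasa)
    (hp.map (Φ.rep θ (Fin n))) (hp.map (Ψ.rep θ (Fin n))) (Φ.rep_mul_leftProj θ p)
    (Ψ.rep_mul_leftProj θ p) (Φ.rep_commute θ hpa) (Ψ.rep_commute θ hpa)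
    ((Φ.norm_rep_sub_rep_le θ a p).trans hpn) ((Ψ.norm_rep_sub_rep_le θ a p).trans hpn)
    (Φ.rep_sub_rep_mem_finiteRank Ψ hθ hfin ha) (Ψ.rep_mem_leftMultiplier hθ ha)
  refine ⟨x, ?_⟩
  rw [hx, ← hpT, hTrace_rep_sub_rep Φ Ψ hθ
    (finiteRank_le_equivariantOp (mem_finiteRank_of_blockAlgebra hpB)) hΦ s hΨ]

end PartialFreeAction

end FreeSets

theorem theorem1 {G H Δ Ω : Type*} [Group G] [Group H] [Countable G] [Countable H]
    [MulAction G Δ] [MulAction Hᵐᵒᵖ Δ] [SMulCommClass G Hᵐᵒᵖ Δ]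
    [MulAction G Ω] [MulAction Hᵐᵒᵖ Ω] [SMulCommClass G Hᵐᵒᵖ Ω]
    (A : Set ℝ) (hA : Set.range (trKZero H) ⊆ A)
    (hHΔ : ∀ (h : Hᵐᵒᵖ) (x : Δ), h • x = x → h = 1)
    (hHΩ : ∀ (h : Hᵐᵒᵖ) (x : Ω), h • x = x → h = 1)
    (hGΔ : ∀ (g : G) (x : Δ), g • x = x → g = 1)
    (Ω' X : Set Ω) (hunion : Ω' ∪ X = Set.univ) (hdisj : Disjoint Ω' X)
    (hΩ' : ∀ (g : G), ∀ x ∈ Ω', g • x ∈ Ω')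
    (hGΩ' : ∀ (g : G), ∀ x ∈ Ω', g • x = x → g = 1)
    (r : ℕ) (hr : 1 ≤ r)
    (hX : ∃ s : Fin r → Ω, (∀ i j, s i ∈ MulAction.orbit Hᵐᵒᵖ (s j) → i = j) ∧
      X = ⋃ i, MulAction.orbit Hᵐᵒᵖ (s i))
    (φ : Δ ≃ Ω) (hφ : ∀ (h : Hᵐᵒᵖ) (x : Δ), φ (h • x) = h • φ x)
    (hR : ∀ g : G, ∃ F : Finset Δ,
      {x : Δ | φ (g • x) ≠ g • φ x} ⊆ ⋃ y ∈ F, MulAction.orbit Hᵐᵒᵖ y) :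
    Set.range (trKZero G) ⊆ (fun a : ℝ => 1 / (r : ℝ) * a) '' A := by
  classical
  obtain ⟨s, hs, hXs⟩ := hX
  have hcompl : ∀ x, x ∈ Ω' ↔ x ∉ X := fun x =>
    ⟨fun h h' => Set.disjoint_left.1 hdisj h h', fun h =>
      ((hunion ▸ Set.mem_univ x : x ∈ Ω' ∪ X)).resolve_right h⟩
  have hXsmul : ∀ (h : Hᵐᵒᵖ) x, h • x ∈ X ↔ x ∈ X := by
    intro h x
    simp only [hXs, Set.mem_iUnion, ← MulAction.orbitRel_apply]
    exact exists_congr fun i =>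
      ⟨fun hi => (MulAction.orbitRel Hᵐᵒᵖ Ω).trans ((MulAction.orbitRel Hᵐᵒᵖ Ω).symm ⟨h, rfl⟩) hi,
        fun hi => (MulAction.orbitRel Hᵐᵒᵖ Ω).trans ⟨h, rfl⟩ hi⟩
  -- identify `Δ` with `I × H`
  obtain ⟨I, hIinj, hIrange⟩ := exists_transversal (M := Hᵐᵒᵖ) (Z := Δ) Set.univ
    (fun _ _ _ => Set.mem_univ _) fun h x _ => hHΔ h x
  let θ : Δ ≃ I × H := ((Equiv.ofBijective _ ⟨hIinj, Set.range_eq_univ.1 hIrange⟩).symm).trans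
    ((Equiv.refl I).prodCongr MulOpposite.opEquiv.symm)
  have hθsymm : ∀ (a : I) (h : H), θ.symm (a, h) = MulOpposite.op h • (a : Δ) := fun a h => rfl
  have hθ : IsEquivariantChart θ := by
    intro k x
    obtain ⟨⟨a, h⟩, rfl⟩ := θ.symm.surjective x
    rw [← θ.symm.injective.eq_iff, Equiv.symm_apply_apply, Equiv.apply_symm_apply, hθsymm, hθsymm,
      MulOpposite.op_mul, mul_smul]
  have hθfst : ∀ (h : Hᵐᵒᵖ) x, (θ (h • x)).1 = (θ x).1 := fun h x => by
    have h1 := congrArg Prod.fst (hθ h.unop x)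
    exact h1
  have horbit : ∀ x y : Δ, (θ x).1 = (θ y).1 → ∃ h : Hᵐᵒᵖ, h • y = x := by
    intro x y hxy
    refine ⟨MulOpposite.op ((θ y).2⁻¹ * (θ x).2), θ.injective ?_⟩
    rw [hθ, ← hxy, mul_inv_cancel_left]
  -- the action of `G` on `Δ`, free by assumption
  obtain ⟨K, hKinj, hKrange⟩ := exists_transversal (M := G) (Z := Δ) Set.univ
    (fun _ _ _ => Set.mem_univ _) fun g x _ => hGΔ g x
  have hKall : ∀ x, x ∈ Set.range (fun p : K × G => p.2 • (p.1 : Δ)) :=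
    fun x => hKrange ▸ Set.mem_univ x
  let Φ : PartialFreeAction G H Δ K :=
    { act := fun g x => g • x
      act_smul := fun g h x => smul_comm g h x
      emb := ⟨_, hKinj⟩
      emb_mul := fun k g g' => mul_smul g g' (k : Δ)
      smul_mem_range := fun h x => by
        exact iff_of_true (hKall _) (hKall _) }
  have hΦ : ∀ x, x ∈ Set.range Φ.emb := hKall
  -- the action of `G` on `Ω`, transported to `Δ`, with free part `Ω'`
  obtain ⟨L, hLinj, hLrange⟩ := exists_transversal (M := G) (Z := Ω) Ω' hΩ' hGΩ'
  have hφsymm : ∀ (h : Hᵐᵒᵖ) (x : Ω), φ.symm (h • x) = h • φ.symm x := fun h x => by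
    rw [Equiv.symm_apply_eq, hφ, Equiv.apply_symm_apply]
  have hΨmem : ∀ x, x ∈ Set.range (fun p : L × G => φ.symm (p.2 • (p.1 : Ω))) ↔ φ x ∈ Ω' := by
    intro x
    rw [← hLrange]
    simp only [Set.mem_range, Equiv.symm_apply_eq]
  let Ψ : PartialFreeAction G H Δ L :=
    { act := fun g x => φ.symm (g • φ x)
      act_smul := fun g h x => by rw [hφ, smul_comm g h, hφsymm]
      emb := ⟨fun p => φ.symm (p.2 • (p.1 : Ω)), φ.symm.injective.comp hLinj⟩
      emb_mul := fun k g g' => by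
        change φ.symm ((g * g') • (k : Ω)) = φ.symm (g • φ (φ.symm (g' • (k : Ω))))
        rw [Equiv.apply_symm_apply, mul_smul]
      smul_mem_range := fun h x => by
        refine (hΨmem _).trans (Iff.trans ?_ (hΨmem x).symm)
        rw [hφ, hcompl, hcompl, hXsmul] }
  -- the orbits in `X`, as elements of `I`
  let t : Fin r ↪ I := ⟨fun i => (θ (φ.symm (s i))).1, fun i j hij => by
    obtain ⟨h, hh⟩ := horbit _ _ hij
    refine hs i j ⟨h, ?_⟩
    rw [← hφsymm] at hh
    exact φ.symm.injective hh⟩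
  have hΨ : ∀ a, θ.symm (a, 1) ∈ Set.range Ψ.emb ↔ a ∉ Set.range t := by
    intro a
    refine (hΨmem _).trans ((hcompl _).trans (not_congr ?_))
    rw [hXs, Set.mem_iUnion]
    refine exists_congr fun i => ⟨?_, fun hi => ?_⟩
    · rintro ⟨h, hh⟩
      change (θ (φ.symm (s i))).1 = a
      rw [← hθfst h, ← hφsymm]
      change h • s i = _ at hh
      rw [hh, Equiv.symm_apply_apply, Equiv.apply_symm_apply]
    · obtain ⟨h, hh⟩ := horbit (θ.symm (a, 1)) (φ.symm (s i))
        (by rw [Equiv.apply_symm_apply]; exact hi.symm)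
      refine ⟨h, ?_⟩
      change h • s i = _
      rw [← hh, hφ, Equiv.apply_symm_apply]
  have hfin : ∀ g : G, ∃ F : Finset I, ∀ a ∉ F, θ.symm (a, 1) ∈ Set.range Φ.emb ∧
      θ.symm (a, 1) ∈ Set.range Ψ.emb ∧ Φ.act g (θ.symm (a, 1)) = Ψ.act g (θ.symm (a, 1)) := by
    intro g
    obtain ⟨F, hF⟩ := hR g
    refine ⟨F.image (fun y => (θ y).1) ∪ Finset.univ.map t, fun a ha => ⟨hΦ _, ?_, ?_⟩⟩
    · rw [hΨ]
      rintro ⟨i, hi⟩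
      exact ha (Finset.mem_union_right _ (Finset.mem_map.2 ⟨i, Finset.mem_univ i, hi⟩))
    · change g • θ.symm (a, 1) = φ.symm (g • φ (θ.symm (a, 1)))
      rw [Equiv.eq_symm_apply]
      by_contra hne
      obtain ⟨y, hy, h, hh⟩ := Set.mem_iUnion₂.1 (hF hne)
      refine ha (Finset.mem_union_left _ (Finset.mem_image.2 ⟨y, hy, ?_⟩))
      change h • y = _ at hh
      rw [← hθfst h, hh, Equiv.apply_symm_apply]
  rintro _ ⟨z, rfl⟩
  obtain ⟨n, m, S, T, hS, hT, hSp, hTp, hz⟩ := trKZero_eq_sub z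
  obtain ⟨x, hx⟩ := Φ.exists_trKZero_eq_mul_hTrace Ψ hθ hfin hΦ t hΨ hS hSp
  obtain ⟨y, hy⟩ := Φ.exists_trKZero_eq_mul_hTrace Ψ hθ hfin hΦ t hΨ hT hTp
  have hxy : trKZero H (x - y) = r * trKZero G z := by
    have : ((trKZero H (x - y) : ℝ) : ℂ) = ((r * trKZero G z : ℝ) : ℂ) := by
      rw [map_sub, Complex.ofReal_sub, hx, hy, Complex.ofReal_mul, hz, Complex.ofReal_natCast]
      ring
    exact_mod_cast this
  have hr0 : (r : ℝ) ≠ 0 := Nat.cast_ne_zero.2 (by omega)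
  refine ⟨trKZero H (x - y), hA ⟨_, rfl⟩, ?_⟩
  change 1 / (r : ℝ) * trKZero H (x - y) = trKZero G z
  rw [hxy]
  field_simp
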